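/- Let $G=(V,E)$ be a finite directed graph without self-loops, $n=|V|$, $m=|E|$. A *shortcut of diameter $D$* is a set $H$ of pairs of distinct vertices, disjoint from $E$, such that $G\cup H$ has the same reachable pairs as $G$ and every pair reachable in $G$ is joined by a walk of at most $D$ edges in $G\cup H$. $H$ is *certified* if for each $(u,v)\in H$ there is $w$ with $(u,w),(w,v)\in E\cup H$. The *certification complexity* of $H$ is the smallest size of a certified shortcut $H'\supseteq H$. Consider the following algorithm. 1. Choose a root in every strongly connected component and contract the components, obtaining a DAG $G_0=(V_0,E_0)$ on the roots (if $G$ is a DAG then $G_0=G$). Let $\ell$ be an integer with $c_1\sqrt{|V_0|}\le \ell\le c_2\sqrt n$. 2. Take any integral minimum-cost flow of value $\ell$ from $s$ to $t$ in the network with nodes $s,t$ and $v^{in},v^{out}$ for $v\in V_0$, and arcs: $v^{in}\to v^{out}$ of capacity $1$ and cost $-1$; a parallel arc $v^{in}\to v^{out}$, $s\to v^{in}$ and $v^{out}\to t$ ($v\in V_0$), and $v^{out}\to u^{in}$ for $(v,u)\in E_0$, all of capacity $\infty$ and cost $0$. Contract each pair $v^{in},v^{out}$ to $v$. 3. Give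 the path indices $1,\dots,\ell$ priorities by a uniformly random permutation. At $s$ put a treap (root = smallest priority) holding the sequence $1,\dots,\ell$; all other nodes start with an empty treap. Process $s$ and then the vertices of $V_0$ in any topological order. To process $x$: if $x\neq s$ and its treap is nonempty, append $x$ to the chain $C_i$, where $i$ is the root of the treap; then go through the edges $(x,y)$ leaving $x$ (including those to $t$) in any order, split off from the treap as many elements as $(x,y)$ carries flow, and join them (on the right) to the treap at $y$. Here split off means the first elements in treap order. Split and join are the standard recursive treap operations. 4. Shortcut each chain $C_i$ by divide and conquer: connect every vertex before the middle vertex to it, connect it to every vertex after it, and recurse on both halves. Output the set $H$ of all these edges together with the edges in both directions between every vertex and the root of its component, omitting the edges already in $E$. There is $k\in\mathbb N$ such that for all $c_1,c_2>0$ there is $C$, and for every $a\in\mathbb N$ there is $C'$, such that for every $G$ and all choices made in the algorithm: - for all priorities, $H$ is a shortcut of diameter at most $C\sqrt n$ and $|H|\le C\,n(1+\log n)^k$; - with probability at least $1-n^{-a}$ over the priorities, the treap operations make at most $C'(n+m)(1+\log n)$ recursive calls in total, and the certification complexity of $H$ is at most $C'\,m(1+\log n)^k$, i.e. $\tilde O(m)$.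 -/

import Mathlib

universe u

namespace CertShortcut

section Shortcuts

variable {V : Type u} [DecidableEq V]

/-- `v` is reachable from `u` in the directed graph with edge set `E`. -/
def Reaches (E : Finset (V × V)) : V → V → Prop :=
  Relation.ReflTransGen (fun a b => (a, b) ∈ E)

/-- There is a walk from `u` to `v` with exactly `k` edges. -/
def HasWalk (E : Finset (V × V)) : ℕ → V → V → Prop
  | 0, u, v => u = v
  | k + 1, u, v => ∃ w, (u, w) ∈ E ∧ HasWalk E k w v

/-- `H` is a shortcut of diameter `D` for the graph with edge set `E`: a set of additional edges
(pairs of distinct vertices that are not edges yet) that does not create new reachable pairs, and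
with which every reachable pair is joined by a walk of at most `D` edges. -/
structure IsShortcut (E H : Finset (V × V)) (D : ℕ) : Prop where
  loopless : ∀ v, (v, v) ∉ H
  additional : Disjoint E H
  not_reaches : ∀ s t, ¬ Reaches E s t → ¬ Reaches (E ∪ H) s t
  short_walk : ∀ s t, Reaches E s t → ∃ k ≤ D, HasWalk (E ∪ H) k s t

/-- Every edge of `H` is certified by two edges of `E ∪ H`. -/
def IsCertified (E H : Finset (V × V)) : Prop :=
  ∀ u v, (u, v) ∈ H → ∃ w, (u, w) ∈ E ∪ H ∧ (w, v) ∈ E ∪ H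

/-- The certification complexity of `H`: the smallest size of a certified shortcut that
contains `H` (and `⊤` if there is none). -/
noncomputable def certComplexity (E H : Finset (V × V)) : ℕ∞ :=
  ⨅ H' ∈ {H' : Finset (V × V) | H ⊆ H' ∧ IsCertified E H' ∧ ∃ D, IsShortcut E H' D},
    (H'.card : ℕ∞)

/-- The divide-and-conquer shortcut of a chain: every vertex before the middle vertex gets an
edge to it, the middle vertex gets an edge to every vertex after it, and the two halves are treated
recursively. -/
def chainShortcut (L : List V) : Finset (V × V) :=
  match h : L.drop (L.length / 2) with
  | [] => ∅
  | mid :: R =>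
      (L.take (L.length / 2)).toFinset ×ˢ {mid} ∪ {mid} ×ˢ R.toFinset ∪
        chainShortcut (L.take (L.length / 2)) ∪ chainShortcut R
termination_by L.length
decreasing_by
  all_goals
    have h' := congrArg List.length h
    simp only [List.length_drop, List.length_cons] at h'
    first
      | (simp only [List.length_take]; omega)
      | omega

end Shortcuts

section Treaps

variable {ι : Type} {α : Type*} [LinearOrder α]

/-- The treap operation JOIN, for the priorities `p`; elements of smaller priority are
higher up. -/
def join (p : ι → α) : BinaryTree ι → BinaryTree ι → BinaryTree ι
  | .nil, T => T
  | .node a l r, .nil => .node a l r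
  | .node a l r, .node b l' r' =>
      if p a < p b then .node a l (join p r (.node b l' r'))
      else .node b (join p (.node a l r) l') r'
termination_by S T => S.numNodes + T.numNodes
decreasing_by
  all_goals simp only [BinaryTree.numNodes]; omega

/-- The number of (recursive) calls made by `join p S T`. -/
def joinSteps (p : ι → α) : BinaryTree ι → BinaryTree ι → ℕ
  | .nil, _ => 1
  | .node _ _ _, .nil => 1
  | .node a l r, .node b l' r' =>
      if p a < p b then 1 + joinSteps p r (.node b l' r')
      else 1 + joinSteps p (.node a l r) l'
termination_by S T => S.numNodes + T.numNodes
decreasing_by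
  all_goals simp only [BinaryTree.numNodes]; omega

/-- The treap operation SPLIT: the first `k` elements, and the remaining ones. -/
def split : BinaryTree ι → ℕ → BinaryTree ι × BinaryTree ι
  | .nil, _ => (.nil, .nil)
  | .node a l r, k =>
      if k ≤ l.numNodes then
        ((split l k).1, .node a (split l k).2 r)
      else
        (.node a l (split r (k - l.numNodes - 1)).1, (split r (k - l.numNodes - 1)).2)

/-- The number of (recursive) calls made by `split T k`; every tree node stores the size of its
subtree. -/
def splitSteps : BinaryTree ι → ℕ → ℕ
  | .nil, _ => 1
  | .node _ l r, k =>
      if k ≤ l.numNodes then 1 + splitSteps l k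
      else 1 + splitSteps r (k - l.numNodes - 1)

/-- The treap operation MEMBER, which returns the root. -/
def member : BinaryTree ι → Option ι
  | .nil => none
  | .node a _ _ => some a

end Treaps

section Flow

variable {W : Type u} [Fintype W] [DecidableEq W]

/-- An assignment of integral flow values to the arcs of the gadget network of a graph on `W`. The
network has a source `s`, a sink `t` and two nodes `v_in`, `v_out` for each vertex `v`. -/
structure GadgetFlow (W : Type u) where
  /-- the arc `s → v_in`, of capacity `∞` and cost `0` -/
  fromSource : W → ℕ
  /-- the arc `v_out → t`, of capacity `∞` and cost `0` -/
  toSink : W → ℕ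
  /-- the first arc `v_in → v_out`, of capacity `1` and cost `-1` -/
  unit : W → ℕ
  /-- the second, parallel arc `v_in → v_out`, of capacity `∞` and cost `0` -/
  free : W → ℕ
  /-- the arc `u_out → v_in`, of capacity `∞` and cost `0`, for each edge `(u, v)` -/
  edge : W → W → ℕ

namespace GadgetFlow

/-- `f` is a flow of value `l` in the gadget network of the graph with edge set `A`. -/
structure IsFlow (A : Finset (W × W)) (l : ℕ) (f : GadgetFlow W) : Prop where
  capacity : ∀ v, f.unit v ≤ 1
  support : ∀ u v, (u, v) ∉ A → f.edge u v = 0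
  conservation_in : ∀ v, f.fromSource v + ∑ u, f.edge u v = f.unit v + f.free v
  conservation_out : ∀ v, f.unit v + f.free v = f.toSink v + ∑ u, f.edge v u
  value : ∑ v, f.fromSource v = l

/-- The cost of `f`: only the arcs of capacity `1` have a nonzero cost, namely `-1`. -/
def cost (f : GadgetFlow W) : ℤ := ∑ v, (-1) * (f.unit v : ℤ)

/-- `f` is an (integral) flow of value `l` of minimum cost. -/
def IsMinCost (A : Finset (W × W)) (l : ℕ) (f : GadgetFlow W) : Prop :=
  f.IsFlow A l ∧ ∀ g : GadgetFlow W, g.IsFlow A l → f.cost ≤ g.cost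

end GadgetFlow

/-- The vertices of the graph together with a source and a sink. -/
inductive Node (W : Type u) : Type u
  | source : Node W
  | sink : Node W
  | vert : W → Node W
  deriving DecidableEq

/-- The edges of the graph extended by the source and the sink, i.e. of the gadget network with
each pair `v_in`, `v_out` contracted to `v`. -/
def ExtAdj (A : Finset (W × W)) : Node W → Node W → Prop
  | .source, .vert _ => True
  | .vert _, .sink => True
  | .vert u, .vert v => (u, v) ∈ A
  | _, _ => False

/-- The contracted flow. -/
def GadgetFlow.onEdge (f : GadgetFlow W) : Node W → Node W → ℕ
  | .source, .vert v => f.fromSource v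
  | .vert v, .sink => f.toSink v
  | .vert u, .vert v => f.edge u v
  | _, _ => 0

/-- `out x` lists the heads of the edges that leave `x`, without repetition, in any order. -/
def IsOutList (A : Finset (W × W)) (out : Node W → List (Node W)) : Prop :=
  ∀ x, (out x).Nodup ∧ ∀ y, y ∈ out x ↔ ExtAdj A x y

/-- `order` is a topological order of all vertices: no edge leads from a later vertex to an
earlier one. -/
def IsTopologicalOrder (A : Finset (W × W)) (order : List W) : Prop :=
  order.Nodup ∧ (∀ v, v ∈ order) ∧ order.Pairwise (fun u v => (v, u) ∉ A)

/-- The state of the extraction of `l` chains: the treap of (indices of) paths at each node, the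
chains found so far, and the number of treap steps made so far. -/
structure State (W : Type u) (l : ℕ) where
  tree : Node W → BinaryTree (Fin l)
  chain : Fin l → List W
  work : ℕ

variable {l : ℕ}

/-- The initial state: a treap with the indices of all `l` paths at the source, built by
joining one-element treaps. -/
def initState (W : Type u) [DecidableEq W] (p : Fin l → Fin l) : State W l :=
  let build := (List.finRange l).foldl
    (fun (S : BinaryTree (Fin l) × ℕ) i =>
      (join p S.1 (.node i .nil .nil), S.2 + joinSteps p S.1 (.node i .nil .nil)))
    (.nil, 0)
  { tree := Function.update (fun _ => .nil) .source build.1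
    chain := fun _ => []
    work := build.2 }

/-- Append a vertex to the chain of a member of its treap, if the treap is nonempty. -/
def assign (S : State W l) : Node W → State W l
  | .vert v =>
      match member (S.tree (.vert v)) with
      | some i => { S with chain := Function.update S.chain i (S.chain i ++ [v]) }
      | none => S
  | _ => S

/-- Split off, for each listed edge that leaves `x`, as many path indices as the edge carries
flow, and join them to the treap at the head of the edge. -/
def distribute (p : Fin l → Fin l) (f : GadgetFlow W) (x : Node W) :
    List (Node W) → BinaryTree (Fin l) → State W l → State W l
  | [], _, S => S
  | y :: ys, T, S =>
      let T' := split T (f.onEdge x y)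
      distribute p f x ys T'.2
        { S with
          tree := Function.update S.tree y (join p (S.tree y) T'.1)
          work := S.work + splitSteps T (f.onEdge x y) + joinSteps p (S.tree y) T'.1 }

/-- Process one node. -/
def visit (p : Fin l → Fin l) (f : GadgetFlow W) (out : Node W → List (Node W))
    (S : State W l) (x : Node W) : State W l :=
  distribute p f x (out x) (S.tree x) (assign S x)

/-- The extraction of `l` chains from the flow `f`, with priorities `p`: process the source, then
all vertices in topological order. -/
def extract (p : Fin l → Fin l) (f : GadgetFlow W) (out : Node W → List (Node W))
    (order : List W) : State W l :=
  (Node.source :: order.map Node.vert).foldl (visit p f out) (initState W p)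

/-- The union of the shortcuts of the extracted chains. -/
def coverShortcut (p : Fin l → Fin l) (f : GadgetFlow W) (out : Node W → List (Node W))
    (order : List W) : Finset (W × W) :=
  Finset.univ.biUnion fun i => chainShortcut ((extract p f out order).chain i)

end Flow

section Condensation

variable {V : Type u} [Fintype V] [DecidableEq V]

/-- `rep` selects one vertex in each strongly connected component. -/
def IsSccRoot (E : Finset (V × V)) (rep : V → V) : Prop :=
  (∀ v, Reaches E v (rep v) ∧ Reaches E (rep v) v) ∧
    ∀ u v, Reaches E u v → Reaches E v u → rep u = rep v

/-- The vertices of the contracted graph: the selected vertices. -/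
abbrev Root (rep : V → V) : Type u := {v : V // rep v = v}

/-- The edges of the graph obtained by contracting every strongly connected component. -/
def condense (E : Finset (V × V)) (rep : V → V) : Finset (Root rep × Root rep) :=
  Finset.univ.filter fun q =>
    q.1 ≠ q.2 ∧ ∃ e ∈ E, rep e.1 = q.1.1 ∧ rep e.2 = q.2.1

/-- The shortcut of rooted spanning trees (away from and towards the root) of the strongly
connected components: edges in both directions between each vertex and its root. -/
def sccShortcut (rep : V → V) : Finset (V × V) :=
  Finset.univ.filter fun q => q.1 ≠ q.2 ∧ (q.1 = rep q.2 ∨ q.2 = rep q.1)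

/-- The shortcut that the algorithm outputs: the shortcuts of the rooted spanning trees of
the strongly connected components and of the chains of the contracted graph, without the edges that
are present already. -/
def outputShortcut (E : Finset (V × V)) (rep : V → V) {l : ℕ} (p : Fin l → Fin l)
    (f : GadgetFlow (Root rep)) (out : Node (Root rep) → List (Node (Root rep)))
    (order : List (Root rep)) : Finset (V × V) :=
  (sccShortcut rep ∪
    (coverShortcut p f out order).image (fun q => ((q.1 : V), (q.2 : V)))) \ E

end Condensation

end CertShortcut

set_option linter.unusedSectionVars false

/-! The priorities never influence where path indices travel. On the level of sequences, `split`
cuts off a prefix and `join` concatenates, so the sequence `seqAt` at a node and the block `seqOn`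
sent along an edge depend only on the flow and the chosen orders. Each block is contiguous in the
sequences at both of its ends, each index follows a path through the network (`nodup_and_reaches`),
and the chain of `i` consists of the vertices where `i` has the smallest priority (`extract_chain`).

Diameter: minimum cost means covering as many vertices as possible. Some index is alone at no more
than `n / l` vertices, where `n` counts the vertices of the DAG. Rerouting it along a path with more
uncovered vertices than that would be a gain, so no such path exists (`card_uncovered_mul_le`). A
shortest walk in the shortcut graph meets each of the `l` chains at most three times, because two
vertices of a chain are two hops apart. Hence it has at most `3 * l + n / l` edges
(`exists_short_walk`), which is of order `√n` for the admitted `l`.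

Randomness: conditioning on the position of the minimum bounds the mean of `2 ^ card` of the
ancestors of an element (`sum_two_pow_card_ancs_le`). Markov's inequality and a union bound over the
fixed sequences show that, with high probability, all elements of all sequences have `O(log n)`
ancestors (`isShallow_prob`). This bounds the heights of all treaps that occur, hence the work.

Certification: an index is marked at a node if it is an ancestor there of the first element of a
block on an incident edge. With shallow treaps there are only `O(m log n)` marks at vertices with an
edge. The certified superset adds the divide-and-conquer shortcuts of the chains of marked vertices.
In such a chain, nonconsecutive vertices are joined by two shortcut edges. For consecutive `u`, `w`
in the chain of `j`, the path of `j` from `u` to `w` is either one edge or passes only unmarked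
vertices. At these, the nearest element `c` to the left of `j` with smaller priority lies in the
block of `j` both on entering and on leaving, so `c` accompanies `j` from `u` to `w`. Being an
ancestor of `j` at both ends, `c` is marked there, so `u`, `w` is also a pair in the marked chain of
`c`. Induction on the priority concludes (`certified_of_marked`). Strongly connected components only
require stars and a few extra edges (`certifiedSet`). -/

namespace CertShortcut

/-! ### Ancestors in the treap of a sequence, without reference to trees. -/

section Ancestors

variable {ι κ : Type*} [DecidableEq ι] [DecidableEq κ] {α : Type*} [LinearOrder α]

/-- `j` is an ancestor of `i` in the treap of the sequence `q`: it has the smallest priority among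
all elements between `i` and `j`. -/
def Anc (p : ι → α) (q : List ι) (i j : ι) : Prop :=
  i ∈ q ∧ j ∈ q ∧ ∀ k ∈ q, min (q.idxOf i) (q.idxOf j) ≤ q.idxOf k →
    q.idxOf k ≤ max (q.idxOf i) (q.idxOf j) → p j ≤ p k

instance (p : ι → α) (q : List ι) (i j : ι) : Decidable (Anc p q i j) := by
  unfold Anc; infer_instance

/-- The ancestors of `i` in the treap of the sequence `q`. -/
def ancs (p : ι → α) (q : List ι) (i : ι) : Finset ι := q.toFinset.filter (Anc p q i)

theorem mem_ancs {p : ι → α} {q : List ι} {i j : ι} : j ∈ ancs p q i ↔ Anc p q i j := by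
  simp only [ancs, Finset.mem_filter, List.mem_toFinset, and_iff_right_iff_imp]
  exact fun h => h.2.1

theorem Anc.refl (p : ι → α) {q : List ι} {i : ι} (hi : i ∈ q) : Anc p q i i := by
  refine ⟨hi, hi, fun k hk h1 h2 => ?_⟩
  have : q.idxOf i = q.idxOf k := by omega
  rw [List.idxOf_inj hi] at this
  rw [this]

theorem Anc.of_forall_le {p : ι → α} {q : List ι} {i j : ι} (hi : i ∈ q) (hj : j ∈ q)
    (h : ∀ k ∈ q, p j ≤ p k) : Anc p q i j :=
  ⟨hi, hj, fun k hk _ _ => h k hk⟩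

theorem Anc.trans {p : ι → α} {q : List ι} {i j k : ι} (h : Anc p q i j) (h' : Anc p q j k) :
    Anc p q i k := by
  refine ⟨h.1, h'.2.1, fun x hx h1 h2 => ?_⟩
  have hkj : p k ≤ p j := h'.2.2 j h'.1 (by omega) (by omega)
  by_cases hb : min (q.idxOf j) (q.idxOf k) ≤ q.idxOf x ∧ q.idxOf x ≤ max (q.idxOf j) (q.idxOf k)
  · exact h'.2.2 x hx hb.1 hb.2
  · exact hkj.trans (h.2.2 x hx (by omega) (by omega))

theorem idxOf_infix {A I B : List ι} (hq : (A ++ I ++ B).Nodup) {i : ι} (hi : i ∈ I) :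
    (A ++ I ++ B).idxOf i = A.length + I.idxOf i := by
  have hA : i ∉ A := fun h => by
    rw [List.append_assoc, List.nodup_append] at hq
    exact hq.2.2 i h i (by simp [hi]) rfl
  rw [List.append_assoc, List.idxOf_append_of_notMem hA, List.idxOf_append_of_mem hi]

theorem mem_infix_of_idxOf {A I B : List ι} {i : ι} (h1 : A.length ≤ (A ++ I ++ B).idxOf i)
    (h2 : (A ++ I ++ B).idxOf i < A.length + I.length) : i ∈ I := by
  rw [List.append_assoc] at h1 h2
  by_cases hA : i ∈ A
  · rw [List.idxOf_append_of_mem hA] at h1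
    have := List.idxOf_lt_length_of_mem hA
    omega
  · rw [List.idxOf_append_of_notMem hA] at h2
    by_contra hI
    rw [List.idxOf_append_of_notMem hI] at h2
    omega

/-- Being an ancestor depends only on the stretch between the two elements, and a block containing
both contains this stretch. This locality allows the sequences at both ends of an edge to be
compared. -/
theorem anc_infix {p : ι → α} {A I B : List ι} (hq : (A ++ I ++ B).Nodup) {i j : ι} (hi : i ∈ I)
    (hj : j ∈ I) : Anc p (A ++ I ++ B) i j ↔ Anc p I i j := by
  have hi' := List.idxOf_lt_length_of_mem hi
  have hj' := List.idxOf_lt_length_of_mem hj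
  unfold Anc
  rw [idxOf_infix hq hi, idxOf_infix hq hj]
  constructor
  · rintro ⟨-, -, h⟩
    refine ⟨hi, hj, fun k hk h1 h2 => h k (by simp [hk]) ?_ ?_⟩ <;> rw [idxOf_infix hq hk] <;> omega
  · rintro ⟨-, -, h⟩
    refine ⟨by simp [hi], by simp [hj], fun k hk h1 h2 => ?_⟩
    have hkI : k ∈ I := mem_infix_of_idxOf (A := A) (B := B) (by omega) (by omega)
    rw [idxOf_infix hq hkI] at h1 h2
    exact h k hkI (by omega) (by omega)

theorem ancs_card_le_of_infix (p : ι → α) {I q : List ι} (hI : I <:+: q) (hq : q.Nodup) {i : ι}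
    (hi : i ∈ I) : (ancs p I i).card ≤ (ancs p q i).card := by
  obtain ⟨A, B, rfl⟩ := hI
  refine Finset.card_le_card fun j hj => ?_
  rw [mem_ancs] at *
  exact (anc_infix hq hi hj.2.1).2 hj

theorem idxOf_map_of_injective {f : ι → κ} (hf : f.Injective) (L : List ι) (i : ι) :
    (L.map f).idxOf (f i) = L.idxOf i := by
  induction L with
  | nil => rfl
  | cons a L ih => simp [List.idxOf_cons, ih, hf.eq_iff, beq_eq_decide]

theorem anc_map {f : ι → κ} (hf : f.Injective) (p : κ → α) (L : List ι) (i j : ι) :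
    Anc p (L.map f) (f i) (f j) ↔ Anc (p ∘ f) L i j := by
  simp only [Anc, List.mem_map_of_injective hf, idxOf_map_of_injective hf, List.forall_mem_map,
    Function.comp_apply]

theorem card_ancs_map {f : ι → κ} (hf : f.Injective) (p : κ → α) (L : List ι) (i : ι) :
    (ancs p (L.map f) (f i)).card = (ancs (p ∘ f) L i).card := by
  rw [← Finset.card_image_of_injective _ hf]
  congr 1
  ext k
  simp only [mem_ancs, Finset.mem_image]
  constructor
  · intro h
    obtain ⟨j, -, rfl⟩ := List.mem_map.1 h.2.1
    exact ⟨j, (anc_map hf p L i j).1 h, rfl⟩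
  · rintro ⟨j, h, rfl⟩
    exact (anc_map hf p L i j).2 h

theorem ancs_comp_strictMono {β : Type*} [LinearOrder β] {g : α → β} (hg : StrictMono g)
    (p : ι → α) (L : List ι) (i : ι) : ancs (g ∘ p) L i = ancs p L i := by
  ext j
  simp [mem_ancs, Anc, hg.le_iff_le]

/-- A minimum `k` to the left of `i` hides everything beyond it: an element further left has `k`
between itself and `i`. `ancs_subset_right` is the mirror image. -/
theorem ancs_subset_left {p : ι → α} {A₁ A₂ B : List ι} {i k : ι}
    (hq : (A₁ ++ k :: A₂ ++ i :: B).Nodup) (hk : ∀ j ∈ A₁ ++ k :: A₂ ++ i :: B, j ≠ k → p k < p j) :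
    ancs p (A₁ ++ k :: A₂ ++ i :: B) i ⊆ insert k (ancs p (A₂ ++ i :: B) i) := by
  intro j hj
  rw [Finset.mem_insert, mem_ancs] at *
  by_cases hjk : j = k
  · exact Or.inl hjk
  right
  have e : A₁ ++ k :: A₂ ++ i :: B = (A₁ ++ [k]) ++ (A₂ ++ i :: B) ++ [] := by simp
  have hj2 : j ∈ A₂ ++ i :: B := by
    by_contra hcon
    have hjA : j ∈ A₁ := by
      have := hj.2.1
      simp only [List.mem_append, List.mem_cons] at this hcon
      tauto
    have h1 : (A₁ ++ k :: A₂ ++ i :: B).idxOf j < A₁.length := by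
      rw [List.append_assoc, List.idxOf_append_of_mem hjA]
      exact List.idxOf_lt_length_of_mem hjA
    have e' : A₁ ++ k :: A₂ ++ i :: B = A₁ ++ [k] ++ (A₂ ++ i :: B) := by simp
    have h2 : (A₁ ++ k :: A₂ ++ i :: B).idxOf k = A₁.length := by
      rw [e'] at hq ⊢
      rw [idxOf_infix hq (by simp)]
      simp
    have h3 : A₁.length + 1 ≤ (A₁ ++ k :: A₂ ++ i :: B).idxOf i := by
      rw [e] at hq ⊢
      rw [idxOf_infix hq (by simp)]
      simp
    have := hj.2.2 k (by simp) (by omega) (by omega)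
    exact absurd (hk j hj.2.1 hjk) (not_lt.2 this)
  rw [e] at hj hq
  exact (anc_infix hq (by simp) hj2).1 hj

theorem ancs_subset_right {p : ι → α} {A B₁ B₂ : List ι} {i k : ι}
    (hq : (A ++ i :: (B₁ ++ k :: B₂)).Nodup)
    (hk : ∀ j ∈ A ++ i :: (B₁ ++ k :: B₂), j ≠ k → p k < p j) :
    ancs p (A ++ i :: (B₁ ++ k :: B₂)) i ⊆ insert k (ancs p (A ++ i :: B₁) i) := by
  intro j hj
  rw [Finset.mem_insert, mem_ancs] at *
  by_cases hjk : j = k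
  · exact Or.inl hjk
  right
  have e : A ++ i :: (B₁ ++ k :: B₂) = [] ++ (A ++ i :: B₁) ++ (k :: B₂) := by simp
  have hj2 : j ∈ A ++ i :: B₁ := by
    by_contra hcon
    have hjB : j ∈ B₂ := by
      have := hj.2.1
      simp only [List.mem_append, List.mem_cons] at this hcon
      tauto
    have e' : A ++ i :: (B₁ ++ k :: B₂) = (A ++ i :: B₁) ++ [k] ++ B₂ := by simp
    have e'' : A ++ i :: (B₁ ++ k :: B₂) = (A ++ i :: B₁ ++ [k]) ++ B₂ ++ [] := by simp
    have h2 : (A ++ i :: (B₁ ++ k :: B₂)).idxOf k = (A ++ i :: B₁).length := by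
      rw [e'] at hq ⊢
      rw [idxOf_infix hq (by simp)]
      simp
    have h1 : (A ++ i :: B₁).length + 1 ≤ (A ++ i :: (B₁ ++ k :: B₂)).idxOf j := by
      rw [e''] at hq ⊢
      rw [idxOf_infix hq hjB]
      simp only [List.length_append, List.length_cons, List.length_nil]
      omega
    have h3 : (A ++ i :: (B₁ ++ k :: B₂)).idxOf i < (A ++ i :: B₁).length := by
      have : i ∈ A ++ i :: B₁ := by simp
      rw [e] at hq ⊢
      rw [idxOf_infix hq this]
      simpa using List.idxOf_lt_length_of_mem this
    have := hj.2.2 k (by simp) (by omega) (by omega)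
    exact absurd (hk j hj.2.1 hjk) (not_lt.2 this)
  rw [e] at hj hq
  exact (anc_infix hq (by simp) hj2).1 hj

theorem ancs_eq_singleton {p : ι → α} {q : List ι} {i : ι} (hi : i ∈ q)
    (h : ∀ j ∈ q, j ≠ i → p i < p j) : ancs p q i = {i} := by
  ext j
  rw [mem_ancs, Finset.mem_singleton]
  constructor
  · intro hj
    by_contra hne
    exact absurd (h j hj.2.1 hne) (not_lt.2 (hj.2.2 i hi (by omega) (by omega)))
  · rintro rfl
    exact Anc.refl p hi

theorem sum_idxOf {M : Type*} [AddCommMonoid M] {L : List ι} (hL : L.Nodup) (φ : ℕ → M) :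
    ∑ k ∈ L.toFinset, φ (L.idxOf k) = ∑ s ∈ Finset.range L.length, φ s := by
  refine Finset.sum_bij (fun k _ => L.idxOf k) ?_ ?_ ?_ ?_
  · intro k hk
    simpa using List.idxOf_lt_length_of_mem (List.mem_toFinset.1 hk)
  · intro a ha b hb h
    exact (List.idxOf_inj (List.mem_toFinset.1 ha)).1 h
  · intro s hs
    have hs' := Finset.mem_range.1 hs
    exact ⟨L[s], by simp, List.Nodup.idxOf_getElem hL s hs'⟩
  · intros; rfl

end Ancestors

/-! ### The exponential moment of the number of ancestors under random priorities. -/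

section Permutations

open Equiv

/-- The permutation for which `k` has the smallest priority, while the priorities of the other
elements are given by `e`. -/
def permOfMin {n : ℕ} (k : Fin (n + 1)) (e : Perm (Fin n)) : Perm (Fin (n + 1)) :=
  (Equiv.Perm.decomposeFin.symm (k, e⁻¹))⁻¹

/-- An enumeration of the elements different from `k`. -/
def skip {n : ℕ} (k : Fin (n + 1)) (x : Fin n) : Fin (n + 1) := swap 0 k x.succ

theorem skip_injective {n : ℕ} (k : Fin (n + 1)) : (skip k).Injective :=
  (swap 0 k).injective.comp (Fin.succ_injective n)

theorem exists_skip {n : ℕ} {k y : Fin (n + 1)} (h : y ≠ k) : ∃ x, skip k x = y := by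
  obtain ⟨x, hx⟩ := Fin.exists_succ_eq.2 (show swap 0 k y ≠ 0 by
    intro h0
    apply h
    have := congrArg (swap 0 k) h0
    simpa using this)
  exact ⟨x, by rw [skip, hx]; simp⟩

theorem permOfMin_self {n : ℕ} (k : Fin (n + 1)) (e : Perm (Fin n)) : permOfMin k e k = 0 := by
  rw [permOfMin, Perm.inv_eq_iff_eq]; simp

theorem permOfMin_skip {n : ℕ} (k : Fin (n + 1)) (e : Perm (Fin n)) (x : Fin n) :
    permOfMin k e (skip k x) = (e x).succ := by
  rw [permOfMin, Perm.inv_eq_iff_eq]; simp [skip]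

theorem permOfMin_lt {n : ℕ} (k : Fin (n + 1)) (e : Perm (Fin n)) {j : Fin (n + 1)} (h : j ≠ k) :
    permOfMin k e k < permOfMin k e j := by
  rw [permOfMin_self]
  refine Fin.pos_of_ne_zero fun h0 => h ?_
  rw [← permOfMin_self k e] at h0
  exact (permOfMin k e).injective h0

/-- Conditioning on the element of smallest priority: `k` is that element and `e` ranks the others.
-/
theorem sum_perm_succ {M : Type*} [AddCommMonoid M] {n : ℕ} (F : Perm (Fin (n + 1)) → M) :
    ∑ p, F p = ∑ k, ∑ e, F (permOfMin k e) := by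
  rw [← Fintype.sum_prod_type']
  refine (Fintype.sum_equiv (((Equiv.prodCongr (Equiv.refl _) (Equiv.inv (Perm (Fin n)))).trans
    (Equiv.Perm.decomposeFin (n := n)).symm).trans (Equiv.inv _)) _ _ fun x => rfl).symm

/-- Conditioned on the minimum `k`, a `k` in the sequence other than `i` costs a factor 2 and cuts
the sequence at `k`; a `k` outside the sequence changes nothing. The mean of the power of two,
unlike the mean of the cardinality itself, gives exponentially decaying tails. -/
theorem sum_two_pow_card_ancs_le (n : ℕ) : ∀ (A B : List (Fin n)) (i : Fin n),
    (A ++ i :: B).Nodup →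
    ∑ p : Perm (Fin n), 2 ^ (ancs p (A ++ i :: B) i).card ≤
      n.factorial * (2 * (A.length + 1) * (B.length + 1)) := by
  induction n with
  | zero => exact fun _ _ i => i.elim0
  | succ n ih =>
    intro A B i hq
    -- The induction hypothesis transported along `skip k`: a sequence avoiding `k` lives on the
    -- other `n` elements, whose priorities are all shifted by one.
    have base : ∀ (k : Fin (n + 1)) (A B : List (Fin (n + 1))), (A ++ i :: B).Nodup →
        k ∉ A ++ i :: B → ∑ e : Perm (Fin n), 2 ^ (ancs (permOfMin k e) (A ++ i :: B) i).card ≤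
          n.factorial * (2 * (A.length + 1) * (B.length + 1)) := by
      intro k A B hq hk
      have lift : ∀ L : List (Fin (n + 1)), k ∉ L → ∃ L' : List (Fin n), L = L'.map (skip k) := by
        intro L hL
        induction L with
        | nil => exact ⟨[], rfl⟩
        | cons a L ihL =>
          simp only [List.mem_cons, not_or] at hL
          obtain ⟨L', rfl⟩ := ihL hL.2
          obtain ⟨x, rfl⟩ := exists_skip (Ne.symm hL.1)
          exact ⟨x :: L', rfl⟩
      simp only [List.mem_append, List.mem_cons, not_or] at hk
      obtain ⟨A', rfl⟩ := lift A hk.1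
      obtain ⟨B', rfl⟩ := lift B hk.2.2
      obtain ⟨i', rfl⟩ := exists_skip (Ne.symm hk.2.1)
      have e1 : A'.map (skip k) ++ skip k i' :: B'.map (skip k) = (A' ++ i' :: B').map (skip k) := by
        simp
      rw [e1] at hq ⊢
      have := ih A' B' i' (List.Nodup.of_map _ hq)
      simp only [List.length_map]
      refine le_of_eq_of_le (Finset.sum_congr rfl fun e _ => ?_) this
      rw [card_ancs_map (skip_injective k)]
      have : (permOfMin k e : Fin (n + 1) → Fin (n + 1)) ∘ skip k = Fin.succ ∘ e := by
        ext x
        simp [permOfMin_skip]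
      rw [this, ancs_comp_strictMono (Fin.strictMono_succ)]
    set x := A.length with hx
    set y := B.length with hy
    have hlen : x + y + 1 ≤ n + 1 := by
      have := hq.length_le_card
      simp at this
      omega
    have hA : A.Nodup := (List.nodup_append.1 hq).1
    have hiB : (i :: B).Nodup := (List.nodup_append.1 hq).2.1
    have hB : B.Nodup := (List.nodup_cons.1 hiB).2
    have two : ∀ (s t : Finset (Fin (n + 1))) (k : Fin (n + 1)), s ⊆ insert k t →
        2 ^ s.card ≤ 2 * 2 ^ t.card := by
      intro s t k h
      rw [← pow_succ']
      exact Nat.pow_le_pow_right (by norm_num) ((Finset.card_le_card h).trans (Finset.card_insert_le _ _))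
    -- After the cut at `k`, `x - A.idxOf k - 1` elements remain to the left of `i`. The 4 combines
    -- the 2 of the induction hypothesis with the factor for the new ancestor `k`.
    have bA : ∀ k ∈ A.toFinset, ∑ e : Perm (Fin n), 2 ^ (ancs (permOfMin k e) (A ++ i :: B) i).card ≤
        n.factorial * (4 * (y + 1)) * (x - A.idxOf k) := by
      intro k hk
      obtain ⟨A₁, A₂, rfl⟩ := List.append_of_mem (List.mem_toFinset.1 hk)
      have hk1 : k ∉ A₂ ++ i :: B := by
        have : (A₁ ++ (k :: (A₂ ++ i :: B))).Nodup := by simpa using hq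
        exact (List.nodup_cons.1 (List.nodup_append.1 this).2.1).1
      have hk2 : k ∉ A₁ := fun h => (List.nodup_append.1 hA).2.2 k h k (by simp) rfl
      have hq2 : (A₂ ++ i :: B).Nodup := by
        have : (A₁ ++ (k :: (A₂ ++ i :: B))).Nodup := by simpa using hq
        exact (List.nodup_cons.1 (List.nodup_append.1 this).2.1).2
      have e1 : x - (A₁ ++ k :: A₂).idxOf k = A₂.length + 1 := by
        rw [List.idxOf_append_of_notMem hk2, hx]
        simp
      rw [e1]
      calc _ ≤ ∑ e : Perm (Fin n), 2 * 2 ^ (ancs (permOfMin k e) (A₂ ++ i :: B) i).card :=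
            Finset.sum_le_sum fun e _ =>
              two _ _ k (ancs_subset_left hq fun j _ h => permOfMin_lt k e h)
        _ ≤ 2 * (n.factorial * (2 * (A₂.length + 1) * (B.length + 1))) := by
            rw [← Finset.mul_sum]
            exact Nat.mul_le_mul_left _ (base k A₂ B hq2 hk1)
        _ = _ := by ring
    have bB : ∀ k ∈ B.toFinset, ∑ e : Perm (Fin n), 2 ^ (ancs (permOfMin k e) (A ++ i :: B) i).card ≤
        n.factorial * (4 * (x + 1)) * (B.idxOf k + 1) := by
      intro k hk
      obtain ⟨B₁, B₂, rfl⟩ := List.append_of_mem (List.mem_toFinset.1 hk)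
      have hq' : ((A ++ i :: B₁) ++ (k :: B₂)).Nodup := by simpa using hq
      have hk1 : k ∉ A ++ i :: B₁ := fun h => (List.nodup_append.1 hq').2.2 k h k (by simp) rfl
      have hk2 : k ∉ B₁ := fun h => hk1 (by simp [h])
      have e1 : (B₁ ++ k :: B₂).idxOf k = B₁.length := by
        rw [List.idxOf_append_of_notMem hk2]
        simp
      rw [e1]
      calc _ ≤ ∑ e : Perm (Fin n), 2 * 2 ^ (ancs (permOfMin k e) (A ++ i :: B₁) i).card :=
            Finset.sum_le_sum fun e _ =>
              two _ _ k (ancs_subset_right hq fun j _ h => permOfMin_lt k e h)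
        _ ≤ 2 * (n.factorial * (2 * (A.length + 1) * (B₁.length + 1))) := by
            rw [← Finset.mul_sum]
            exact Nat.mul_le_mul_left _ (base k A B₁ (List.nodup_append.1 hq').1 hk1)
        _ = _ := by ring
    have bi : ∑ e : Perm (Fin n), 2 ^ (ancs (permOfMin i e) (A ++ i :: B) i).card ≤
        n.factorial * 2 := by
      refine le_of_eq ?_
      rw [Finset.sum_congr rfl fun e _ => by
        rw [ancs_eq_singleton (by simp) fun j _ h => permOfMin_lt i e h, Finset.card_singleton]]
      simp [Fintype.card_perm]
    set Q : Finset (Fin (n + 1)) := (A ++ i :: B).toFinset with hQ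
    have hQcard : Q.card = x + y + 1 := by
      rw [hQ, List.toFinset_card_of_nodup hq]; simp; omega
    have sA : ∑ s ∈ Finset.range x, (x - s) * 2 = x * (x + 1) := by
      have := Finset.sum_range_id_mul_two (x + 1)
      rw [Finset.sum_range_succ'] at this
      simp only [add_zero, Nat.add_sub_cancel] at this
      rw [← Finset.sum_mul, mul_comm x, ← this, ← Finset.sum_range_reflect]
      congr 1
      refine Finset.sum_congr rfl fun s hs => ?_
      have := Finset.mem_range.1 hs
      omega
    have sB : ∑ s ∈ Finset.range y, (s + 1) * 2 = y * (y + 1) := by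
      have := Finset.sum_range_id_mul_two (y + 1)
      rw [Finset.sum_range_succ'] at this
      simp only [add_zero, Nat.add_sub_cancel] at this
      rw [← Finset.sum_mul, this, mul_comm]
    have dAB : Disjoint A.toFinset (insert i B.toFinset) := by
      rw [Finset.disjoint_left]
      intro k hk hk'
      refine (List.nodup_append.1 hq).2.2 k (by simpa using hk) k (by simpa using hk') rfl
    have hQ' : Q = A.toFinset ∪ insert i B.toFinset := by ext; simp [hQ]
    have hiB' : i ∉ B.toFinset := by simpa using (List.nodup_cons.1 hiB).1
    rw [sum_perm_succ, ← Finset.sum_add_sum_compl Q]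
    have h1 : ∑ k ∈ Q, ∑ e : Perm (Fin n), 2 ^ (ancs (permOfMin k e) (A ++ i :: B) i).card ≤
        n.factorial * (2 * (x * (x + 1) * (y + 1) + (x + 1) * (y * (y + 1)) + 1)) := by
      rw [hQ', Finset.sum_union dAB, Finset.sum_insert hiB']
      have := Finset.sum_le_sum bA
      have h2 := Finset.sum_le_sum bB
      rw [← Finset.mul_sum, sum_idxOf hA (fun s => x - s), ← hx] at this
      rw [← Finset.mul_sum, sum_idxOf hB (fun s => s + 1), ← hy] at h2
      rw [← Finset.sum_mul] at sA sB
      refine (add_le_add this (add_le_add bi h2)).trans (le_of_eq ?_)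
      rw [← sA, ← sB]
      ring
    have h2 : ∑ k ∈ Qᶜ, ∑ e : Perm (Fin n), 2 ^ (ancs (permOfMin k e) (A ++ i :: B) i).card ≤
        (n - (x + y)) * (n.factorial * (2 * (x + 1) * (y + 1))) := by
      refine (Finset.sum_le_card_nsmul _ _ _ fun k hk => base k A B hq ?_).trans (le_of_eq ?_)
      · rw [Finset.mem_compl, hQ, List.mem_toFinset] at hk
        exact hk
      · rw [Finset.card_compl, hQcard, Fintype.card_fin, smul_eq_mul]
        congr 1
        omega
    refine (add_le_add h1 h2).trans ?_
    obtain ⟨d, hd⟩ : ∃ d, n = x + y + d := ⟨n - (x + y), by omega⟩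
    have hd' : n - (x + y) = d := by omega
    rw [hd', Nat.factorial_succ]
    -- With `n = x + y + d` this reduces to `1 ≤ (x + 1) * (y + 1)`.
    have : 2 * (x * (x + 1) * (y + 1) + (x + 1) * (y * (y + 1)) + 1) + d * (2 * (x + 1) * (y + 1)) ≤
        (n + 1) * (2 * (x + 1) * (y + 1)) := by
      rw [hd]
      nlinarith [Nat.zero_le (x * y), Nat.zero_le x, Nat.zero_le y]
    calc _ = n.factorial * (2 * (x * (x + 1) * (y + 1) + (x + 1) * (y * (y + 1)) + 1) +
          d * (2 * (x + 1) * (y + 1))) := by ring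
      _ ≤ n.factorial * ((n + 1) * (2 * (x + 1) * (y + 1))) := Nat.mul_le_mul_left _ this
      _ = _ := by ring

/-- Elements of a sequence have few ancestors for most permutations. -/
theorem card_filter_lt_ancs_le {n : ℕ} {q : List (Fin n)} (hq : q.Nodup) {i : Fin n} (hi : i ∈ q)
    (t : ℕ) : (Finset.univ.filter fun p : Perm (Fin n) => t < (ancs p q i).card).card * 2 ^ t ≤
      n.factorial * n ^ 2 := by
  obtain ⟨A, B, rfl⟩ := List.append_of_mem hi
  have hlen : A.length + B.length + 1 ≤ n := by
    have := hq.length_le_card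
    simp at this
    omega
  have h := sum_two_pow_card_ancs_le n A B i hq
  -- Markov's inequality. The strict bound allows the exponent `t + 1`, whose extra factor cancels
  -- the 2 of `sum_two_pow_card_ancs_le`.
  have h1 : (Finset.univ.filter fun p : Perm (Fin n) => t < (ancs p (A ++ i :: B) i).card).card *
      2 ^ (t + 1) ≤ ∑ p : Perm (Fin n), 2 ^ (ancs p (A ++ i :: B) i).card := by
    rw [← smul_eq_mul, ← Finset.sum_const]
    refine (Finset.sum_le_sum fun p hp => ?_).trans
      (Finset.sum_le_sum_of_subset (Finset.subset_univ _))
    exact Nat.pow_le_pow_right (by norm_num) (Finset.mem_filter.1 hp).2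
  have h2 : (A.length + 1) * (B.length + 1) ≤ n ^ 2 := by
    rw [sq]; exact Nat.mul_le_mul (by omega) (by omega)
  have h3 := h1.trans h
  rw [pow_succ] at h3
  have h4 := Nat.mul_le_mul_left n.factorial h2
  nlinarith

end Permutations

/-! ### Treap operations: effect on sequences, heap order, heights and costs. -/

section TreapLemmas

variable {ι : Type} {α : Type*} [LinearOrder α]

/-- The sequence of elements of a tree. -/
def inorder : BinaryTree ι → List ι
  | .nil => []
  | .node a l r => inorder l ++ a :: inorder r

/-- Every element has a priority that is at most those of its descendants. -/
def IsHeap (p : ι → α) : BinaryTree ι → Prop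
  | .nil => True
  | .node a l r => (∀ k ∈ inorder l ++ inorder r, p a ≤ p k) ∧ IsHeap p l ∧ IsHeap p r

theorem length_inorder (T : BinaryTree ι) : (inorder T).length = T.numNodes := by
  induction T with
  | nil => rfl
  | node a l r hl hr => simp [inorder, hl, hr]; omega

theorem inorder_join (p : ι → α) (S T : BinaryTree ι) :
    inorder (join p S T) = inorder S ++ inorder T := by
  induction S, T using join.induct p with
  | case1 T => simp [join, inorder]
  | case2 a l r => simp [join, inorder]
  | case3 a l r b l' r' h ih => simp [join, inorder, h, ih]
  | case4 a l r b l' r' h ih => simp [join, inorder, h, ih]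

theorem isHeap_join (p : ι → α) (S T : BinaryTree ι) (hS : IsHeap p S) (hT : IsHeap p T) :
    IsHeap p (join p S T) := by
  induction S, T using join.induct p with
  | case1 T => simpa [join] using hT
  | case2 a l r => simpa [join] using hS
  | case3 a l r b l' r' h ih =>
    rw [join, if_pos h]
    refine ⟨fun k hk => ?_, hS.2.1, ih hS.2.2 hT⟩
    have h1 := hS.1 k
    have h2 := hT.1 k
    simp only [inorder_join, inorder, List.mem_append, List.mem_cons] at hk h1 h2
    rcases hk with hk | hk | hk | rfl | hk
    · exact h1 (Or.inl hk)
    · exact h1 (Or.inr hk)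
    · exact h.le.trans (h2 (Or.inl hk))
    · exact h.le
    · exact h.le.trans (h2 (Or.inr hk))
  | case4 a l r b l' r' h ih =>
    rw [join, if_neg h]
    rw [not_lt] at h
    refine ⟨fun k hk => ?_, ih hS hT.2.1, hT.2.2⟩
    have h1 := hS.1 k
    have h2 := hT.1 k
    simp only [inorder_join, inorder, List.mem_append, List.mem_cons] at hk h1 h2
    rcases hk with ((hk | rfl | hk) | hk) | hk
    · exact h.trans (h1 (Or.inl hk))
    · exact h
    · exact h.trans (h1 (Or.inr hk))
    · exact h2 (Or.inl hk)
    · exact h2 (Or.inr hk)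

/-- Each call descends one level in one of the two trees. -/
theorem joinSteps_le (p : ι → α) (S T : BinaryTree ι) :
    joinSteps p S T ≤ S.height + T.height + 1 := by
  induction S, T using join.induct p with
  | case1 T => simp [joinSteps]
  | case2 a l r => simp [joinSteps]
  | case3 a l r b l' r' h ih =>
    rw [joinSteps, if_pos h]
    simp only [BinaryTree.height] at *
    omega
  | case4 a l r b l' r' h ih =>
    rw [joinSteps, if_neg h]
    simp only [BinaryTree.height] at *
    omega

theorem inorder_split (T : BinaryTree ι) (k : ℕ) :
    inorder (split T k).1 = (inorder T).take k ∧ inorder (split T k).2 = (inorder T).drop k := by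
  induction T generalizing k with
  | nil => simp [split, inorder]
  | node a l r hl hr =>
    rw [split]
    split_ifs with h
    · have h' : k - (inorder l).length = 0 := by rw [length_inorder]; omega
      simp [inorder, hl, List.take_append, List.drop_append, h']
    · obtain ⟨m, hm⟩ : ∃ m, k = (inorder l).length + (m + 1) :=
        ⟨k - l.numNodes - 1, by rw [length_inorder]; omega⟩
      have hm' : k - l.numNodes - 1 = m := by rw [← length_inorder]; omega
      rw [hm']
      have e1 : (inorder l).take k = inorder l := List.take_of_length_le (by omega)
      have e2 : (inorder l).drop k = [] := List.drop_of_length_le (by omega)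
      have e3 : k - (inorder l).length = m + 1 := by omega
      simp [inorder, hr, List.take_append, List.drop_append, e1, e2, e3]

theorem isHeap_split (p : ι → α) (T : BinaryTree ι) (k : ℕ) (hT : IsHeap p T) :
    IsHeap p (split T k).1 ∧ IsHeap p (split T k).2 := by
  induction T generalizing k with
  | nil => simp [split, IsHeap]
  | node a l r hl hr =>
    have h1 := hT.1
    simp only [List.mem_append] at h1
    rw [split]
    split_ifs with h
    · refine ⟨(hl k hT.2.1).1, fun x hx => h1 x ?_, (hl k hT.2.1).2, hT.2.2⟩
      rw [(inorder_split l k).2, List.mem_append] at hx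
      exact hx.imp List.mem_of_mem_drop id
    · refine ⟨⟨fun x hx => h1 x ?_, hT.2.1, (hr _ hT.2.2).1⟩, (hr _ hT.2.2).2⟩
      rw [(inorder_split r _).1, List.mem_append] at hx
      exact hx.imp id List.mem_of_mem_take

theorem splitSteps_le (T : BinaryTree ι) (k : ℕ) : splitSteps T k ≤ T.height + 1 := by
  induction T generalizing k with
  | nil => simp [splitSteps]
  | node a l r hl hr =>
    rw [splitSteps]
    have h1 := hl k
    have h2 := hr (k - l.numNodes - 1)
    simp only [BinaryTree.height]
    split_ifs <;> omega

/-- The height of a treap is bounded by the numbers of ancestors in its sequence. -/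
theorem height_le [DecidableEq ι] {p : ι → α} {T : BinaryTree ι} (hT : IsHeap p T)
    (hn : (inorder T).Nodup) {t : ℕ} (h : ∀ i ∈ inorder T, (ancs p (inorder T) i).card ≤ t) :
    T.height ≤ t := by
  induction T generalizing t with
  | nil => simp
  | node a l r hl hr =>
    have hroot : ∀ k ∈ inorder (.node a l r), p a ≤ p k := by
      intro k hk
      have := hT.1 k
      simp only [inorder, List.mem_append, List.mem_cons] at hk this
      rcases hk with hk | rfl | hk
      · exact this (Or.inl hk)
      · exact le_rfl
      · exact this (Or.inr hk)
    have ha : a ∈ inorder (.node a l r) := by simp [inorder]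
    -- The root is an ancestor of everything; for an element of a subtree it comes on top of the
    -- ancestors inside that subtree.
    have key : ∀ s, s <:+: inorder (.node a l r) → a ∉ s → ∀ i ∈ s,
        (ancs p s i).card + 1 ≤ t := by
      intro s hs has i hi
      have hi' := hs.subset hi
      rw [← Finset.card_insert_of_notMem (a := a) (s := ancs p s i) (by
        rw [mem_ancs]; exact fun h => has h.2.1)]
      refine (Finset.card_le_card fun j hj => ?_).trans (h i hi')
      rw [Finset.mem_insert] at hj
      rw [mem_ancs] at *
      obtain ⟨A, B, hAB⟩ := hs
      rcases hj with rfl | hj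
      · exact Anc.of_forall_le hi' ha hroot
      · rw [← hAB] at hn ⊢
        exact (anc_infix hn hi hj.2.1).2 hj
    have ht : 1 ≤ t := by
      refine le_trans (Finset.card_pos.2 ⟨a, ?_⟩) (h a ha)
      rw [mem_ancs]
      exact Anc.refl p ha
    have hn' := hn
    simp only [inorder, List.nodup_append, List.nodup_cons] at hn'
    have h1 := hl hT.2.1 hn'.1 (t := t - 1) fun i hi => by
      have := key (inorder l) ⟨[], a :: inorder r, by simp [inorder]⟩
        (fun h => hn'.2.2 a h a (by simp) rfl) i hi
      omega
    have h2 := hr hT.2.2 hn'.2.1.2 (t := t - 1) fun i hi => by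
      have := key (inorder r) ⟨inorder l ++ [a], [], by simp [inorder]⟩ hn'.2.1.1 i hi
      omega
    simp only [BinaryTree.height]
    omega

/-- The trees passed to `split` and `join` hold blocks of the final sequences, so a bound on
ancestors in the final sequences alone controls all their heights. -/
theorem height_le_of_infix [DecidableEq ι] {p : ι → α} {T : BinaryTree ι} (hT : IsHeap p T)
    {q : List ι} (hn : q.Nodup) (hq : inorder T <:+: q) {t : ℕ}
    (h : ∀ i ∈ q, (ancs p q i).card ≤ t) : T.height ≤ t :=
  height_le hT (hn.sublist hq.sublist) fun i hi =>
    (ancs_card_le_of_infix p hq hn hi).trans (h i (hq.subset hi))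

/-- A heap has its minimum at the root, and injectivity makes the minimum unique. Thus `member`
depends on the sequence only, not on the shape of the tree. -/
theorem member_eq_some_iff {p : ι → α} (hp : p.Injective) {T : BinaryTree ι} (hT : IsHeap p T)
    (i : ι) : member T = some i ↔ i ∈ inorder T ∧ ∀ k ∈ inorder T, p i ≤ p k := by
  cases T with
  | nil => simp [member, inorder]
  | node a l r =>
    have hroot : ∀ k ∈ inorder (.node a l r), p a ≤ p k := by
      intro k hk
      have := hT.1 k
      simp only [inorder, List.mem_append, List.mem_cons] at hk this
      rcases hk with hk | rfl | hk
      · exact this (Or.inl hk)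
      · exact le_rfl
      · exact this (Or.inr hk)
    have ha : a ∈ inorder (.node a l r) := by simp [inorder]
    simp only [member, Option.some.injEq]
    constructor
    · rintro rfl
      exact ⟨ha, hroot⟩
    · rintro ⟨h1, h2⟩
      exact hp (le_antisymm (hroot i h1) (h2 a ha))

end TreapLemmas

/-! ### The divide-and-conquer shortcut of a single chain. -/

section ChainShortcut

open scoped List

variable {V : Type u}

/-- The recursion scheme of `chainShortcut`; the condition on `A.length` says that `mid` is the
middle vertex. -/
theorem bisection_induction {P : List V → Prop} (nil : P [])
    (append : ∀ A mid R, A.length = (A ++ mid :: R).length / 2 → P A → P R → P (A ++ mid :: R))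
    (L : List V) : P L := by
  induction h : L.length using Nat.strong_induction_on generalizing L with
  | _ n ih =>
    subst h
    match h : L.drop (L.length / 2) with
    | [] =>
      have : L.length = 0 := by
        have := congrArg List.length h
        simp at this
        omega
      rw [List.length_eq_zero_iff.1 this]
      exact nil
    | mid :: R =>
      have e : L = L.take (L.length / 2) ++ mid :: R := by rw [← h, List.take_append_drop]
      have hl : (L.take (L.length / 2)).length = L.length / 2 := by
        rw [List.length_take]; omega
      have hlen := congrArg List.length e
      rw [List.length_append, List.length_cons, hl] at hlen
      generalize L.take (L.length / 2) = A at *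
      subst e
      exact append A mid R hl (ih A.length (by omega) A rfl) (ih R.length (by omega) R rfl)

theorem pair_sublist_cases {A R : List V} {mid u w : V} (h : [u, w] <+ A ++ mid :: R) :
    [u, w] <+ A ∨ (u ∈ A ∧ w = mid) ∨ (u ∈ A ∧ w ∈ R) ∨ (u = mid ∧ w ∈ R) ∨ [u, w] <+ R := by
  rw [List.sublist_append_iff] at h
  obtain ⟨l₁, l₂, e, h1, h2⟩ := h
  match l₁, l₂, e with
  | [], _, e =>
    simp only [List.nil_append] at e
    subst e
    cases h2 with
    | cons _ h => simp [h]
    | cons_cons _ h => simp [List.singleton_sublist.1 h]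
  | [a], _, e =>
    simp only [List.cons_append, List.nil_append, List.cons.injEq] at e
    obtain ⟨rfl, rfl⟩ := e
    have := List.singleton_sublist.1 h1
    have h3 := List.singleton_sublist.1 h2
    simp only [List.mem_cons] at h3
    tauto
  | [a, b], _, e =>
    simp only [List.cons_append, List.nil_append, List.cons.injEq] at e
    obtain ⟨rfl, rfl, -⟩ := e
    exact Or.inl h1
  | a :: b :: c :: l, _, e => simp at e

variable [DecidableEq V]

theorem chainShortcut_nil : chainShortcut ([] : List V) = ∅ := by
  rw [chainShortcut]
  split
  · rfl
  · next h => simp at h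

theorem chainShortcut_append {A R : List V} {mid : V} (hA : A.length = (A ++ mid :: R).length / 2) :
    chainShortcut (A ++ mid :: R) = A.toFinset ×ˢ {mid} ∪ {mid} ×ˢ R.toFinset ∪
        chainShortcut A ∪ chainShortcut R := by
  have h1 : (A ++ mid :: R).drop ((A ++ mid :: R).length / 2) = mid :: R := by
    rw [← hA, List.drop_left]
  have h2 : (A ++ mid :: R).take ((A ++ mid :: R).length / 2) = A := by
    rw [← hA, List.take_left]
  rw [chainShortcut]
  split
  · next h => rw [h1] at h; cases h
  · next m R' h =>
    rw [h1] at h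
    cases h
    rw [h2]

/-- Each level of the recursion adds at most one edge per vertex, and both halves have length at
most `n / 2`, where the logarithm is smaller by one. -/
theorem card_chainShortcut_le (L : List V) :
    (chainShortcut L).card ≤ L.length * Nat.log 2 L.length := by
  induction L using bisection_induction with
  | nil => simp [chainShortcut_nil]
  | append A mid R hA ihA ihR =>
    rw [chainShortcut_append hA]
    set n := (A ++ mid :: R).length with hn
    have hn' : n = A.length + R.length + 1 := by simp [hn]; omega
    have c1 : (A.toFinset ×ˢ ({mid} : Finset V)).card ≤ A.length := by
      simpa using List.toFinset_card_le A
    have c2 : (({mid} : Finset V) ×ˢ R.toFinset).card ≤ R.length := by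
      simpa using List.toFinset_card_le R
    have d1 := Finset.card_union_le (A.toFinset ×ˢ {mid} ∪ {mid} ×ˢ R.toFinset ∪ chainShortcut A)
      (chainShortcut R)
    have d2 := Finset.card_union_le (A.toFinset ×ˢ {mid} ∪ {mid} ×ˢ R.toFinset) (chainShortcut A)
    have d3 := Finset.card_union_le (A.toFinset ×ˢ {mid}) (({mid} : Finset V) ×ˢ R.toFinset)
    rcases Nat.lt_or_ge n 2 with h2 | h2
    · have hA0 : A.length = 0 := by omega
      have hR0 : R.length = 0 := by omega
      rw [hA0] at ihA c1
      rw [hR0] at ihR c2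
      omega
    · have e : Nat.log 2 (n / 2) + 1 = Nat.log 2 n := by
        have := Nat.log_pos one_lt_two h2
        rw [Nat.log_div_base]; omega
      have lA : Nat.log 2 A.length ≤ Nat.log 2 (n / 2) := Nat.log_mono_right (by omega)
      have lR : Nat.log 2 R.length ≤ Nat.log 2 (n / 2) := Nat.log_mono_right (by omega)
      have m1 := Nat.mul_le_mul_left A.length lA
      have m2 := Nat.mul_le_mul_left R.length lR
      rw [← e]
      generalize Nat.log 2 (n / 2) = b at *
      have : n * (b + 1) = A.length * b + R.length * b + b + n := by rw [hn']; ring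
      omega

theorem pair_sublist_of_mem_chainShortcut (L : List V) {u w : V} (h : (u, w) ∈ chainShortcut L) :
    [u, w] <+ L := by
  induction L using bisection_induction with
  | nil => simp [chainShortcut_nil] at h
  | append A mid R hA ihA ihR =>
    rw [chainShortcut_append hA] at h
    simp only [Finset.mem_union, Finset.mem_product, List.mem_toFinset, Finset.mem_singleton] at h
    rcases h with ((⟨h, rfl⟩ | ⟨rfl, h⟩) | h) | h
    · exact (List.singleton_sublist.2 h).append (List.singleton_sublist.2 (by simp : w ∈ w :: R))
    · exact ((List.singleton_sublist.2 h).cons_cons u).trans (List.sublist_append_right _ _)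
    · exact (ihA h).trans (List.sublist_append_left _ _)
    · exact (ihR h).trans ((List.sublist_cons_self _ _).trans (List.sublist_append_right _ _))

/-- Two elements of a chain are joined by at most two edges of its shortcut. -/
theorem chainShortcut_two_hop (L : List V) {u w : V} (h : [u, w] <+ L) :
    (u, w) ∈ chainShortcut L ∨ ∃ x, (u, x) ∈ chainShortcut L ∧ (x, w) ∈ chainShortcut L := by
  induction L using bisection_induction with
  | nil => simp at h
  | append A mid R hA ihA ihR =>
    rw [chainShortcut_append hA]
    simp only [Finset.mem_union, Finset.mem_product, List.mem_toFinset, Finset.mem_singleton]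
    rcases pair_sublist_cases h with h | ⟨h, rfl⟩ | ⟨h, h'⟩ | ⟨rfl, h⟩ | h
    · rcases ihA h with h | ⟨x, h, h'⟩
      · tauto
      · exact Or.inr ⟨x, by tauto⟩
    · tauto
    · exact Or.inr ⟨mid, by tauto⟩
    · tauto
    · rcases ihR h with h | ⟨x, h, h'⟩
      · tauto
      · exact Or.inr ⟨x, by tauto⟩

/-- When the recursion separates two neighbours, one of them must be the middle vertex. -/
theorem mem_chainShortcut_of_infix (L : List V) {u w : V} (h : [u, w] <:+: L) :
    (u, w) ∈ chainShortcut L := by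
  induction L using bisection_induction with
  | nil => simp at h
  | append A mid R hA ihA ihR =>
    rw [chainShortcut_append hA]
    simp only [Finset.mem_union, Finset.mem_product, List.mem_toFinset, Finset.mem_singleton]
    obtain ⟨S, T, e⟩ := h
    rw [List.append_assoc, List.append_eq_append_iff] at e
    rcases e with ⟨A', rfl, e⟩ | ⟨B, rfl, e⟩
    · match A', e with
      | [], e =>
        simp only [List.nil_append, List.cons_append, List.cons.injEq] at e
        obtain ⟨rfl, rfl⟩ := e
        simp
      | [a], e =>
        simp only [List.cons_append, List.nil_append, List.cons.injEq] at e
        obtain ⟨rfl, rfl, rfl⟩ := e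
        simp
      | a :: b :: A'', e =>
        simp only [List.cons_append, List.nil_append, List.cons.injEq] at e
        obtain ⟨rfl, rfl, e⟩ := e
        have := ihA ⟨S, A'', by simp⟩
        tauto
    · match B, e with
      | [], e =>
        simp only [List.nil_append, List.cons_append, List.cons.injEq] at e
        obtain ⟨rfl, rfl⟩ := e
        simp
      | b :: B', e =>
        simp only [List.cons_append, List.cons.injEq] at e
        obtain ⟨rfl, rfl⟩ := e
        have := ihR ⟨B', T, by simp⟩
        tauto

/-- Two elements of a chain that are not consecutive are joined by two edges of its shortcut. -/
theorem chainShortcut_between (L : List V) {u w : V} (hs : [u, w] <+ L) :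
    [u, w] <:+: L ∨
      ∃ x, (u, x) ∈ chainShortcut L ∧ (x, w) ∈ chainShortcut L := by
  induction L using bisection_induction with
  | nil => simp at hs
  | append A mid R hA ihA ihR =>
    have hc := chainShortcut_append hA
    have emb : ∀ S, S <:+: A ∨ S <:+: R → S <:+: A ++ mid :: R := by
      rintro S (hS | hS)
      · exact hS.trans (List.prefix_append _ _).isInfix
      · exact hS.trans ⟨A ++ [mid], [], by simp⟩
    have hm := fun a b => @mem_chainShortcut_of_infix V _ (A ++ mid :: R) a b
    rw [hc] at hm ⊢
    simp only [Finset.mem_union, Finset.mem_product, List.mem_toFinset, Finset.mem_singleton] at hm ⊢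
    rcases pair_sublist_cases hs with h | ⟨h, rfl⟩ | ⟨h, h'⟩ | ⟨rfl, h⟩ | h
    · rcases ihA h with h | ⟨x, h, h'⟩
      · exact Or.inl (emb _ (Or.inl h))
      · exact Or.inr ⟨x, by tauto⟩
    · obtain ⟨S, T, rfl⟩ := List.append_of_mem h
      match T with
      | [] => exact Or.inl ⟨S, R, by simp⟩
      | x :: T =>
        -- The successor `x` of `u` is joined to `u` as a neighbour, and to the middle vertex `w`
        -- because it still lies before it.
        refine Or.inr ⟨x, hm _ _ ⟨S, T ++ w :: R, by simp⟩, ?_⟩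
        simp
    · exact Or.inr ⟨mid, by tauto⟩
    · obtain ⟨S, T, rfl⟩ := List.append_of_mem h
      rcases List.eq_nil_or_concat S with rfl | ⟨S', x, rfl⟩
      · exact Or.inl ⟨A, T, by simp⟩
      · refine Or.inr ⟨x, ?_, hm _ _ ⟨A ++ u :: S', T, by simp⟩⟩
        simp
    · rcases ihR h with h | ⟨x, h, h'⟩
      · exact Or.inl (emb _ (Or.inr h))
      · exact Or.inr ⟨x, by tauto⟩

end ChainShortcut

/-! ### The movement of index sequences through the network, independent of priorities. -/

section Run

variable {W : Type u} [DecidableEq W] {ι : Type*}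

/-- The part of the sequence `L` that is handed over to `y` if `g z` elements are handed over to
each listed node `z`. -/
def slice (g : Node W → ℕ) : List ι → List (Node W) → Node W → List ι
  | _, [], _ => []
  | L, z :: zs, y => if y = z then L.take (g z) else slice g (L.drop (g z)) zs y

theorem slice_of_notMem (g : Node W → ℕ) (L : List ι) {zs : List (Node W)} {y : Node W}
    (h : y ∉ zs) : slice g L zs y = [] := by
  induction zs generalizing L with
  | nil => rfl
  | cons z zs ih =>
    rw [List.mem_cons, not_or] at h
    rw [slice, if_neg h.1, ih _ h.2]

theorem slice_infix (g : Node W → ℕ) (L : List ι) (zs : List (Node W)) (y : Node W) :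
    slice g L zs y <:+: L := by
  induction zs generalizing L with
  | nil => exact List.nil_infix
  | cons z zs ih =>
    rw [slice]
    split_ifs
    · exact (List.take_prefix _ _).isInfix
    · exact (ih _).trans (List.drop_suffix _ _).isInfix

theorem length_slice (g : Node W → ℕ) {L : List ι} {zs : List (Node W)} (hzs : zs.Nodup)
    (h : (zs.map g).sum ≤ L.length) {y : Node W} (hy : y ∈ zs) :
    (slice g L zs y).length = g y := by
  induction zs generalizing L with
  | nil => simp at hy
  | cons z zs ih =>
    rw [List.map_cons, List.sum_cons] at h
    rw [slice]
    split_ifs with hyz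
    · rw [List.length_take, hyz]; omega
    · refine ih (List.nodup_cons.1 hzs).2 ?_ ((List.mem_cons.1 hy).resolve_left hyz)
      rw [List.length_drop]; omega

theorem flatMap_slice (g : Node W → ℕ) {L : List ι} {zs : List (Node W)} (hzs : zs.Nodup)
    (h : (zs.map g).sum = L.length) : zs.flatMap (slice g L zs) = L := by
  induction zs generalizing L with
  | nil => simpa using h.symm
  | cons z zs ih =>
    rw [List.map_cons, List.sum_cons] at h
    have hz := (List.nodup_cons.1 hzs).1
    have e : zs.flatMap (slice g L (z :: zs)) = zs.flatMap (slice g (L.drop (g z)) zs) := by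
      rw [List.flatMap_def, List.flatMap_def]
      congr 1
      refine List.map_congr_left fun y hy => ?_
      rw [slice, if_neg]
      rintro rfl
      exact hz hy
    rw [List.flatMap_cons, e, ih (List.nodup_cons.1 hzs).2 (by rw [List.length_drop]; omega), slice,
      if_pos rfl, List.take_append_drop]

/-- The sequences at all nodes after the listed nodes have been processed, beginning with the
sequences `Q`. -/
def run (g : Node W → Node W → ℕ) (out : Node W → List (Node W)) :
    List (Node W) → (Node W → List ι) → Node W → List ι
  | [], Q => Q
  | x :: xs, Q => run g out xs fun y => Q y ++ slice (g x) (Q x) (out x) y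

theorem prefix_run (g : Node W → Node W → ℕ) (out : Node W → List (Node W)) (xs : List (Node W))
    (Q : Node W → List ι) (y : Node W) : Q y <+: run g out xs Q y := by
  induction xs generalizing Q with
  | nil => exact List.prefix_rfl
  | cons x xs ih => exact (List.prefix_append _ _).trans (ih fun y => Q y ++ slice (g x) (Q x) (out x) y)

theorem run_of_notMem (g : Node W → Node W → ℕ) {out : Node W → List (Node W)} {xs : List (Node W)}
    (Q : Node W → List ι) {y : Node W} (h : ∀ x ∈ xs, y ∉ out x) : run g out xs Q y = Q y := by
  induction xs generalizing Q with
  | nil => rfl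
  | cons x xs ih =>
    rw [run, ih _ fun z hz => h z (List.mem_cons_of_mem _ hz),
      slice_of_notMem _ _ (h x List.mem_cons_self), List.append_nil]

theorem run_cons_self (g : Node W → Node W → ℕ) {out : Node W → List (Node W)} {x : Node W}
    {xs : List (Node W)} (Q : Node W → List ι) (hx : x ∉ out x)
    (h : (x :: xs).Pairwise fun a b => a ∉ out b) : run g out (x :: xs) Q x = Q x := by
  refine run_of_notMem g Q fun z hz => ?_
  rcases List.mem_cons.1 hz with rfl | hz
  · exact hx
  · exact (List.pairwise_cons.1 h).1 z hz

/-- In topological order nothing reaches a node once it has been processed, so a node hands on its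
final sequence. The recursion thereby becomes an equation between final sequences. -/
theorem run_eq (g : Node W → Node W → ℕ) {out : Node W → List (Node W)} {xs : List (Node W)}
    (Q : Node W → List ι) (hx : ∀ x ∈ xs, x ∉ out x) (h : xs.Pairwise fun a b => a ∉ out b)
    (y : Node W) :
    run g out xs Q y = Q y ++ xs.flatMap fun x => slice (g x) (run g out xs Q x) (out x) y := by
  induction xs generalizing Q with
  | nil => simp [run]
  | cons x xs ih =>
    rw [List.flatMap_cons, run_cons_self g Q (hx x List.mem_cons_self) h, run,
      ih _ (fun z hz => hx z (List.mem_cons_of_mem _ hz)) (List.pairwise_cons.1 h).2,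
      List.append_assoc]

end Run

/-! ### The algorithm's state as treaps of the sequences of `run`, and the cost of its operations.
-/

section Simulation

variable {W : Type u} [DecidableEq W] {l : ℕ}

/-- The trees of a state are treaps of given sequences. -/
def Represents (p : Fin l → Fin l) (S : State W l) (Q : Node W → List (Fin l)) : Prop :=
  ∀ x, inorder (S.tree x) = Q x ∧ IsHeap p (S.tree x)

/-- `i` is the root of the treap of the sequence `q`. -/
def IsRoot (p : Fin l → Fin l) (q : List (Fin l)) (i : Fin l) : Prop :=
  i ∈ q ∧ ∀ k ∈ q, p i ≤ p k

instance (p : Fin l → Fin l) (q : List (Fin l)) (i : Fin l) : Decidable (IsRoot p q i) := by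
  unfold IsRoot; infer_instance


theorem distribute_chain (p : Fin l → Fin l) (f : GadgetFlow W) (x : Node W) (ys : List (Node W))
    (T : BinaryTree (Fin l)) (S : State W l) : (distribute p f x ys T S).chain = S.chain := by
  induction ys generalizing T S with
  | nil => rfl
  | cons y ys ih => rw [distribute, ih]

theorem represents_distribute {p : Fin l → Fin l} (f : GadgetFlow W) (x : Node W)
    {ys : List (Node W)} (hys : ys.Nodup) {T : BinaryTree (Fin l)} (hT : IsHeap p T)
    {S : State W l} {Q : Node W → List (Fin l)} (hS : Represents p S Q) :
    Represents p (distribute p f x ys T S) fun y => Q y ++ slice (f.onEdge x) (inorder T) ys y := by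
  induction ys generalizing T S Q with
  | nil => simpa [distribute, slice] using hS
  | cons y ys ih =>
    have hT' := isHeap_split p T (f.onEdge x y) hT
    have hi := inorder_split T (f.onEdge x y)
    have h1 := ih (List.nodup_cons.1 hys).2 hT'.2
      (S := { S with
          tree := Function.update S.tree y (join p (S.tree y) (split T (f.onEdge x y)).1)
          work := S.work + splitSteps T (f.onEdge x y) +
            joinSteps p (S.tree y) (split T (f.onEdge x y)).1 })
      (Q := Function.update Q y (Q y ++ (inorder T).take (f.onEdge x y))) (by
        intro z
        by_cases hz : z = y
        · subst hz
          simp only [Function.update_self]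
          rw [inorder_join, (hS z).1, hi.1]
          exact ⟨rfl, isHeap_join _ _ _ (hS z).2 hT'.1⟩
        · simp only [Function.update_of_ne hz]
          exact hS z)
    rw [distribute]
    intro z
    refine ⟨(h1 z).1.trans ?_, (h1 z).2⟩
    rw [hi.2]
    beta_reduce
    by_cases hz : z = y
    · subst hz
      rw [Function.update_self, slice_of_notMem _ _ (List.nodup_cons.1 hys).1, slice, if_pos rfl,
        List.append_nil]
    · rw [Function.update_of_ne hz, slice, if_neg hz]

/-- An edge costs one split of at most `t + 1` steps and one join of at most `2 * t + 1`. In the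
application `L` and `R y` are the final sequences, which contain the current ones as blocks. -/
theorem distribute_work_le {p : Fin l → Fin l} (f : GadgetFlow W) (x : Node W)
    {ys : List (Node W)} (hys : ys.Nodup) {T : BinaryTree (Fin l)} (hT : IsHeap p T)
    {S : State W l} {Q : Node W → List (Fin l)} (hS : Represents p S Q) {t : ℕ}
    {L : List (Fin l)} (hL : L.Nodup ∧ ∀ i ∈ L, (ancs p L i).card ≤ t) (hTL : inorder T <:+: L)
    {R : Node W → List (Fin l)} (hR : ∀ y, (R y).Nodup ∧ ∀ i ∈ R y, (ancs p (R y) i).card ≤ t)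
    (hQR : ∀ y, Q y ++ slice (f.onEdge x) (inorder T) ys y <+: R y) :
    (distribute p f x ys T S).work ≤ S.work + ys.length * (3 * t + 2) := by
  induction ys generalizing T S Q with
  | nil => simp [distribute]
  | cons y ys ih =>
    have hT' := isHeap_split p T (f.onEdge x y) hT
    have hi := inorder_split T (f.onEdge x y)
    rw [distribute]
    refine (ih (List.nodup_cons.1 hys).2 hT'.2
      (Q := Function.update Q y (Q y ++ (inorder T).take (f.onEdge x y))) ?_ ?_ ?_).trans ?_
    · intro z
      by_cases hz : z = y
      · subst hz
        simp only [Function.update_self]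
        rw [inorder_join, (hS z).1, hi.1]
        exact ⟨rfl, isHeap_join _ _ _ (hS z).2 hT'.1⟩
      · simp only [Function.update_of_ne hz]
        exact hS z
    · rw [hi.2]
      exact (List.drop_suffix _ _).isInfix.trans hTL
    · intro z
      refine List.IsPrefix.trans ?_ (hQR z)
      rw [hi.2]
      by_cases hz : z = y
      · subst hz
        rw [Function.update_self, slice_of_notMem _ _ (List.nodup_cons.1 hys).1, slice, if_pos rfl,
          List.append_nil]
      · rw [Function.update_of_ne hz, slice, if_neg hz]
    · have b1 := splitSteps_le T (f.onEdge x y)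
      have b2 := joinSteps_le p (S.tree y) (split T (f.onEdge x y)).1
      have c1 := height_le_of_infix hT hL.1 hTL hL.2
      have c2 := height_le_of_infix hT'.1 hL.1
        (by rw [hi.1]; exact (List.take_prefix _ _).isInfix.trans hTL) hL.2
      have c3 := height_le_of_infix (hS y).2 (hR y).1
        (by rw [(hS y).1]; exact ((List.prefix_append _ _).trans (hQR y)).isInfix) (hR y).2
      simp only [List.length_cons]
      rw [add_mul]
      omega

theorem assign_tree (S : State W l) (x : Node W) : (assign S x).tree = S.tree := by
  cases x with
  | vert v => rw [assign]; split <;> rfl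
  | source => rfl
  | sink => rfl

theorem assign_work (S : State W l) (x : Node W) : (assign S x).work = S.work := by
  cases x with
  | vert v => rw [assign]; split <;> rfl
  | source => rfl
  | sink => rfl

theorem represents_visit {p : Fin l → Fin l} (f : GadgetFlow W) {out : Node W → List (Node W)}
    (hout : ∀ x, (out x).Nodup) {S : State W l} {Q : Node W → List (Fin l)}
    (hS : Represents p S Q) (x : Node W) :
    Represents p (visit p f out S x) fun y => Q y ++ slice (f.onEdge x) (Q x) (out x) y := by
  rw [visit, ← (hS x).1]
  refine represents_distribute f x (hout x) (hS x).2 fun z => ?_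
  rw [assign_tree]
  exact hS z

theorem assign_chain {p : Fin l → Fin l} (hp : p.Injective) {S : State W l}
    {Q : Node W → List (Fin l)} (hS : Represents p S Q) (v : W) (i : Fin l) :
    (assign S (.vert v)).chain i = S.chain i ++ if IsRoot p (Q (.vert v)) i then [v] else [] := by
  have h := fun j => member_eq_some_iff hp (hS (.vert v)).2 j
  rw [(hS (.vert v)).1] at h
  rw [assign]
  split
  · next j hj =>
    by_cases hij : i = j
    · subst hij
      simp only [Function.update_self]
      have hr : IsRoot p (Q (.vert v)) i := (h i).1 hj
      rw [if_pos hr]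
    · simp only [Function.update_of_ne hij]
      rw [if_neg, List.append_nil]
      intro hr
      have := (h i).2 hr
      rw [hj] at this
      exact hij (Option.some.inj this).symm
  · next hj =>
    rw [if_neg, List.append_nil]
    intro hr
    have := (h i).2 hr
    rw [hj] at this
    cases this

theorem chain_foldl {p : Fin l → Fin l} (hp : p.Injective) (f : GadgetFlow W)
    {out : Node W → List (Node W)} (hout : ∀ x, (out x).Nodup) (vs : List W)
    (hself : ∀ x, x ∉ out x) (hpw : (vs.map Node.vert).Pairwise fun a b => a ∉ out b)
    {S : State W l} {Q : Node W → List (Fin l)} (hS : Represents p S Q) (i : Fin l) :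
    ((vs.map Node.vert).foldl (visit p f out) S).chain i =
      S.chain i ++ vs.filter fun v => IsRoot p (run f.onEdge out (vs.map Node.vert) Q (.vert v)) i := by
  induction vs generalizing S Q with
  | nil => simp
  | cons v vs ih =>
    rw [List.map_cons] at hpw
    rw [List.map_cons, List.foldl_cons, ih (List.pairwise_cons.1 hpw).2 (represents_visit f hout hS _),
      visit, distribute_chain, assign_chain hp hS, List.filter_cons,
      run_cons_self f.onEdge Q (hself _) hpw, run]
    split_ifs with h1 h2 h2
    · simp
    · simp [h1] at h2
    · simp [h1] at h2
    · simp

theorem work_foldl_le {p : Fin l → Fin l} (f : GadgetFlow W) {out : Node W → List (Node W)}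
    (hout : ∀ x, (out x).Nodup) (xs : List (Node W)) {S : State W l} {Q : Node W → List (Fin l)}
    (hS : Represents p S Q) {t : ℕ}
    (ht : ∀ y, (run f.onEdge out xs Q y).Nodup ∧
      ∀ i ∈ run f.onEdge out xs Q y, (ancs p (run f.onEdge out xs Q y) i).card ≤ t) :
    (xs.foldl (visit p f out) S).work ≤
      S.work + (xs.map fun x => (out x).length).sum * (3 * t + 2) := by
  induction xs generalizing S Q with
  | nil => simp
  | cons x xs ih =>
    have h1 := ih (represents_visit f hout hS x) ht
    have h2 : (visit p f out S x).work ≤ S.work + (out x).length * (3 * t + 2) := by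
      rw [visit, ← assign_work S x]
      refine distribute_work_le f x (hout x) (hS x).2 (Q := Q) (fun z => ?_) (ht x) ?_ ht ?_
      · rw [assign_tree]
        exact hS z
      · rw [(hS x).1]
        exact (prefix_run _ _ _ _ _).isInfix
      · intro y
        rw [(hS x).1]
        exact prefix_run f.onEdge out xs (fun y => Q y ++ slice (f.onEdge x) (Q x) (out x) y) y
    rw [List.foldl_cons, List.map_cons, List.sum_cons, add_mul]
    omega

theorem foldl_join_spec (p : Fin l → Fin l) (L : List (Fin l)) (S : BinaryTree (Fin l) × ℕ)
    (hS : IsHeap p S.1) :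
    let S' := L.foldl (fun (S : BinaryTree (Fin l) × ℕ) i =>
      (join p S.1 (.node i .nil .nil), S.2 + joinSteps p S.1 (.node i .nil .nil))) S
    inorder S'.1 = inorder S.1 ++ L ∧ IsHeap p S'.1 ∧
      ∀ t, (inorder S.1 ++ L).Nodup →
        (∀ i ∈ inorder S.1 ++ L, (ancs p (inorder S.1 ++ L) i).card ≤ t) →
        S'.2 ≤ S.2 + L.length * (t + 2) := by
  induction L generalizing S with
  | nil => simp [hS]
  | cons i L ih =>
    have h1 : IsHeap p (.node i .nil .nil) := by simp [IsHeap, inorder]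
    obtain ⟨a, b, c⟩ := ih (join p S.1 (.node i .nil .nil),
      S.2 + joinSteps p S.1 (.node i .nil .nil)) (isHeap_join p _ _ hS h1)
    have e : inorder (join p S.1 (.node i .nil .nil)) ++ L = inorder S.1 ++ i :: L := by
      simp [inorder_join, inorder]
    rw [e] at a c
    refine ⟨a, b, fun t hn ht => (c t hn ht).trans ?_⟩
    have b2 := joinSteps_le p S.1 (.node i .nil .nil)
    have c2 := height_le_of_infix hS hn (List.prefix_append _ _).isInfix ht
    simp only [BinaryTree.height, List.length_cons] at *
    rw [add_mul]
    omega

/-- The initial sequences. -/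
def initSeq (W : Type u) [DecidableEq W] (l : ℕ) : Node W → List (Fin l) :=
  Function.update (fun _ => []) .source (List.finRange l)

theorem represents_initState (p : Fin l → Fin l) :
    Represents p (initState W p) (initSeq W l) := by
  intro x
  obtain ⟨a, b, -⟩ := foldl_join_spec p (List.finRange l) (.nil, 0) trivial
  by_cases hx : x = .source
  · subst hx
    simp only [initState, initSeq, Function.update_self]
    exact ⟨a, b⟩
  · simp only [initState, initSeq, Function.update_of_ne hx]
    exact ⟨rfl, trivial⟩

theorem initState_work_le {p : Fin l → Fin l} {t : ℕ}
    (ht : ∀ i ∈ List.finRange l, (ancs p (List.finRange l) i).card ≤ t) :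
    (initState W p).work ≤ l * (t + 2) := by
  obtain ⟨-, -, c⟩ := foldl_join_spec p (List.finRange l) (.nil, 0) trivial
  have := c t (List.nodup_finRange l) ht
  simp only [List.length_finRange, zero_add] at this
  exact this

end Simulation

/-! ### The paths that the indices follow in a flow on a DAG. -/

section Routing

variable {W : Type u} [Fintype W] [DecidableEq W]

instance : Fintype (Node W) :=
  Fintype.ofEquiv (Option (Option W))
    { toFun := fun x => match x with
        | none => .source
        | some none => .sink
        | some (some v) => .vert v
      invFun := fun x => match x with
        | .source => none
        | .sink => some none
        | .vert v => some (some v)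
      left_inv := by rintro (_ | _ | _) <;> rfl
      right_inv := by rintro (_ | _ | _) <;> rfl }

theorem Node.vert_injective : (Node.vert : W → Node W).Injective := fun _ _ h => Node.vert.inj h

theorem Node.univ_eq : (Finset.univ : Finset (Node W)) =
    insert .source (insert .sink (Finset.univ.map ⟨Node.vert, Node.vert_injective⟩)) := by
  ext x
  cases x <;> simp

theorem Node.sum_univ {M : Type*} [AddCommMonoid M] (F : Node W → M) :
    ∑ x, F x = F .source + (F .sink + ∑ v, F (.vert v)) := by
  rw [Node.univ_eq, Finset.sum_insert (by simp), Finset.sum_insert (by simp), Finset.sum_map]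
  rfl

/-- The source followed by all vertices. -/
def nodes (order : List W) : List (Node W) := .source :: order.map .vert

/-- A flow on a directed acyclic graph together with the choices of the algorithm. -/
structure IsRouting (A : Finset (W × W)) (l : ℕ) (f : GadgetFlow W)
    (out : Node W → List (Node W)) (order : List W) : Prop where
  loopless : ∀ v, (v, v) ∉ A
  isFlow : f.IsFlow A l
  isOutList : IsOutList A out
  isTopologicalOrder : IsTopologicalOrder A order

/-- The position of a node in the order of processing. -/
def rank (order : List W) : Node W → ℕ
  | .source => 0
  | .vert v => order.idxOf v + 1
  | .sink => order.length + 1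

/-- The sequence of path indices at a node, which does not depend on the priorities. -/
def seqAt (l : ℕ) (f : GadgetFlow W) (out : Node W → List (Node W)) (order : List W) :
    Node W → List (Fin l) :=
  run f.onEdge out (nodes order) (initSeq W l)

/-- The sequence of path indices that are sent along an edge. -/
def seqOn (l : ℕ) (f : GadgetFlow W) (out : Node W → List (Node W)) (order : List W)
    (x y : Node W) : List (Fin l) :=
  slice (f.onEdge x) (seqAt l f out order x) (out x) y

theorem infix_flatMap {α β : Type*} (g : α → List β) {L : List α} {a : α} (h : a ∈ L) :
    g a <:+: L.flatMap g := by
  obtain ⟨S, T, rfl⟩ := List.append_of_mem h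
  exact ⟨S.flatMap g, T.flatMap g, by simp⟩

namespace IsRouting

variable {A : Finset (W × W)} {l : ℕ} {f : GadgetFlow W} {out : Node W → List (Node W)}
  {order : List W}

local notation "qAt" => seqAt l f out order
local notation "qOn" => seqOn l f out order

theorem idxOf_lt (h : IsRouting A l f out order) {u v : W} (huv : (u, v) ∈ A) :
    order.idxOf u < order.idxOf v := by
  obtain ⟨-, hmem, hpw⟩ := h.isTopologicalOrder
  rcases lt_trichotomy (order.idxOf u) (order.idxOf v) with h1 | h1 | h1
  · exact h1
  · rw [List.idxOf_inj (hmem u)] at h1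
    subst h1
    exact absurd huv (h.loopless _)
  · have := List.pairwise_iff_getElem.1 hpw _ _ (List.idxOf_lt_length_of_mem (hmem v))
      (List.idxOf_lt_length_of_mem (hmem u)) h1
    rw [List.getElem_idxOf, List.getElem_idxOf] at this
    exact absurd huv this

theorem rank_lt (h : IsRouting A l f out order) {x y : Node W} (hxy : ExtAdj A x y) :
    rank order x < rank order y := by
  cases x <;> cases y <;> simp only [ExtAdj] at hxy <;> simp only [rank]
  · omega
  · have := List.idxOf_lt_length_of_mem (h.isTopologicalOrder.2.1 ‹W›)
    omega
  · have := h.idxOf_lt hxy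
    omega

theorem mem_out (h : IsRouting A l f out order) {x y : Node W} : y ∈ out x ↔ ExtAdj A x y :=
  (h.isOutList x).2 y

theorem nodup_out (h : IsRouting A l f out order) (x : Node W) : (out x).Nodup :=
  (h.isOutList x).1

theorem notMem_out_self (h : IsRouting A l f out order) (x : Node W) : x ∉ out x := by
  rw [h.mem_out]
  intro hx
  exact absurd (h.rank_lt hx) (lt_irrefl _)

theorem nodup_nodes (h : IsRouting A l f out order) : (nodes order).Nodup := by
  rw [nodes, List.nodup_cons]
  exact ⟨by simp, h.isTopologicalOrder.1.map Node.vert_injective⟩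

theorem mem_nodes (h : IsRouting A l f out order) {x : Node W} : x ∈ nodes order ↔ x ≠ .sink := by
  have := h.isTopologicalOrder.2.1
  cases x <;> simp [nodes, this]

theorem pairwise_vert (h : IsRouting A l f out order) :
    (order.map Node.vert).Pairwise fun a b => a ∉ out b := by
  rw [List.pairwise_map]
  refine h.isTopologicalOrder.2.2.imp fun {a b} hab => ?_
  rw [h.mem_out]
  exact hab

theorem source_notMem_out (h : IsRouting A l f out order) (x : Node W) : Node.source ∉ out x := by
  rw [h.mem_out]
  cases x <;> simp [ExtAdj]

theorem pairwise_nodes (h : IsRouting A l f out order) :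
    (nodes order).Pairwise fun a b => a ∉ out b := by
  rw [nodes, List.pairwise_cons]
  exact ⟨fun b _ => h.source_notMem_out b, h.pairwise_vert⟩

theorem seqAt_eq (h : IsRouting A l f out order) (y : Node W) :
    qAt y = initSeq W l y ++ (nodes order).flatMap fun x => qOn x y :=
  run_eq f.onEdge _ (fun x _ => h.notMem_out_self x) h.pairwise_nodes y

theorem seqOn_eq_nil (h : IsRouting A l f out order) {x y : Node W} (hxy : ¬ ExtAdj A x y) :
    qOn x y = [] :=
  slice_of_notMem _ _ (by rwa [h.mem_out])

theorem extAdj_of_mem (h : IsRouting A l f out order) {x y : Node W} {j : Fin l}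
    (hj : j ∈ qOn x y) : ExtAdj A x y := by
  by_contra hxy
  rw [h.seqOn_eq_nil hxy] at hj
  simp at hj

theorem seqAt_source (h : IsRouting A l f out order) : qAt .source = List.finRange l := by
  rw [h.seqAt_eq, initSeq, Function.update_self]
  conv_rhs => rw [← List.append_nil (List.finRange l)]
  congr 1
  rw [List.flatMap_eq_nil_iff]
  intro x _
  exact h.seqOn_eq_nil (by cases x <;> simp [ExtAdj])

theorem seqAt_of_ne_source (h : IsRouting A l f out order) {y : Node W} (hy : y ≠ .source) :
    qAt y = (nodes order).flatMap fun x => qOn x y := by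
  rw [h.seqAt_eq, initSeq, Function.update_of_ne hy, List.nil_append]

theorem onEdge_eq_zero (h : IsRouting A l f out order) {x y : Node W} (hxy : ¬ ExtAdj A x y) :
    f.onEdge x y = 0 := by
  cases x <;> cases y <;> simp only [ExtAdj, not_true_eq_false, GadgetFlow.onEdge] at *
  exact h.isFlow.support _ _ hxy

theorem sum_out (h : IsRouting A l f out order) (x : Node W) :
    ((out x).map (f.onEdge x)).sum = ∑ y, f.onEdge x y := by
  rw [← List.sum_toFinset _ (h.nodup_out x)]
  refine Finset.sum_subset (Finset.subset_univ _) fun y _ hy => h.onEdge_eq_zero ?_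
  rwa [List.mem_toFinset, h.mem_out] at hy

theorem conservation (h : IsRouting A l f out order) (v : W) :
    ∑ x, f.onEdge x (.vert v) = ∑ y, f.onEdge (.vert v) y := by
  have h1 := h.isFlow.conservation_in v
  have h2 := h.isFlow.conservation_out v
  rw [Node.sum_univ, Node.sum_univ]
  simp only [GadgetFlow.onEdge]
  omega

/-- Induction along the topological order: the nodes feeding `x` hold as many indices as flow leaves
them, so every slice has its full length, which `List.take` alone would not guarantee. Conservation
then gives the count at `x`. -/
theorem length_seqAt (h : IsRouting A l f out order) {x : Node W} (hx : x ≠ .sink) :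
    (qAt x).length = ∑ y, f.onEdge x y := by
  induction hr : rank order x using Nat.strong_induction_on generalizing x with
  | _ r ih =>
    subst hr
    cases x with
    | sink => exact absurd rfl hx
    | source =>
      rw [h.seqAt_source, List.length_finRange, Node.sum_univ]
      simp only [GadgetFlow.onEdge, zero_add]
      exact h.isFlow.value.symm
    | vert v =>
      rw [h.seqAt_of_ne_source (by simp), List.length_flatMap, ← h.conservation,
        ← List.sum_toFinset _ h.nodup_nodes]
      have hsub := Finset.sum_subset (Finset.subset_univ (nodes order).toFinset)
        (f := fun x => f.onEdge x (.vert v)) fun y _ hy => by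
          rw [List.mem_toFinset, h.mem_nodes, not_not] at hy
          subst hy
          rfl
      rw [← hsub]
      refine Finset.sum_congr rfl fun x hx => ?_
      rw [List.mem_toFinset, h.mem_nodes] at hx
      by_cases hxv : ExtAdj A x (.vert v)
      · refine length_slice _ (h.nodup_out x) ?_ (h.mem_out.2 hxv)
        rw [h.sum_out, ih _ (h.rank_lt hxv) hx rfl]
      · rw [h.seqOn_eq_nil hxv, h.onEdge_eq_zero hxv, List.length_nil]

theorem seqAt_eq_flatMap_out (h : IsRouting A l f out order) {x : Node W} (hx : x ≠ .sink) :
    (out x).flatMap (qOn x) = qAt x :=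
  flatMap_slice _ (h.nodup_out x) (by rw [h.sum_out, h.length_seqAt hx])

theorem seqOn_infix_left (x y : Node W) : qOn x y <:+: qAt x :=
  slice_infix _ _ _ _

/-- What arrives along one edge is joined in one piece and stays contiguous. Together with
`seqOn_infix_left` this lets treaps at adjacent nodes be compared. -/
theorem seqOn_infix_right (h : IsRouting A l f out order) (x y : Node W) : qOn x y <:+: qAt y := by
  by_cases hxy : ExtAdj A x y
  · rw [h.seqAt_of_ne_source (by rintro rfl; cases x <;> exact hxy)]
    refine infix_flatMap (fun x => qOn x y) (h.mem_nodes.2 ?_)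
    rintro rfl
    exact hxy
  · rw [h.seqOn_eq_nil hxy]
    exact List.nil_infix

theorem exists_in (h : IsRouting A l f out order) {x : Node W} (hx : x ≠ .source) {j : Fin l}
    (hj : j ∈ qAt x) : ∃ z, j ∈ qOn z x := by
  rw [h.seqAt_of_ne_source hx, List.mem_flatMap] at hj
  obtain ⟨z, -, hz⟩ := hj
  exact ⟨z, hz⟩

theorem exists_out (h : IsRouting A l f out order) {x : Node W} (hx : x ≠ .sink) {j : Fin l}
    (hj : j ∈ qAt x) : ∃ y, j ∈ qOn x y := by
  rw [← h.seqAt_eq_flatMap_out hx, List.mem_flatMap] at hj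
  obtain ⟨z, -, hz⟩ := hj
  exact ⟨z, hz⟩

theorem eq_of_mem_seqOn (h : IsRouting A l f out order) {x y y' : Node W} {j : Fin l}
    (hx : (qAt x).Nodup) (hy : j ∈ qOn x y) (hy' : j ∈ qOn x y') : y = y' := by
  have hxs : x ≠ .sink := by rintro rfl; exact h.extAdj_of_mem hy
  rw [← h.seqAt_eq_flatMap_out hxs, List.nodup_flatMap] at hx
  by_contra hne
  have : Std.Symm (Function.onFun List.Disjoint (qOn x)) := ⟨fun _ _ hab => hab.symm⟩
  exact List.Pairwise.forall hx.2 (h.mem_out.2 (h.extAdj_of_mem hy))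
    (h.mem_out.2 (h.extAdj_of_mem hy')) hne hy hy'

/-- Both claims need a joint induction on the rank. If `j` arrived at `x` from `z` and from `z'`,
both would lie on the trajectory of `j` from the source, so one of them, say `z`, leads to the
other. But its next step is `x`, so `z'` would not precede `x`. The relation includes `Nodup` so
that successors are unique. -/
theorem nodup_and_reaches (h : IsRouting A l f out order) (x : Node W) :
    (qAt x).Nodup ∧ ∀ j ∈ qAt x,
      Relation.ReflTransGen (fun x y => j ∈ qOn x y ∧ (qAt x).Nodup) .source x := by
  induction hr : rank order x using Nat.strong_induction_on generalizing x with
  | _ r ih =>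
    subst hr
    by_cases hx : x = .source
    · subst hx
      exact ⟨by rw [h.seqAt_source]; exact List.nodup_finRange l, fun _ _ => .refl⟩
    · have hstep : ∀ z, ∀ j ∈ qOn z x, (qAt z).Nodup ∧
          Relation.ReflTransGen (fun x y => j ∈ qOn x y ∧ (qAt x).Nodup) .source z := by
        intro z j hj
        obtain ⟨h1, h2⟩ := ih _ (h.rank_lt (h.extAdj_of_mem hj)) z rfl
        exact ⟨h1, h2 j ((seqOn_infix_left z x).subset hj)⟩
      refine ⟨?_, fun j hj => ?_⟩
      · rw [h.seqAt_of_ne_source hx, List.nodup_flatMap]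
        constructor
        · intro z _
          by_cases hzx : ExtAdj A z x
          · exact (ih _ (h.rank_lt hzx) z rfl).1.sublist (seqOn_infix_left z x).sublist
          · rw [h.seqOn_eq_nil hzx]
            exact List.nodup_nil
        · refine h.nodup_nodes.imp fun {z z'} hne j hj hj' => ?_
          have key : ∀ z z', z ≠ z' → j ∈ qOn z x → j ∈ qOn z' x →
              ¬ Relation.ReflTransGen (fun x y => j ∈ qOn x y ∧ (qAt x).Nodup) z z' := by
            intro z z' hne hj hj' hzz
            rcases Relation.ReflTransGen.cases_head hzz with rfl | ⟨y, ⟨hy, -⟩, hyz⟩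
            · exact hne rfl
            · have := h.eq_of_mem_seqOn (hstep z j hj).1 hj hy
              subst this
              have hle : rank order x ≤ rank order z' := by
                clear hj' hzz hne
                induction hyz with
                | refl => exact le_rfl
                | tail _ hab ih' => exact ih'.trans (h.rank_lt (h.extAdj_of_mem hab.1)).le
              exact absurd (h.rank_lt (h.extAdj_of_mem hj')) (not_lt.2 hle)
          rcases Relation.ReflTransGen.total_of_right_unique
            (fun a b c hab hac => h.eq_of_mem_seqOn hab.2 hab.1 hac.1)
            (hstep z j hj).2 (hstep z' j hj').2 with hzz | hzz
          · exact key z z' hne hj hj' hzz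
          · exact key z' z hne.symm hj' hj hzz
      · obtain ⟨z, hz⟩ := h.exists_in hx hj
        exact (hstep z j hz).2.tail ⟨hz, (hstep z j hz).1⟩

theorem nodup_seqAt (h : IsRouting A l f out order) (x : Node W) : (qAt x).Nodup :=
  (h.nodup_and_reaches x).1

theorem rank_le (h : IsRouting A l f out order) {x y : Node W} {j : Fin l}
    (hxy : Relation.ReflTransGen (fun x y => j ∈ qOn x y) x y) : rank order x ≤ rank order y := by
  induction hxy with
  | refl => exact le_rfl
  | tail _ hab ih' => exact ih'.trans (h.rank_lt (h.extAdj_of_mem hab)).le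

/-- The nodes that are visited by the same path are visited one after another. -/
theorem reflTransGen_of_rank_lt (h : IsRouting A l f out order) {x y : Node W} {j : Fin l}
    (hx : j ∈ qAt x) (hy : j ∈ qAt y) (hxy : rank order x < rank order y) :
    Relation.ReflTransGen (fun x y => j ∈ qOn x y) x y := by
  have hx' := Relation.ReflTransGen.mono (p := fun x y => j ∈ qOn x y) (fun _ _ h => h.1) _ _ ((h.nodup_and_reaches x).2 j hx)
  have hy' := Relation.ReflTransGen.mono (p := fun x y => j ∈ qOn x y) (fun _ _ h => h.1) _ _ ((h.nodup_and_reaches y).2 j hy)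
  rcases Relation.ReflTransGen.total_of_right_unique
    (fun a b c hab hac => h.eq_of_mem_seqOn (h.nodup_seqAt a) hab hac) hx' hy' with hr | hr
  · exact hr
  · exact absurd (h.rank_le hr) (not_le.2 hxy)

/-- A path of the routing that leads from a vertex to a vertex is a path of the graph. -/
theorem reaches_of_reflTransGen (h : IsRouting A l f out order) {u w : W} {j : Fin l}
    (hxy : Relation.ReflTransGen (fun x y => j ∈ qOn x y) (.vert u) (.vert w)) :
    Reaches A u w := by
  generalize hy : Node.vert w = y at hxy
  induction hxy generalizing w with
  | refl => cases hy; exact .refl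
  | @tail b c hb hab ih =>
    subst hy
    have hadj := h.extAdj_of_mem hab
    cases b with
    | source =>
      have := h.rank_le hb
      simp [rank] at this
    | sink => exact hadj.elim
    | vert b => exact (ih rfl).tail hadj

/-- The chains consist of the vertices at which the index is the root of the treap. -/
theorem extract_chain (h : IsRouting A l f out order) {p : Fin l → Fin l} (hp : p.Injective)
    (i : Fin l) : (extract p f out order).chain i =
      order.filter fun v => IsRoot p (qAt (.vert v)) i := by
  have := chain_foldl hp f h.nodup_out order h.notMem_out_self h.pairwise_vert
    (represents_visit f h.nodup_out (represents_initState p) .source) i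
  rw [extract, List.foldl_cons, this, visit, distribute_chain]
  rfl

theorem extract_work_le (h : IsRouting A l f out order) {p : Fin l → Fin l} {t : ℕ}
    (ht : ∀ x, ∀ i ∈ qAt x, (ancs p (qAt x) i).card ≤ t) :
    (extract p f out order).work ≤
      (l + ((nodes order).map fun x => (out x).length).sum) * (3 * t + 2) := by
  have h1 := work_foldl_le f h.nodup_out (nodes order) (represents_initState p) (t := t)
    fun y => ⟨h.nodup_seqAt y, ht y⟩
  have h2 := initState_work_le (W := W) (p := p) (t := t) (by
    have := ht .source
    rwa [h.seqAt_source] at this)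
  refine h1.trans ?_
  rw [add_mul]
  refine Nat.add_le_add_right (h2.trans (Nat.mul_le_mul_left _ (by omega))) _

theorem sum_length_out_le (h : IsRouting A l f out order) :
    ((nodes order).map fun x => (out x).length).sum ≤ 2 * Fintype.card W + A.card := by
  have hcard : order.length = Fintype.card W := by
    rw [← List.toFinset_card_of_nodup h.isTopologicalOrder.1, ← Finset.card_univ]
    congr 1
    ext v
    simp [h.isTopologicalOrder.2.1 v]
  have h1 : (out .source).length ≤ Fintype.card W := by
    rw [← List.toFinset_card_of_nodup (h.nodup_out _), ← Finset.card_univ,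
      ← Finset.card_map (s := (Finset.univ : Finset W)) ⟨Node.vert, Node.vert_injective⟩]
    refine Finset.card_le_card fun y hy => ?_
    rw [List.mem_toFinset, h.mem_out] at hy
    cases y <;> simp_all [ExtAdj]
  have h2 : ∀ v, (out (.vert v)).length ≤ 1 + (A.filter fun e => e.1 = v).card := by
    intro v
    have : (out (.vert v)).toFinset ⊆
        insert .sink ((A.filter fun e => e.1 = v).image fun e => .vert e.2) := by
      intro y hy
      rw [List.mem_toFinset, h.mem_out] at hy
      cases y with
      | source => exact hy.elim
      | sink => simp
      | vert w =>
        simp only [Finset.mem_insert, Finset.mem_image, Finset.mem_filter]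
        exact Or.inr ⟨(v, w), ⟨hy, rfl⟩, rfl⟩
    rw [← List.toFinset_card_of_nodup (h.nodup_out _)]
    have h3 := (Finset.card_le_card this).trans (Finset.card_insert_le _ _)
    have h4 := Finset.card_image_le (s := A.filter fun e => e.1 = v) (f := fun e => Node.vert e.2)
    omega
  have h3 : (order.map fun v => (out (.vert v)).length).sum ≤ Fintype.card W + A.card := by
    rw [← List.sum_toFinset _ h.isTopologicalOrder.1]
    refine (Finset.sum_le_sum fun v _ => h2 v).trans ?_
    rw [Finset.sum_add_distrib]
    refine add_le_add ?_ ?_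
    · simp only [Finset.sum_const, smul_eq_mul, mul_one]
      exact Finset.card_le_univ _
    · refine (Finset.sum_le_sum_of_subset (Finset.subset_univ _)).trans ?_
      rw [← Finset.card_eq_sum_card_fiberwise (f := Prod.fst) (t := Finset.univ) (by simp)]
  rw [nodes, List.map_cons, List.sum_cons, List.map_map]
  change (out .source).length + (order.map fun v => (out (.vert v)).length).sum ≤ _
  omega

end IsRouting

end Routing

/-! ### Walks, and paths through given vertices. -/

section Walks

variable {V : Type u}

theorem HasWalk.trans {E : Finset (V × V)} {a b : ℕ} {u v w : V} (h : HasWalk E a u v)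
    (h' : HasWalk E b v w) : HasWalk E (a + b) u w := by
  induction a generalizing u with
  | zero => cases h; simpa using h'
  | succ a ih =>
    obtain ⟨x, hx, hxv⟩ := h
    rw [Nat.succ_add]
    exact ⟨x, hx, ih hxv⟩

theorem HasWalk.single {E : Finset (V × V)} {u v : V} (h : (u, v) ∈ E) : HasWalk E 1 u v :=
  ⟨v, h, rfl⟩

theorem HasWalk.mono {E F : Finset (V × V)} (hEF : E ⊆ F) {k : ℕ} {u v : V} (h : HasWalk E k u v) :
    HasWalk F k u v := by
  induction k generalizing u with
  | zero => exact h
  | succ k ih =>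
    obtain ⟨x, hx, hxv⟩ := h
    exact ⟨x, hEF hx, ih hxv⟩

theorem exists_hasWalk {E : Finset (V × V)} {u v : V} (h : Reaches E u v) :
    ∃ k, HasWalk E k u v := by
  induction h with
  | refl => exact ⟨0, rfl⟩
  | tail _ hab ih =>
    obtain ⟨k, hk⟩ := ih
    exact ⟨k + 1, hk.trans (.single hab)⟩

theorem HasWalk.exists_fun {E : Finset (V × V)} {k : ℕ} {u v : V} (h : HasWalk E k u v) :
    ∃ x : ℕ → V, x 0 = u ∧ x k = v ∧ ∀ i < k, (x i, x (i + 1)) ∈ E := by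
  induction k generalizing u with
  | zero => exact ⟨fun _ => u, rfl, h, by simp⟩
  | succ k ih =>
    obtain ⟨w, hw, hwv⟩ := h
    obtain ⟨x, h0, hk, hx⟩ := ih hwv
    refine ⟨fun i => if i = 0 then u else x (i - 1), by simp, by simp [hk], fun i hi => ?_⟩
    rcases i with _ | i
    · simpa [h0] using hw
    · simpa using hx i (by omega)

theorem hasWalk_of_fun {E : Finset (V × V)} {x : ℕ → V} {k : ℕ}
    (hx : ∀ i < k, (x i, x (i + 1)) ∈ E) {a d : ℕ} (h : a + d ≤ k) :
    HasWalk E d (x a) (x (a + d)) := by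
  induction d generalizing a with
  | zero => rfl
  | succ d ih =>
    refine ⟨x (a + 1), hx a (by omega), ?_⟩
    have := ih (a := a + 1) (by omega)
    rwa [show a + 1 + d = a + (d + 1) by omega] at this

/-- A sequence of vertices, each of which reaches the next one, is part of a path. -/
theorem exists_isChain {E : Finset (V × V)} (x : ℕ → V) (k : ℕ)
    (hx : ∀ i < k, Reaches E (x i) (x (i + 1))) :
    ∃ vs : List V, List.IsChain (fun a b => (a, b) ∈ E) vs ∧ vs.getLast? = some (x k) ∧
      ∀ i ≤ k, x i ∈ vs := by
  induction k with
  | zero =>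
    refine ⟨[x 0], by simp, by simp, fun i hi => ?_⟩
    rw [Nat.le_zero.1 hi]
    simp
  | succ k ih =>
    obtain ⟨vs, hvs, hlast, hmem⟩ := ih fun i hi => hx i (by omega)
    obtain ⟨S, rfl⟩ := List.getLast?_eq_some_iff.1 hlast
    obtain ⟨L, hL, hL'⟩ := List.exists_isChain_cons_of_relationReflTransGen (hx k (by omega))
    have hlast' : (S ++ [x k] ++ L).getLast? = some (x (k + 1)) := by
      rw [← hL', ← List.getLast?_eq_getLast_of_ne_nil, List.append_assoc, List.singleton_append,
        List.getLast?_append_of_ne_nil _ (by simp)]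
    refine ⟨S ++ [x k] ++ L, hvs.append_overlap hL (by simp), hlast', fun i hi => ?_⟩
    rcases Nat.lt_or_ge k i with h | h
    · have : i = k + 1 := by omega
      subst this
      exact List.mem_of_getLast? hlast'
    · exact List.mem_append_left _ (hmem i h)

end Walks

/-! ### Ordered pairs in duplicate-free lists. -/

section PairSublist

open scoped List

variable {V : Type u} [DecidableEq V]

theorem pair_sublist_iff {L : List V} (hL : L.Nodup) {u w : V} :
    [u, w] <+ L ↔ u ∈ L ∧ w ∈ L ∧ L.idxOf u < L.idxOf w := by
  induction L with
  | nil => simp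
  | cons a L ih =>
    rw [List.nodup_cons] at hL
    by_cases hau : a = u
    · subst hau
      rw [List.cons_sublist_cons, List.singleton_sublist]
      constructor
      · intro hw
        have : a ≠ w := by rintro rfl; exact hL.1 hw
        simp [hw, this]
      · rintro ⟨-, h1, h2⟩
        rcases List.mem_cons.1 h1 with rfl | h1
        · simp at h2
        · exact h1
    · rw [List.sublist_cons_iff]
      constructor
      · rintro (h | ⟨r, h, -⟩)
        · obtain ⟨h1, h2, h3⟩ := (ih hL.2).1 h
          have : a ≠ w := by rintro rfl; exact hL.1 h2
          simp [h1, h2, this, hau, h3]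
        · exact absurd (List.cons.inj h).1.symm hau
      · rintro ⟨h1, h2, h3⟩
        have haw : a ≠ w := by rintro rfl; simp at h3
        refine Or.inl ((ih hL.2).2 ⟨(List.mem_cons.1 h1).resolve_left (Ne.symm hau),
          (List.mem_cons.1 h2).resolve_left (Ne.symm haw), ?_⟩)
        simpa [List.idxOf_cons, hau, haw] using h3

theorem pair_sublist_filter_iff {L : List V} (hL : L.Nodup) {P : V → Prop} [DecidablePred P]
    {u w : V} : [u, w] <+ L.filter (fun v => P v) ↔
      (u ∈ L ∧ P u) ∧ (w ∈ L ∧ P w) ∧ L.idxOf u < L.idxOf w := by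
  constructor
  · intro h
    obtain ⟨h1, h2, h3⟩ := (pair_sublist_iff hL).1 (h.trans List.filter_sublist)
    have m1 := h.subset (List.mem_cons_self)
    have m2 := h.subset (show w ∈ [u, w] by simp)
    simp only [List.mem_filter, decide_eq_true_eq] at m1 m2
    exact ⟨m1, m2, h3⟩
  · rintro ⟨⟨h1, hu⟩, ⟨h2, hw⟩, h3⟩
    have := ((pair_sublist_iff hL).2 ⟨h1, h2, h3⟩).filter (fun v => decide (P v))
    simpa [List.filter_cons, hu, hw] using this

end PairSublist

/-! ### Optimality of the flow: an exchange argument bounds the uncovered vertices on a path. -/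

section MinCost

variable {W : Type u} [Fintype W] [DecidableEq W]

/-- The amount of flow that enters a vertex. -/
def throughput (F : Node W → Node W → ℕ) (v : W) : ℕ := ∑ x, F x (.vert v)

/-- A flow on the contracted network. -/
structure IsNodeFlow (A : Finset (W × W)) (l : ℕ) (F : Node W → Node W → ℕ) : Prop where
  support : ∀ x y, ¬ ExtAdj A x y → F x y = 0
  conservation : ∀ v, throughput F v = ∑ y, F (.vert v) y
  value : ∑ v, F .source (.vert v) = l

/-- The flow on the gadget network that uses the arcs of negative cost as much as possible. -/
def gadgetOf (F : Node W → Node W → ℕ) : GadgetFlow W where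
  fromSource v := F .source (.vert v)
  toSink v := F (.vert v) .sink
  unit v := min 1 (throughput F v)
  free v := throughput F v - min 1 (throughput F v)
  edge u v := F (.vert u) (.vert v)

theorem IsNodeFlow.isFlow {A : Finset (W × W)} {l : ℕ} {F : Node W → Node W → ℕ}
    (hF : IsNodeFlow A l F) : (gadgetOf F).IsFlow A l where
  capacity v := min_le_left _ _
  support u v huv := hF.support _ _ huv
  conservation_in v := by
    have h : throughput F v = F .source (.vert v) + ∑ u, F (.vert u) (.vert v) := by
      rw [throughput, Node.sum_univ, hF.support .sink _ (fun h => h), zero_add]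
    simp only [gadgetOf]
    omega
  conservation_out v := by
    have h : throughput F v = F (.vert v) .sink + ∑ u, F (.vert v) (.vert u) := by
      rw [hF.conservation, Node.sum_univ, hF.support (.vert v) .source (fun h => h), zero_add]
    simp only [gadgetOf]
    omega
  value := hF.value

/-- The arcs of cost -1 have capacity 1, so a flow gains at most 1 per vertex that it visits, and
`gadgetOf` gains exactly that. Minimum cost thus means the maximum number of visited vertices. -/
theorem card_throughput_le {A : Finset (W × W)} {l : ℕ} {f : GadgetFlow W} (hf : f.IsMinCost A l)
    {F : Node W → Node W → ℕ} (hF : IsNodeFlow A l F) :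
    (Finset.univ.filter fun v => throughput F v ≠ 0).card ≤
      (Finset.univ.filter fun v => throughput f.onEdge v ≠ 0).card := by
  have h1 := hf.2 _ hF.isFlow
  have e : ∀ g : GadgetFlow W, g.cost = -((∑ v, g.unit v : ℕ) : ℤ) := fun g => by
    simp [GadgetFlow.cost]
  rw [e, e, neg_le_neg_iff, Nat.cast_le] at h1
  have h2 : (Finset.univ.filter fun v => throughput F v ≠ 0).card ≤ ∑ v, (gadgetOf F).unit v := by
    rw [Finset.card_filter]
    refine Finset.sum_le_sum fun v _ => ?_
    simp only [gadgetOf]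
    split_ifs <;> omega
  have h3 : ∑ v, f.unit v ≤ (Finset.univ.filter fun v => throughput f.onEdge v ≠ 0).card := by
    rw [Finset.card_filter]
    refine Finset.sum_le_sum fun v _ => ?_
    have h4 := hf.1.capacity v
    have h5 := hf.1.conservation_in v
    have h6 : throughput f.onEdge v = f.fromSource v + ∑ u, f.edge u v := by
      rw [throughput, Node.sum_univ]
      simp only [GadgetFlow.onEdge, zero_add]
    split_ifs <;> omega
  exact h2.trans (h1.trans h3)

theorem sum_count_left {α β : Type*} [Fintype α] [DecidableEq α] [DecidableEq β]
    (Z : List (α × β)) (y : β) : ∑ x, Z.count (x, y) = (Z.map Prod.snd).count y := by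
  induction Z with
  | nil => simp
  | cons z Z ih =>
    obtain ⟨a, b⟩ := z
    simp only [List.count_cons, List.map_cons, Finset.sum_add_distrib, ih, beq_eq_decide,
      Prod.mk.injEq, Nat.add_left_cancel_iff]
    by_cases h : b = y <;> simp [h]

theorem sum_count_right {α β : Type*} [Fintype β] [DecidableEq α] [DecidableEq β]
    (Z : List (α × β)) (x : α) : ∑ y, Z.count (x, y) = (Z.map Prod.fst).count x := by
  induction Z with
  | nil => simp
  | cons z Z ih =>
    obtain ⟨a, b⟩ := z
    simp only [List.count_cons, List.map_cons, Finset.sum_add_distrib, ih, beq_eq_decide,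
      Prod.mk.injEq, Nat.add_left_cancel_iff]
    by_cases h : a = x <;> simp [h]

theorem rel_of_mem_zip {α : Type*} {R : α → α → Prop} {a : α} {L : List α}
    (h : List.IsChain R (a :: L)) {x y : α} (hxy : (x, y) ∈ (a :: L).zip L) : R x y := by
  induction L generalizing a with
  | nil => simp at hxy
  | cons b L ih =>
    rw [List.isChain_cons_cons] at h
    rw [List.zip_cons_cons, List.mem_cons] at hxy
    rcases hxy with hxy | hxy
    · cases hxy
      exact h.1
    · exact ih h.2 hxy

/-- The flow of value `1` along a path. -/
def pathFlow (vs : List W) (x y : Node W) : ℕ :=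
  ((Node.source :: (vs.map Node.vert ++ [.sink])).zip (vs.map Node.vert ++ [.sink])).count (x, y)

theorem sum_pathFlow_in (vs : List W) (v : W) : ∑ x, pathFlow vs x (.vert v) = vs.count v := by
  simp only [pathFlow]
  rw [sum_count_left, List.map_snd_zip (by simp), List.count_append,
    List.count_map_of_injective _ _ Node.vert_injective]
  simp

theorem sum_pathFlow_out (vs : List W) (x : Node W) :
    ∑ y, pathFlow vs x y = (Node.source :: vs.map Node.vert).count x := by
  simp only [pathFlow]
  rw [sum_count_right]
  congr 1
  rw [← List.cons_append]
  conv_lhs => rw [← List.append_nil (vs.map Node.vert ++ [Node.sink])]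
  rw [List.zip_append (by simp)]
  simp [List.map_fst_zip]

theorem extAdj_of_pathFlow {A : Finset (W × W)} {vs : List W} (hvs : vs ≠ [])
    (hc : List.IsChain (fun a b => (a, b) ∈ A) vs) {x y : Node W} (h : ¬ ExtAdj A x y) :
    pathFlow vs x y = 0 := by
  by_contra hne
  have hmem := List.count_pos_iff.1 (Nat.pos_of_ne_zero hne)
  refine h (rel_of_mem_zip ?_ hmem)
  rw [← List.cons_append, List.isChain_append]
  obtain ⟨a, vs, rfl⟩ := List.exists_cons_of_ne_nil hvs
  refine ⟨?_, by simp, ?_⟩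
  · rw [List.map_cons, List.isChain_cons_cons, ← List.map_cons, List.isChain_map]
    exact ⟨trivial, hc⟩
  · intro b hb c hc
    simp only [List.head?_cons, Option.mem_def, Option.some.injEq] at hc
    subst hc
    rw [Option.mem_def, List.map_cons, List.getLast?_cons_cons] at hb
    have := List.mem_of_getLast? hb
    rw [← List.map_cons, List.mem_map] at this
    obtain ⟨v, -, rfl⟩ := this
    trivial

namespace IsRouting

variable {A : Finset (W × W)} {l : ℕ} {f : GadgetFlow W} {out : Node W → List (Node W)}
  {order : List W}

local notation "qAt" => seqAt l f out order
local notation "qOn" => seqOn l f out order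

theorem sum_countP_in (h : IsRouting A l f out order) (P : Fin l → Bool) (v : W) :
    ∑ x, (qOn x (.vert v)).countP P = (qAt (.vert v)).countP P := by
  rw [h.seqAt_of_ne_source (by simp), List.countP_flatMap, ← List.sum_toFinset _ h.nodup_nodes]
  refine (Finset.sum_subset (Finset.subset_univ _) fun y _ hy => ?_).symm
  rw [List.mem_toFinset, h.mem_nodes, not_not] at hy
  subst hy
  have e : ¬ ExtAdj A .sink (.vert v) := fun h => h
  rw [h.seqOn_eq_nil e, List.countP_nil]

theorem sum_countP_out (h : IsRouting A l f out order) (P : Fin l → Bool) {x : Node W}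
    (hx : x ≠ .sink) : ∑ y, (qOn x y).countP P = (qAt x).countP P := by
  rw [← h.seqAt_eq_flatMap_out hx, List.countP_flatMap, ← List.sum_toFinset _ (h.nodup_out x)]
  refine (Finset.sum_subset (Finset.subset_univ _) fun y _ hy => ?_).symm
  rw [List.mem_toFinset, h.mem_out] at hy
  rw [h.seqOn_eq_nil hy, List.countP_nil]

theorem throughput_eq (h : IsRouting A l f out order) (v : W) :
    throughput f.onEdge v = (qAt (.vert v)).length := by
  rw [h.length_seqAt (by simp), throughput, h.conservation]

/-- Index `i` is deleted everywhere and its unit of flow is sent along `vs` instead, extended to the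
source and the sink. Counting the remaining indices preserves conservation, since a sequence is the
concatenation of its incoming blocks and also of its outgoing ones. An empty `vs` is excluded
because no arc joins source and sink. -/
theorem isNodeFlow_exchange (h : IsRouting A l f out order) (i : Fin l) {vs : List W}
    (hvs : vs ≠ []) (hc : List.IsChain (fun a b => (a, b) ∈ A) vs) :
    IsNodeFlow A l (fun x y => (qOn x y).countP (fun j => j ≠ i) + pathFlow vs x y) ∧
      ∀ v, throughput (fun x y => (qOn x y).countP (fun j => j ≠ i) + pathFlow vs x y) v =
        (qAt (.vert v)).countP (fun j => j ≠ i) + vs.count v := by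
  have ht : ∀ v, throughput (fun x y => (qOn x y).countP (fun j => j ≠ i) + pathFlow vs x y) v =
        (qAt (.vert v)).countP (fun j => j ≠ i) + vs.count v := by
    intro v
    rw [throughput, Finset.sum_add_distrib, h.sum_countP_in, sum_pathFlow_in]
  refine ⟨⟨?_, ?_, ?_⟩, ht⟩
  · intro x y hxy
    rw [h.seqOn_eq_nil hxy, extAdj_of_pathFlow hvs hc hxy, List.countP_nil]
  · intro v
    rw [ht, Finset.sum_add_distrib, h.sum_countP_out _ (by simp), sum_pathFlow_out,
      List.count_cons_of_ne (by simp), List.count_map_of_injective _ _ Node.vert_injective]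
  · have h1 : ∑ y, ((qOn .source y).countP (fun j => j ≠ i) + pathFlow vs .source y) = l := by
      rw [Finset.sum_add_distrib, h.sum_countP_out _ (by simp), sum_pathFlow_out, h.seqAt_source,
        List.count_cons_self, List.count_eq_zero_of_not_mem (by simp)]
      have h2 := List.length_eq_countP_add_countP (fun j => decide (j ≠ i)) (l := List.finRange l)
      have h3 : (List.finRange l).countP (fun j => !decide (j ≠ i)) = 1 := by
        have := List.count_eq_one_of_mem (List.nodup_finRange l) (List.mem_finRange i)
        rw [← this, List.count]
        congr 1
        ext j
        simp [beq_eq_decide]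
      rw [List.length_finRange] at h2
      have h4 : (List.finRange l).countP (fun a => decide (¬ (decide (a ≠ i)) = true)) = 1 := by
        rw [← h3]
        congr 1
        ext j
        simp
      omega
    rw [Node.sum_univ] at h1
    have e1 : ¬ ExtAdj A .source .source := fun h => h
    have e2 : ¬ ExtAdj A .source .sink := fun h => h
    rw [h.seqOn_eq_nil e1, h.seqOn_eq_nil e2, extAdj_of_pathFlow hvs hc e1,
      extAdj_of_pathFlow hvs hc e2] at h1
    simpa using h1

/-- Few vertices on a path of the graph carry no flow. -/
theorem card_uncovered_mul_le (h : IsRouting A l f out order) (hf : f.IsMinCost A l) {vs : List W}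
    (hc : List.IsChain (fun a b => (a, b) ∈ A) vs) :
    (vs.toFinset.filter fun v => qAt (.vert v) = []).card * l ≤ Fintype.card W := by
  rcases Nat.eq_zero_or_pos l with hl | hl
  · simp [hl]
  by_cases hvs : vs = []
  · simp [hvs]
  -- The vertices that `i` alone covers, which is what is lost by giving up `i`. These sets are
  -- disjoint, so averaging finds an `i` with a small one.
  set K : Fin l → Finset W := fun i => Finset.univ.filter fun v => qAt (.vert v) = [i]
  have hK : ∑ i, (K i).card ≤ Fintype.card W := by
    rw [← Finset.card_biUnion]
    · exact Finset.card_le_univ _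
    · intro i _ j _ hij
      rw [Function.onFun, Finset.disjoint_left]
      intro v hi hj
      simp only [K, Finset.mem_filter] at hi hj
      rw [hi.2] at hj
      exact hij (List.cons.inj hj.2).1
  obtain ⟨i, hi⟩ : ∃ i, l * (K i).card ≤ Fintype.card W := by
    by_contra hcon
    push Not at hcon
    have : Nonempty (Fin l) := ⟨⟨0, hl⟩⟩
    have h1 := Finset.sum_lt_sum_of_nonempty (Finset.univ_nonempty (α := Fin l)) fun i _ => hcon i
    rw [← Finset.mul_sum] at h1
    simp only [Finset.sum_const, Finset.card_univ, Fintype.card_fin, smul_eq_mul] at h1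
    exact absurd (Nat.mul_le_mul_left l hK) (not_le.2 h1)
  obtain ⟨hF, ht⟩ := h.isNodeFlow_exchange i hvs hc
  have hcard := card_throughput_le hf hF
  simp only [ht, h.throughput_eq] at hcard
  set U := vs.toFinset.filter fun v => qAt (.vert v) = []
  set Cov := Finset.univ.filter fun v => (qAt (.vert v)).length ≠ 0
  -- The exchange loses at most `K i` and gains the uncovered vertices `U` of the path, so
  -- optimality forces `U.card ≤ (K i).card`.
  have hsub : (Cov \ K i) ∪ U ⊆
      Finset.univ.filter fun v => (qAt (.vert v)).countP (fun j => j ≠ i) + vs.count v ≠ 0 := by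
    intro v hv
    simp only [Cov, K, U, Finset.mem_union, Finset.mem_sdiff, Finset.mem_filter, Finset.mem_univ,
      true_and, List.mem_toFinset] at hv ⊢
    rcases hv with ⟨h1, h2⟩ | ⟨h1, -⟩
    · intro h0
      have h3 : (qAt (.vert v)).countP (fun j => j ≠ i) = 0 := by omega
      rw [List.countP_eq_zero] at h3
      have h4 : ∀ j ∈ qAt (.vert v), j = i := by simpa using h3
      have h5 := List.eq_replicate_of_mem h4
      have h6 := h.nodup_seqAt (.vert v)
      rw [h5, List.nodup_replicate] at h6
      have h7 : (qAt (.vert v)).length = 1 := by omega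
      rw [h7] at h5
      exact h2 h5
    · have := List.count_pos_iff.2 h1
      omega
  have hdisj : Disjoint (Cov \ K i) U := by
    rw [Finset.disjoint_left]
    intro v h1 h2
    simp only [Cov, K, U, Finset.mem_sdiff, Finset.mem_filter, Finset.mem_univ,
      true_and] at h1 h2
    exact h1.1 (by rw [h2.2]; rfl)
  have h1 := (Finset.card_le_card hsub).trans hcard
  rw [Finset.card_union_of_disjoint hdisj] at h1
  have h2 := Finset.le_card_sdiff (K i) Cov
  have h3 : U.card ≤ (K i).card := by
    omega
  calc U.card * l ≤ (K i).card * l := Nat.mul_le_mul_right _ h3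
    _ = l * (K i).card := mul_comm _ _
    _ ≤ _ := hi

end IsRouting

end MinCost

/-! ### Short walks and the size of the chain shortcuts in the DAG. -/

section Diameter

open scoped List

variable {W : Type u} [Fintype W] [DecidableEq W]

namespace IsRouting

variable {A : Finset (W × W)} {l : ℕ} {f : GadgetFlow W} {out : Node W → List (Node W)}
  {order : List W}

local notation "qAt" => seqAt l f out order
local notation "qOn" => seqOn l f out order

theorem pair_sublist_chain_iff (h : IsRouting A l f out order) {p : Fin l → Fin l}
    (hp : p.Injective) {i : Fin l} {u w : W} : [u, w] <+ (extract p f out order).chain i ↔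
      IsRoot p (qAt (.vert u)) i ∧ IsRoot p (qAt (.vert w)) i ∧ order.idxOf u < order.idxOf w := by
  have hmem := h.isTopologicalOrder.2.1
  rw [h.extract_chain hp, pair_sublist_filter_iff h.isTopologicalOrder.1]
  simp [hmem]

theorem exists_of_mem_coverShortcut (h : IsRouting A l f out order) {p : Fin l → Fin l}
    (hp : p.Injective) {u w : W} (huw : (u, w) ∈ coverShortcut p f out order) :
    ∃ i, IsRoot p (qAt (.vert u)) i ∧ IsRoot p (qAt (.vert w)) i ∧
      order.idxOf u < order.idxOf w := by
  rw [coverShortcut, Finset.mem_biUnion] at huw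
  obtain ⟨i, -, hi⟩ := huw
  exact ⟨i, (h.pair_sublist_chain_iff hp).1 (pair_sublist_of_mem_chainShortcut _ hi)⟩

theorem reaches_of_idxOf_lt (h : IsRouting A l f out order) {j : Fin l} {u w : W}
    (hu : j ∈ qAt (.vert u)) (hw : j ∈ qAt (.vert w)) (huw : order.idxOf u < order.idxOf w) :
    Reaches A u w :=
  h.reaches_of_reflTransGen (h.reflTransGen_of_rank_lt hu hw (by simp only [rank]; omega))

theorem reaches_of_mem_coverShortcut (h : IsRouting A l f out order) {p : Fin l → Fin l}
    (hp : p.Injective) {u w : W} (huw : (u, w) ∈ coverShortcut p f out order) :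
    Reaches A u w ∧ order.idxOf u < order.idxOf w := by
  obtain ⟨i, hu, hw, hlt⟩ := h.exists_of_mem_coverShortcut hp huw
  exact ⟨h.reaches_of_idxOf_lt hu.1 hw.1 hlt, hlt⟩

theorem exists_isRoot {p : Fin l → Fin l} {q : List (Fin l)} (hq : q ≠ []) :
    ∃ i, IsRoot p q i := by
  obtain ⟨i, hi, hmin⟩ := q.toFinset.exists_min_image p (by
    obtain ⟨a, ha⟩ := List.exists_mem_of_ne_nil q hq
    exact ⟨a, by simpa using ha⟩)
  exact ⟨i, by simpa using hi, by simpa using hmin⟩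

/-- Two vertices of the same chain are joined by a short walk. -/
theorem hasWalk_of_isRoot (h : IsRouting A l f out order) {p : Fin l → Fin l} (hp : p.Injective)
    {i : Fin l} {u w : W} (hu : IsRoot p (qAt (.vert u)) i) (hw : IsRoot p (qAt (.vert w)) i)
    (huw : order.idxOf u < order.idxOf w) :
    ∃ d ≤ 2, HasWalk (A ∪ coverShortcut p f out order) d u w := by
  have hmem : ∀ {e}, e ∈ chainShortcut ((extract p f out order).chain i) →
      e ∈ A ∪ coverShortcut p f out order := fun he =>
    Finset.mem_union_right _ (Finset.mem_biUnion.2 ⟨i, Finset.mem_univ _, he⟩)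
  rcases chainShortcut_two_hop _ ((h.pair_sublist_chain_iff hp).2 ⟨hu, hw, huw⟩) with
    h1 | ⟨x, h1, h2⟩
  · exact ⟨1, by omega, .single (hmem h1)⟩
  · exact ⟨2, le_rfl, x, hmem h1, w, hmem h2, rfl⟩

/-- The vertices of a shortest walk are counted: few are uncovered, and each covered one lies on one
of the `l` chains, which contribute at most three each. -/
theorem exists_short_walk (h : IsRouting A l f out order) (hf : f.IsMinCost A l) (hl : 0 < l)
    {p : Fin l → Fin l} (hp : p.Injective) {u v : W} (huv : Reaches A u v) :
    ∃ k ≤ 3 * l + Fintype.card W / l, HasWalk (A ∪ coverShortcut p f out order) k u v := by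
  classical
  set B := A ∪ coverShortcut p f out order with hB
  have hex : ∃ k, HasWalk B k u v := by
    obtain ⟨k, hk⟩ := exists_hasWalk huv
    exact ⟨k, hk.mono Finset.subset_union_left⟩
  set k := Nat.find hex with hk
  have hwalk := Nat.find_spec hex
  rw [← hk] at hwalk
  refine ⟨k, ?_, hwalk⟩
  obtain ⟨x, hx0, hxk, hx⟩ := hwalk.exists_fun
  have hstep : ∀ i < k, Reaches A (x i) (x (i + 1)) ∧ order.idxOf (x i) < order.idxOf (x (i + 1)) := by
    intro i hi
    rcases Finset.mem_union.1 (hx i hi) with h1 | h1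
    · exact ⟨.single h1, h.idxOf_lt h1⟩
    · exact h.reaches_of_mem_coverShortcut hp h1
  have hmono : ∀ a b, a < b → b ≤ k → order.idxOf (x a) < order.idxOf (x b) := by
    intro a b hab hbk
    induction b with
    | zero => omega
    | succ b ih =>
      have h1 := (hstep b (by omega)).2
      rcases Nat.lt_or_ge a b with h2 | h2
      · exact (ih h2 (by omega)).trans h1
      · have : a = b := by omega
        subst this
        exact h1
  have hinj : ∀ a ≤ k, ∀ b ≤ k, x a = x b → a = b := by
    intro a ha b hb hab
    rcases lt_trichotomy a b with h1 | h1 | h1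
    · have := hmono a b h1 hb
      rw [hab] at this
      omega
    · exact h1
    · have := hmono b a h1 ha
      rw [hab] at this
      omega
  -- Expanding the shortcut edges turns the walk into a path of the DAG through the same vertices,
  -- to which the exchange bound applies.
  obtain ⟨vs, hvs, -, hmem⟩ := exists_isChain x k fun i hi => (hstep i hi).1
  set P := Finset.range (k + 1) with hP
  set U := P.filter fun a => qAt (.vert (x a)) = [] with hU
  have hUcard : U.card ≤ Fintype.card W / l := by
    rw [Nat.le_div_iff_mul_le hl]
    refine le_trans (Nat.mul_le_mul_right _ ?_) (h.card_uncovered_mul_le hf hvs)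
    refine Finset.card_le_card_of_injOn x ?_ ?_
    · intro a ha
      simp only [hU, hP, Finset.coe_filter, Finset.mem_range, Set.mem_ofPred_eq] at ha
      simp only [Finset.coe_filter, List.mem_toFinset, Set.mem_ofPred_eq]
      exact ⟨hmem a (by omega), ha.2⟩
    · intro a ha b hb hab
      simp only [hU, hP, Finset.coe_filter, Finset.mem_range, Set.mem_ofPred_eq] at ha hb
      exact hinj a (by omega) b (by omega) hab
  set Cv := P.filter fun a => ¬ qAt (.vert (x a)) = [] with hC
  have hroot : ∀ a : ℕ, ∃ i : Fin l, qAt (.vert (x a)) ≠ [] → IsRoot p (qAt (.vert (x a))) i := by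
    intro a
    by_cases ha : qAt (.vert (x a)) = []
    · exact ⟨⟨0, hl⟩, fun h => absurd ha h⟩
    · obtain ⟨i, hi⟩ := exists_isRoot (p := p) ha
      exact ⟨i, fun _ => hi⟩
  choose r hr using hroot
  have hCcard : Cv.card ≤ 3 * l := by
    have := Finset.card_le_mul_card_image_of_maps_to (f := r) (s := Cv) (t := Finset.univ)
      (fun _ _ => Finset.mem_univ _) 3 ?_
    · simpa using this
    intro i _
    set F := Cv.filter fun a => r a = i with hF
    rcases F.eq_empty_or_nonempty with h0 | h0
    · simp [h0]
    have hmF : ∀ a ∈ F, a ≤ k ∧ IsRoot p (qAt (.vert (x a))) i := by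
      intro a ha
      simp only [hF, hC, hP, Finset.mem_filter, Finset.mem_range] at ha
      refine ⟨by omega, ?_⟩
      rw [← ha.2]
      exact hr a ha.1.2
    -- From the first vertex of the chain on the walk, any later one is at most two edges away. A
    -- gap larger than two would contradict minimality.
    have hsub : F ⊆ Finset.Icc (F.min' h0) (F.min' h0 + 2) := by
      intro b hb
      have hab := F.min'_le b hb
      rw [Finset.mem_Icc]
      refine ⟨hab, ?_⟩
      by_contra hlt
      obtain ⟨ha, ha'⟩ := hmF _ (F.min'_mem h0)
      obtain ⟨hbk, hb'⟩ := hmF b hb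
      generalize F.min' h0 = a at *
      obtain ⟨d, hd, hw⟩ := h.hasWalk_of_isRoot hp ha' hb' (hmono a b (by omega) hbk)
      have w1 := hasWalk_of_fun hx (a := 0) (d := a) (by omega)
      have w2 := hasWalk_of_fun hx (a := b) (d := k - b) (by omega)
      rw [zero_add, hx0] at w1
      rw [show b + (k - b) = k by omega, hxk] at w2
      exact Nat.find_min hex (show a + d + (k - b) < Nat.find hex by rw [← hk]; omega)
        ((w1.trans hw).trans w2)
    refine (Finset.card_le_card hsub).trans ?_
    rw [Nat.card_Icc]
    omega
  have htot := Finset.card_filter_add_card_filter_not (s := P) fun a => qAt (.vert (x a)) = []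
  rw [← hU, ← hC, hP, Finset.card_range] at htot
  omega

/-- The chains are disjoint, as a vertex joins only the chain of its root. -/
theorem sum_length_chain_le (h : IsRouting A l f out order) {p : Fin l → Fin l}
    (hp : p.Injective) :
    ∑ i, ((extract p f out order).chain i).length ≤ Fintype.card W := by
  have e : ∀ i, ((extract p f out order).chain i).length =
      (Finset.univ.filter fun v => IsRoot p (qAt (.vert v)) i).card := by
    intro i
    rw [h.extract_chain hp, ← List.toFinset_card_of_nodup (h.isTopologicalOrder.1.filter _)]
    congr 1
    ext v
    simp [h.isTopologicalOrder.2.1 v]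
  rw [Finset.sum_congr rfl fun i _ => e i, ← Finset.card_biUnion]
  · exact Finset.card_le_univ _
  · intro i _ j _ hij
    rw [Function.onFun, Finset.disjoint_left]
    intro v hi hj
    simp only [Finset.mem_filter] at hi hj
    exact hij (hp (le_antisymm (hi.2.2 j hj.2.1) (hj.2.2 i hi.2.1)))

theorem card_coverShortcut_le (h : IsRouting A l f out order) {p : Fin l → Fin l}
    (hp : p.Injective) :
    (coverShortcut p f out order).card ≤ Fintype.card W * Nat.log 2 (Fintype.card W) := by
  refine Finset.card_biUnion_le.trans ?_
  have hs := h.sum_length_chain_le hp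
  refine (Finset.sum_le_sum fun i hi => ?_).trans
    ((Finset.sum_mul _ _ _).symm.le.trans (Nat.mul_le_mul_right _ hs))
  refine (card_chainShortcut_le _).trans (Nat.mul_le_mul_left _ (Nat.log_mono_right ?_))
  exact (Finset.single_le_sum (f := fun i => ((extract p f out order).chain i).length)
    (fun _ _ => Nat.zero_le _) hi).trans hs

end IsRouting

end Diameter

/-! ### The nearest element of smaller priority to the left. -/

section SmallerLeft

variable {ι : Type*} [DecidableEq ι] {α : Type*} [LinearOrder α]

/-- `c` is the nearest element to the left of `j` in `q` that has a smaller priority than `j`. -/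
def IsSmallerLeft (p : ι → α) (q : List ι) (j c : ι) : Prop :=
  j ∈ q ∧ c ∈ q ∧ q.idxOf c < q.idxOf j ∧ p c < p j ∧
    ∀ k ∈ q, q.idxOf c < q.idxOf k → q.idxOf k < q.idxOf j → p j ≤ p k

/-- If `j` is not an ancestor of the first element, something before `j` has smaller priority; the
last such element is `c`. -/
theorem exists_isSmallerLeft {p : ι → α} {q : List ι} {i j : ι} (hi : q.head? = some i)
    (hj : j ∈ q) (h : ¬ Anc p q i j) : ∃ c, IsSmallerLeft p q j c := by
  have hiq : i ∈ q := List.mem_of_head? hi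
  have hi0 : q.idxOf i = 0 := by
    cases q with
    | nil => simp at hi
    | cons a q => simp at hi; simp [hi]
  simp only [Anc, hiq, hj, true_and, hi0] at h
  push Not at h
  obtain ⟨k, hk, -, h2, h3⟩ := h
  have hkj : q.idxOf k < q.idxOf j := by
    rcases Nat.lt_or_ge (q.idxOf k) (q.idxOf j) with h4 | h4
    · exact h4
    · have : q.idxOf k = q.idxOf j := by omega
      rw [List.idxOf_inj hk] at this
      subst this
      exact absurd h3 (lt_irrefl _)
  obtain ⟨c, hc, hmax⟩ := (q.toFinset.filter fun c => q.idxOf c < q.idxOf j ∧ p c < p j)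
    |>.exists_max_image (fun c => q.idxOf c) ⟨k, by simp [hk, hkj, h3]⟩
  simp only [Finset.mem_filter, List.mem_toFinset] at hc hmax
  refine ⟨c, hj, hc.1, hc.2.1, hc.2.2, fun x hx h4 h5 => ?_⟩
  by_contra h6
  have := hmax x ⟨hx, h5, not_le.1 h6⟩
  omega

theorem IsSmallerLeft.unique {p : ι → α} {q : List ι} {j c c' : ι} (h : IsSmallerLeft p q j c)
    (h' : IsSmallerLeft p q j c') : c = c' := by
  obtain ⟨-, hc, h1, h2, h3⟩ := h
  obtain ⟨-, hc', h1', h2', h3'⟩ := h'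
  rw [← List.idxOf_inj hc]
  rcases lt_trichotomy (q.idxOf c) (q.idxOf c') with h4 | h4 | h4
  · exact absurd (h3 c' hc' h4 h1') (not_le.2 h2')
  · exact h4
  · exact absurd (h3' c hc h4 h1) (not_le.2 h2)

/-- Only the stretch from `c` to `j` matters, and it lies inside the block. -/
theorem IsSmallerLeft.of_infix {p : ι → α} {I q : List ι} (hI : I <:+: q) (hq : q.Nodup) {j c : ι}
    (h : IsSmallerLeft p I j c) : IsSmallerLeft p q j c := by
  obtain ⟨S, T, rfl⟩ := hI
  obtain ⟨hj, hc, h1, h2, h3⟩ := h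
  have hj' := List.idxOf_lt_length_of_mem hj
  refine ⟨by simp [hj], by simp [hc], ?_, h2, fun k hk h4 h5 => ?_⟩
  · rw [idxOf_infix hq hj, idxOf_infix hq hc]
    omega
  · rw [idxOf_infix hq hc] at h4
    rw [idxOf_infix hq hj] at h5
    have hkI : k ∈ I := mem_infix_of_idxOf (A := S) (B := T) (by omega) (by omega)
    rw [idxOf_infix hq hkI] at h4 h5
    exact h3 k hkI (by omega) (by omega)

theorem IsSmallerLeft.anc {p : ι → α} {q : List ι} {j c : ι} (h : IsSmallerLeft p q j c) :
    Anc p q j c := by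
  obtain ⟨hj, hc, h1, h2, h3⟩ := h
  refine ⟨hj, hc, fun k hk h4 h5 => ?_⟩
  rcases Nat.lt_or_ge (q.idxOf c) (q.idxOf k) with h6 | h6
  · rcases Nat.lt_or_ge (q.idxOf k) (q.idxOf j) with h7 | h7
    · exact h2.le.trans (h3 k hk h6 h7)
    · have : q.idxOf k = q.idxOf j := by omega
      rw [List.idxOf_inj hk] at this
      rw [this]
      exact h2.le
  · have : q.idxOf k = q.idxOf c := by omega
    rw [List.idxOf_inj hk] at this
    rw [this]

end SmallerLeft

/-! ### Marked vertices and the certification of the chain shortcuts in the DAG. -/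

section Certification

open scoped List

variable {W : Type u} [Fintype W] [DecidableEq W]

/-- The first elements of the sequences on the edges at a node. -/
def heads (l : ℕ) (f : GadgetFlow W) (out : Node W → List (Node W)) (order : List W)
    (x : Node W) : Finset (Fin l) :=
  Finset.univ.biUnion fun z =>
    (seqOn l f out order z x).head?.toFinset ∪ (seqOn l f out order x z).head?.toFinset

/-- In the treap at `x`, the index `j` is an ancestor of the first element of an edge. -/
def Marked {l : ℕ} (p : Fin l → Fin l) (f : GadgetFlow W) (out : Node W → List (Node W))
    (order : List W) (j : Fin l) (x : Node W) : Prop :=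
  ∃ i ∈ heads l f out order x, Anc p (seqAt l f out order x) i j

instance {l : ℕ} (p : Fin l → Fin l) (f : GadgetFlow W) (out : Node W → List (Node W))
    (order : List W) (j : Fin l) (x : Node W) : Decidable (Marked p f out order j x) := by
  unfold Marked; infer_instance

/-- `v` is incident to an edge. -/
def HasEdge (A : Finset (W × W)) (v : W) : Prop := ∃ w, (v, w) ∈ A ∨ (w, v) ∈ A

instance (A : Finset (W × W)) (v : W) : Decidable (HasEdge A v) := by
  unfold HasEdge; infer_instance

/-- The vertices at which the index `j` is marked. -/
def markedChain {l : ℕ} (A : Finset (W × W)) (p : Fin l → Fin l) (f : GadgetFlow W)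
    (out : Node W → List (Node W)) (order : List W) (j : Fin l) : List W :=
  order.filter fun v => HasEdge A v ∧ Marked p f out order j (.vert v)

/-- The shortcuts of the chains of marked vertices. -/
def markedShortcut {l : ℕ} (A : Finset (W × W)) (p : Fin l → Fin l) (f : GadgetFlow W)
    (out : Node W → List (Node W)) (order : List W) : Finset (W × W) :=
  Finset.univ.biUnion fun j => chainShortcut (markedChain A p f out order j)

namespace IsRouting

variable {A : Finset (W × W)} {l : ℕ} {f : GadgetFlow W} {out : Node W → List (Node W)}
  {order : List W}

local notation "qAt" => seqAt l f out order
local notation "qOn" => seqOn l f out order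

theorem pair_sublist_markedChain_iff (h : IsRouting A l f out order) {p : Fin l → Fin l}
    {j : Fin l} {u w : W} : [u, w] <+ markedChain A p f out order j ↔
      (HasEdge A u ∧ Marked p f out order j (.vert u)) ∧
        (HasEdge A w ∧ Marked p f out order j (.vert w)) ∧ order.idxOf u < order.idxOf w := by
  have hmem := h.isTopologicalOrder.2.1
  rw [markedChain, pair_sublist_filter_iff h.isTopologicalOrder.1]
  simp [hmem]

theorem mem_of_marked {p : Fin l → Fin l} {j : Fin l} {x : Node W}
    (h : Marked p f out order j x) : j ∈ qAt x := by
  obtain ⟨i, -, hi⟩ := h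
  exact hi.2.1

/-- An unmarked `j` is an ancestor of neither block's first element, so each block contains a
nearest smaller element to the left of `j`. Both blocks lie in the sequence at `x`, where that
element is unique. -/
theorem exists_isSmallerLeft_of_not_marked (h : IsRouting A l f out order) {p : Fin l → Fin l}
    {j : Fin l} {x y z : Node W} (hzx : j ∈ qOn z x) (hxy : j ∈ qOn x y)
    (hm : ¬ Marked p f out order j x) :
    ∃ c, IsSmallerLeft p (qOn z x) j c ∧ IsSmallerLeft p (qOn x y) j c := by
  have key : ∀ I : List (Fin l), I <:+: qAt x → (∀ i, I.head? = some i → i ∈ heads l f out order x) →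
      j ∈ I → ∃ c, IsSmallerLeft p I j c := by
    intro I hI hh hj
    obtain ⟨i, hi⟩ : ∃ i, I.head? = some i := by
      cases I with
      | nil => simp at hj
      | cons a I => exact ⟨a, rfl⟩
    refine exists_isSmallerLeft hi hj fun hanc => hm ⟨i, hh i hi, ?_⟩
    obtain ⟨S, T, e⟩ := hI
    have hn := h.nodup_seqAt x
    rw [← e] at hn ⊢
    exact (anc_infix hn hanc.1 hj).2 hanc
  obtain ⟨c, hc⟩ := key _ (h.seqOn_infix_right z x) (fun i hi => by
    simp only [heads, Finset.mem_biUnion, Finset.mem_univ, true_and, Finset.mem_union,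
      Option.mem_toFinset, Option.mem_def]
    exact ⟨z, Or.inl hi⟩) hzx
  obtain ⟨c', hc'⟩ := key _ (seqOn_infix_left x y) (fun i hi => by
    simp only [heads, Finset.mem_biUnion, Finset.mem_univ, true_and, Finset.mem_union,
      Option.mem_toFinset, Option.mem_def]
    exact ⟨y, Or.inr hi⟩) hxy
  have e := (hc.of_infix (h.seqOn_infix_right z x) (h.nodup_seqAt x)).unique
    (hc'.of_infix (seqOn_infix_left x y) (h.nodup_seqAt x))
  subst e
  exact ⟨c, hc, hc'⟩

/-- Between two consecutive marked vertices, a path is an edge or accompanies another path. -/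
theorem exists_companion (h : IsRouting A l f out order) {p : Fin l → Fin l} {j : Fin l} {u : W}
    {b : ℕ} {z : Node W}
    (hb : ∀ v, order.idxOf u < order.idxOf v → order.idxOf v + 1 < b → HasEdge A v →
      ¬ Marked p f out order j (.vert v))
    (hz : Relation.TransGen (fun x y => j ∈ qOn x y) (.vert u) z) (hzb : rank order z ≤ b) :
    ∃ z', z' ≠ .source ∧ j ∈ qOn z' z ∧ (z' = .vert u ∨ ∃ c, IsSmallerLeft p (qOn z' z) j c ∧
      ∃ y, IsSmallerLeft p (qOn (.vert u) y) j c) := by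
  induction hz with
  | single huz => exact ⟨.vert u, by simp, huz, Or.inl rfl⟩
  | @tail z z₂ huz hzz ih =>
    have hlt := h.rank_lt (h.extAdj_of_mem hzz)
    obtain ⟨z', hz's, hz', hor⟩ := ih (by omega)
    have hadj := h.extAdj_of_mem hz'
    have hadj2 := h.extAdj_of_mem hzz
    have hult : rank order (.vert u) < rank order z := by
      obtain ⟨y, hy, hyz⟩ := Relation.TransGen.head'_iff.1 huz
      exact (h.rank_lt (h.extAdj_of_mem hy)).trans_le (h.rank_le hyz)
    cases z with
    | source => simp [rank] at hult
    | sink => exact hadj2.elim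
    | vert v =>
      -- The condition `z' ≠ .source` is carried along for this purpose: the edge into `v` comes
      -- from a vertex and hence belongs to `A`.
      have hedge : HasEdge A v := by
        cases z' with
        | source => exact absurd rfl hz's
        | sink => exact hadj.elim
        | vert v' => exact ⟨v', Or.inr hadj⟩
      have eu : rank order (.vert u) = order.idxOf u + 1 := rfl
      have ev : rank order (.vert v) = order.idxOf v + 1 := rfl
      have hnm := hb v (by omega) (by omega) hedge
      obtain ⟨c, hc, hc'⟩ := h.exists_isSmallerLeft_of_not_marked hz' hzz hnm
      refine ⟨.vert v, by simp, hzz, Or.inr ⟨c, hc', ?_⟩⟩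
      -- The companion is picked up at the first inner vertex; from then on uniqueness keeps it the
      -- same.
      rcases hor with rfl | ⟨c₀, hc₀, y, hy⟩
      · exact ⟨_, hc⟩
      · have e := hc.unique hc₀
        subst e
        exact ⟨y, hy⟩

/-- Pairs in a chain of marked vertices are certified. -/
theorem certified_of_marked (h : IsRouting A l f out order) {p : Fin l → Fin l} {j : Fin l}
    {u w : W} (huw : [u, w] <+ markedChain A p f out order j) :
    (u, w) ∈ A ∨ ∃ x, (u, x) ∈ markedShortcut A p f out order ∧
      (x, w) ∈ markedShortcut A p f out order := by
  -- A companion has smaller priority than the path it accompanies, so passing to companions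
  -- terminates.
  induction hr : (p j).val using Nat.strong_induction_on generalizing j with
  | _ r ih =>
    subst hr
    have hmem : ∀ {e}, e ∈ chainShortcut (markedChain A p f out order j) →
        e ∈ markedShortcut A p f out order := fun he =>
      Finset.mem_biUnion.2 ⟨j, Finset.mem_univ _, he⟩
    rcases chainShortcut_between _ huw with hinf | ⟨x, h1, h2⟩
    swap
    · exact Or.inr ⟨x, hmem h1, hmem h2⟩
    obtain ⟨⟨hue, hum⟩, ⟨hwe, hwm⟩, hlt⟩ := h.pair_sublist_markedChain_iff.1 huw
    have hpath := h.reflTransGen_of_rank_lt (mem_of_marked hum) (mem_of_marked hwm)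
      (x := .vert u) (y := .vert w) (by simp only [rank]; omega)
    have hpath' : Relation.TransGen (fun x y => j ∈ qOn x y) (.vert u) (.vert w) := by
      rcases Relation.reflTransGen_iff_eq_or_transGen.1 hpath with e | e
      · cases e
        omega
      · exact e
    -- Since `u` and `w` are neighbours in the marked chain, no vertex incident to an edge and
    -- strictly between them is marked. The bound `order.idxOf w + 1` is the rank of `w`.
    obtain ⟨z', -, hz', hor⟩ := h.exists_companion (p := p) (b := order.idxOf w + 1) (fun v h1 h2 h3 h4 => by
      have s1 := h.pair_sublist_markedChain_iff.2 ⟨⟨hue, hum⟩, ⟨h3, h4⟩, h1⟩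
      have s2 := h.pair_sublist_markedChain_iff.2 ⟨⟨h3, h4⟩, ⟨hwe, hwm⟩, by omega⟩
      have hn : (markedChain A p f out order j).Nodup := h.isTopologicalOrder.1.filter _
      obtain ⟨S, T, e⟩ := hinf
      rw [pair_sublist_iff hn] at s1 s2
      rw [← e] at hn s1 s2
      have hi1 : (S ++ [u, w] ++ T).idxOf u = S.length := by
        rw [idxOf_infix hn (by simp)]; simp
      have huw' : u ≠ w := by rintro rfl; omega
      have hi2 : (S ++ [u, w] ++ T).idxOf w = S.length + 1 := by
        rw [idxOf_infix hn (by simp)]; simp [huw']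
      omega) hpath' (by simp [rank])
    rcases hor with rfl | ⟨c, hc, y, hy⟩
    · exact Or.inl (h.extAdj_of_mem hz')
    -- The companion is an ancestor of `j` at both ends, and ancestors of marked indices are marked.
    · have a1 := (hy.of_infix (seqOn_infix_left _ _) (h.nodup_seqAt _)).anc
      have a2 := (hc.of_infix (h.seqOn_infix_right _ _) (h.nodup_seqAt _)).anc
      have m1 : Marked p f out order c (.vert u) := by
        obtain ⟨i, hi, hij⟩ := hum
        exact ⟨i, hi, hij.trans a1⟩
      have m2 : Marked p f out order c (.vert w) := by
        obtain ⟨i, hi, hij⟩ := hwm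
        exact ⟨i, hi, hij.trans a2⟩
      exact ih _ hc.2.2.2.1 (h.pair_sublist_markedChain_iff.2 ⟨⟨hue, m1⟩, ⟨hwe, m2⟩, hlt⟩) rfl

/-- The root is an ancestor of everything, in particular of the head of an outgoing block. Hence
pairs of an output chain are also pairs of a marked chain. -/
theorem marked_of_isRoot (h : IsRouting A l f out order) {p : Fin l → Fin l} {i : Fin l} {v : W}
    (hv : IsRoot p (qAt (.vert v)) i) : Marked p f out order i (.vert v) := by
  obtain ⟨y, hy⟩ := h.exists_out (by simp) hv.1
  obtain ⟨k, hk⟩ : ∃ k, (qOn (.vert v) y).head? = some k := by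
    cases hq : qOn (.vert v) y with
    | nil => simp [hq] at hy
    | cons a I => exact ⟨a, rfl⟩
  refine ⟨k, ?_, Anc.of_forall_le ((seqOn_infix_left _ _).subset (List.mem_of_head? hk)) hv.1 hv.2⟩
  simp only [heads, Finset.mem_biUnion, Finset.mem_univ, true_and, Finset.mem_union,
    Option.mem_toFinset, Option.mem_def]
  exact ⟨y, Or.inr hk⟩

theorem hasEdge_of_idxOf_lt (h : IsRouting A l f out order) {j : Fin l} {u w : W}
    (hu : j ∈ qAt (.vert u)) (hw : j ∈ qAt (.vert w)) (huw : order.idxOf u < order.idxOf w) :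
    HasEdge A u ∧ HasEdge A w := by
  have hr := h.reaches_of_idxOf_lt hu hw huw
  have hne : u ≠ w := by rintro rfl; omega
  constructor
  · rcases Relation.ReflTransGen.cases_head hr with h1 | ⟨x, hx, -⟩
    · exact absurd h1 hne
    · exact ⟨x, Or.inl hx⟩
  · rcases Relation.ReflTransGen.cases_tail hr with h1 | ⟨x, -, hx⟩
    · exact absurd h1.symm hne
    · exact ⟨x, Or.inr hx⟩

/-- All shortcut edges are certified by edges of the graph and shortcuts of marked chains. -/
theorem certified (h : IsRouting A l f out order) {p : Fin l → Fin l} (hp : p.Injective) {u w : W}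
    (huw : (u, w) ∈ coverShortcut p f out order ∪ markedShortcut A p f out order) :
    (u, w) ∈ A ∨ ∃ x, (u, x) ∈ markedShortcut A p f out order ∧
      (x, w) ∈ markedShortcut A p f out order := by
  rcases Finset.mem_union.1 huw with huw | huw
  · obtain ⟨i, hu, hw, hlt⟩ := h.exists_of_mem_coverShortcut hp huw
    obtain ⟨e1, e2⟩ := h.hasEdge_of_idxOf_lt hu.1 hw.1 hlt
    exact h.certified_of_marked (h.pair_sublist_markedChain_iff.2
      ⟨⟨e1, h.marked_of_isRoot hu⟩, ⟨e2, h.marked_of_isRoot hw⟩, hlt⟩)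
  · rw [markedShortcut, Finset.mem_biUnion] at huw
    obtain ⟨j, -, hj⟩ := huw
    exact h.certified_of_marked (pair_sublist_of_mem_chainShortcut _ hj)

theorem reaches_of_mem_markedShortcut (h : IsRouting A l f out order) {p : Fin l → Fin l} {u w : W}
    (huw : (u, w) ∈ markedShortcut A p f out order) :
    Reaches A u w ∧ order.idxOf u < order.idxOf w := by
  rw [markedShortcut, Finset.mem_biUnion] at huw
  obtain ⟨j, -, hj⟩ := huw
  obtain ⟨⟨-, hu⟩, ⟨-, hw⟩, hlt⟩ :=
    h.pair_sublist_markedChain_iff.1 (pair_sublist_of_mem_chainShortcut _ hj)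
  exact ⟨h.reaches_of_idxOf_lt (mem_of_marked hu) (mem_of_marked hw) hlt, hlt⟩

/-- One head for each incident edge; the 2 stands for the edges from the source and to the sink. -/
theorem card_heads_le (h : IsRouting A l f out order) (v : W) :
    (heads l f out order (.vert v)).card ≤
      2 + ((A.filter fun e => e.2 = v).card + (A.filter fun e => e.1 = v).card) := by
  have h0 : ∀ x y, ((qOn x y).head?.toFinset).card ≤ 1 := by
    intro x y
    rw [Option.card_toFinset]
    cases (qOn x y).head? <;> simp
  have h1 : ∀ x y, ¬ ExtAdj A x y → ((qOn x y).head?.toFinset).card = 0 := by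
    intro x y hxy
    rw [h.seqOn_eq_nil hxy]
    simp
  have hfib : ∀ g : W → W × W, g.Injective → ∀ P : W × W → Prop, ∀ [DecidablePred P],
      (∀ z, P (g z)) → ∑ z, (if g z ∈ A then 1 else 0) ≤ (A.filter P).card := by
    intro g hg P _ hP
    rw [← Finset.card_filter, ← Finset.card_image_of_injective _ hg]
    refine Finset.card_le_card fun e he => ?_
    simp only [Finset.mem_image, Finset.mem_filter, Finset.mem_univ, true_and] at he ⊢
    obtain ⟨z, hz, rfl⟩ := he
    exact ⟨hz, hP z⟩
  have hb : ∀ x y, ∀ P : Prop, ∀ [Decidable P], (ExtAdj A x y → P) →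
      ((qOn x y).head?.toFinset).card ≤ if P then 1 else 0 := by
    intro x y P _ hP
    split_ifs with hP'
    · exact h0 x y
    · exact (h1 x y fun hxy => hP' (hP hxy)).le
  refine Finset.card_biUnion_le.trans ((Finset.sum_le_sum fun z _ => Finset.card_union_le _ _).trans ?_)
  rw [Node.sum_univ]
  have s1 := h0 .source (.vert v)
  have s2 := h1 (.vert v) .source (fun h => h)
  have s3 := h1 .sink (.vert v) (fun h => h)
  have s4 := h0 (.vert v) .sink
  have s5 : ∑ z, (((qOn (.vert z) (.vert v)).head?.toFinset).card +
      ((qOn (.vert v) (.vert z)).head?.toFinset).card) ≤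
      (A.filter fun e => e.2 = v).card + (A.filter fun e => e.1 = v).card := by
    rw [Finset.sum_add_distrib]
    refine add_le_add ?_ ?_
    · exact (Finset.sum_le_sum fun z _ => hb (.vert z) (.vert v) ((z, v) ∈ A) fun h => h).trans
        (hfib (fun z => (z, v)) (fun _ _ e => (Prod.mk.inj e).1) (fun e => e.2 = v) fun _ => rfl)
    · exact (Finset.sum_le_sum fun z _ => hb (.vert v) (.vert z) ((v, z) ∈ A) fun h => h).trans
        (hfib (fun z => (v, z)) (fun _ _ e => (Prod.mk.inj e).2) (fun e => e.1 = v) fun _ => rfl)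
  omega

/-- Each head contributes at most `t` ancestors. As only vertices with an edge are counted, the
additive 2 in the number of heads is absorbed by tripling the degree, and the degrees sum to `2 *
A.card`. Without `HasEdge`, isolated vertices would spoil a bound in terms of edges. -/
theorem sum_length_markedChain_le (h : IsRouting A l f out order) {p : Fin l → Fin l} {t : ℕ}
    (ht : ∀ x, ∀ i ∈ qAt x, (ancs p (qAt x) i).card ≤ t) :
    ∑ j, (markedChain A p f out order j).length ≤ 6 * A.card * t := by
  have e : ∀ j, (markedChain A p f out order j).length =
      ∑ v, if HasEdge A v ∧ Marked p f out order j (.vert v) then 1 else 0 := by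
    intro j
    rw [← Finset.card_filter, markedChain,
      ← List.toFinset_card_of_nodup (h.isTopologicalOrder.1.filter _)]
    congr 1
    ext v
    simp [h.isTopologicalOrder.2.1 v]
  rw [Finset.sum_congr rfl fun j _ => e j, Finset.sum_comm]
  have hv : ∀ v, ∑ j, (if HasEdge A v ∧ Marked p f out order j (.vert v) then 1 else 0) ≤
      3 * ((A.filter fun e => e.2 = v).card + (A.filter fun e => e.1 = v).card) * t := by
    intro v
    by_cases hve : HasEdge A v
    · simp only [hve, true_and]
      rw [← Finset.card_filter]
      have hsub : (Finset.univ.filter fun j => Marked p f out order j (.vert v)) ⊆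
          ((heads l f out order (.vert v)).filter fun i => i ∈ qAt (.vert v)).biUnion
            fun i => ancs p (qAt (.vert v)) i := by
        intro j hj
        simp only [Finset.mem_filter, Finset.mem_univ, true_and] at hj
        obtain ⟨i, hi, hij⟩ := hj
        simp only [Finset.mem_biUnion, Finset.mem_filter]
        exact ⟨i, ⟨hi, hij.1⟩, mem_ancs.2 hij⟩
      have h1 := (Finset.card_le_card hsub).trans (Finset.card_biUnion_le_card_mul _ _ t
        fun i hi => ht _ i (Finset.mem_filter.1 hi).2)
      refine h1.trans (Nat.mul_le_mul_right _ ?_)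
      have h2 := (Finset.card_filter_le (heads l f out order (.vert v))
        (fun i => i ∈ qAt (.vert v))).trans (h.card_heads_le v)
      have h3 : 1 ≤ (A.filter fun e => e.2 = v).card + (A.filter fun e => e.1 = v).card := by
        obtain ⟨w, hw | hw⟩ := hve
        · have : 0 < (A.filter fun e => e.1 = v).card :=
            Finset.card_pos.2 ⟨(v, w), by simp [hw]⟩
          omega
        · have : 0 < (A.filter fun e => e.2 = v).card :=
            Finset.card_pos.2 ⟨(w, v), by simp [hw]⟩
          omega
      omega
    · simp [hve]
  refine (Finset.sum_le_sum fun v _ => hv v).trans (le_of_eq ?_)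
  rw [← Finset.sum_mul, ← Finset.mul_sum, Finset.sum_add_distrib,
    ← Finset.card_eq_sum_card_fiberwise (f := Prod.fst) (t := Finset.univ) (by simp),
    ← Finset.card_eq_sum_card_fiberwise (f := Prod.snd) (t := Finset.univ) (by simp)]
  ring

theorem length_le_card (h : IsRouting A l f out order) {L : List W} (hL : L <+ order) :
    L.length ≤ Fintype.card W :=
  (h.isTopologicalOrder.1.sublist hL).length_le_card

theorem card_markedShortcut_le (h : IsRouting A l f out order) {p : Fin l → Fin l} {t : ℕ}
    (ht : ∀ x, ∀ i ∈ qAt x, (ancs p (qAt x) i).card ≤ t) :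
    (markedShortcut A p f out order).card ≤ 6 * A.card * t * Nat.log 2 (Fintype.card W) := by
  refine Finset.card_biUnion_le.trans ((Finset.sum_le_sum fun j _ =>
    (card_chainShortcut_le _).trans (Nat.mul_le_mul_left _ (Nat.log_mono_right
      (h.length_le_card List.filter_sublist)))).trans ?_)
  rw [← Finset.sum_mul]
  exact Nat.mul_le_mul_right _ (h.sum_length_markedChain_le ht)

/-- Chains of at least two vertices consist of marked vertices. -/
theorem length_chain_le (h : IsRouting A l f out order) {p : Fin l → Fin l} (hp : p.Injective)
    (i : Fin l) : ((extract p f out order).chain i).length ≤ 1 ∨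
      ((extract p f out order).chain i).length ≤ (markedChain A p f out order i).length := by
  rw [h.extract_chain hp]
  by_cases hlen : (order.filter fun v => IsRoot p (qAt (.vert v)) i).length ≤ 1
  · exact Or.inl hlen
  right
  have hn := h.isTopologicalOrder.1
  rw [markedChain, ← List.toFinset_card_of_nodup (hn.filter _),
    ← List.toFinset_card_of_nodup (hn.filter _)]
  rw [← List.toFinset_card_of_nodup (hn.filter _), not_le] at hlen
  refine Finset.card_le_card fun u hu => ?_
  obtain ⟨w, hw, hwu⟩ := Finset.exists_mem_ne hlen u
  have hmem := h.isTopologicalOrder.2.1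
  simp only [List.toFinset_filter, Finset.mem_filter, List.mem_toFinset, hmem, true_and,
    decide_eq_true_eq] at hu hw ⊢
  refine ⟨?_, h.marked_of_isRoot hu⟩
  rcases lt_trichotomy (order.idxOf u) (order.idxOf w) with h1 | h1 | h1
  · exact (h.hasEdge_of_idxOf_lt hu.1 hw.1 h1).1
  · exact absurd ((List.idxOf_inj (hmem u)).1 h1).symm hwu
  · exact (h.hasEdge_of_idxOf_lt hw.1 hu.1 h1).2

/-- A bound in terms of vertices is too weak for sparse graphs. Chains of at most one vertex produce
no edges, and longer ones are no longer than their marked chains. -/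
theorem card_coverShortcut_le_of_ancs (h : IsRouting A l f out order) {p : Fin l → Fin l}
    (hp : p.Injective) {t : ℕ} (ht : ∀ x, ∀ i ∈ qAt x, (ancs p (qAt x) i).card ≤ t) :
    (coverShortcut p f out order).card ≤ 6 * A.card * t * Nat.log 2 (Fintype.card W) := by
  refine Finset.card_biUnion_le.trans ((Finset.sum_le_sum fun i _ => ?_).trans
    ((Finset.sum_mul _ _ _).symm.le.trans
      (Nat.mul_le_mul_right _ (h.sum_length_markedChain_le ht))))
  refine (card_chainShortcut_le _).trans ?_
  rcases h.length_chain_le hp i with h1 | h1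
  · rw [Nat.log_of_lt (by omega), mul_zero]
    exact Nat.zero_le _
  · refine Nat.mul_le_mul h1 (Nat.log_mono_right (h.length_le_card ?_))
    rw [h.extract_chain hp]
    exact List.filter_sublist

end IsRouting

end Certification

/-! ### With high probability all treaps are shallow. -/

section Probability

variable {W : Type u} [Fintype W] [DecidableEq W] {A : Finset (W × W)} {l : ℕ} {f : GadgetFlow W}
  {out : Node W → List (Node W)} {order : List W}

theorem Node.card_eq : Fintype.card (Node W) = Fintype.card W + 2 := by
  rw [← Finset.card_univ, Finset.card_eq_sum_ones, Node.sum_univ]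
  simp
  omega

/-- All treaps of the routing are shallow. -/
def IsShallow (l : ℕ) (f : GadgetFlow W) (out : Node W → List (Node W)) (order : List W) (t : ℕ)
    (p : Fin l → Fin l) : Prop :=
  ∀ x, ∀ i ∈ seqAt l f out order x, (ancs p (seqAt l f out order x) i).card ≤ t

instance (t : ℕ) (p : Fin l → Fin l) : Decidable (IsShallow l f out order t p) := by
  unfold IsShallow; infer_instance

/-- A union bound over the nodes and the elements of their sequences, possible because `seqAt` does
not depend on `p`. -/
theorem IsRouting.card_not_isShallow_le (h : IsRouting A l f out order) (t : ℕ) :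
    (Finset.univ.filter fun p : Equiv.Perm (Fin l) => ¬ IsShallow l f out order t p).card * 2 ^ t ≤
      (Fintype.card W + 2) * l ^ 3 * l.factorial := by
  have hsub : (Finset.univ.filter fun p : Equiv.Perm (Fin l) => ¬ IsShallow l f out order t p) ⊆
      Finset.univ.biUnion fun x : Node W => (seqAt l f out order x).toFinset.biUnion fun i =>
        Finset.univ.filter fun p : Equiv.Perm (Fin l) =>
          t < (ancs p (seqAt l f out order x) i).card := by
    intro p hp
    simp only [IsShallow, Finset.mem_filter, Finset.mem_univ, true_and, not_forall, not_le] at hp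
    obtain ⟨x, i, hi, hlt⟩ := hp
    simp only [Finset.mem_biUnion, Finset.mem_filter, Finset.mem_univ, true_and, List.mem_toFinset]
    exact ⟨x, i, hi, hlt⟩
  have h1 : ∀ x : Node W, ((seqAt l f out order x).toFinset.biUnion fun i =>
        Finset.univ.filter fun p : Equiv.Perm (Fin l) =>
          t < (ancs p (seqAt l f out order x) i).card).card * 2 ^ t ≤
      l * (l.factorial * l ^ 2) := by
    intro x
    refine (Nat.mul_le_mul_right _ Finset.card_biUnion_le).trans ?_
    rw [Finset.sum_mul]
    refine (Finset.sum_le_card_nsmul _ _ (l.factorial * l ^ 2) fun i hi =>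
      card_filter_lt_ancs_le (h.nodup_seqAt x) (List.mem_toFinset.1 hi) t).trans ?_
    rw [smul_eq_mul]
    refine Nat.mul_le_mul_right _ ((Finset.card_le_univ _).trans ?_)
    rw [Fintype.card_fin]
  refine (Nat.mul_le_mul_right _ ((Finset.card_le_card hsub).trans Finset.card_biUnion_le)).trans ?_
  rw [Finset.sum_mul]
  refine (Finset.sum_le_card_nsmul _ _ _ fun x _ => h1 x).trans (le_of_eq ?_)
  rw [Finset.card_univ, Node.card_eq, smul_eq_mul]
  ring

theorem IsRouting.isShallow_prob (h : IsRouting A l f out order) {n a K t : ℕ}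
    (hn : Fintype.card W ≤ n) (hl : l ≤ K * n) (ht : 3 * K ^ 3 * n ^ (a + 4) ≤ 2 ^ t) :
    ENNReal.ofReal (1 - 1 / (n : ℝ) ^ a) ≤
      (PMF.uniformOfFintype (Equiv.Perm (Fin l))).toOuterMeasure
        {p | IsShallow l f out order t p} := by
  have hbad := h.card_not_isShallow_le t
  set bad := (Finset.univ.filter fun p : Equiv.Perm (Fin l) => ¬ IsShallow l f out order t p).card
    with hb
  have hF : 0 < l.factorial := l.factorial_pos
  have hsum := Finset.card_filter_add_card_filter_not (s := (Finset.univ : Finset (Equiv.Perm (Fin l))))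
    fun p => IsShallow l f out order t p
  rw [← hb, Finset.card_univ, Fintype.card_perm, Fintype.card_fin] at hsum
  set good := (Finset.univ.filter fun p : Equiv.Perm (Fin l) => IsShallow l f out order t p).card
    with hg
  rw [PMF.toOuterMeasure_uniformOfFintype_apply, Fintype.card_perm, Fintype.card_fin,
    Fintype.card_subtype]
  change _ ≤ (good : ENNReal) / _
  have key : 1 - 1 / (n : ℝ) ^ a ≤ (good : ℝ) / (l.factorial : ℝ) := by
    rw [le_div_iff₀ (by exact_mod_cast hF)]
    have hsum' : (good : ℝ) + bad = l.factorial := by exact_mod_cast hsum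
    -- For `n = 0` and positive `a` the quotient `1 / n ^ a` is 0 and no bad permutation may exist;
    -- the counting bound ensures this, as `l = 0`.
    rcases Nat.eq_zero_or_pos n with hn0 | hn0
    · have hl0 : l = 0 := by
        rw [hn0, mul_zero] at hl
        omega
      have hbad0 : bad = 0 := by
        rw [hl0] at hbad
        have : bad * 2 ^ t = 0 := by simpa using hbad
        exact (Nat.mul_eq_zero.1 this).resolve_right (by positivity)
      rw [hbad0] at hsum'
      have h0 : 0 ≤ 1 / (n : ℝ) ^ a := by positivity
      have h1 : (0 : ℝ) ≤ l.factorial := by positivity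
      push_cast at hsum'
      nlinarith
    · have h1 : bad * n ^ a ≤ l.factorial := by
        have hK : 0 < n ^ 4 * 2 ^ t := by positivity
        have e1 : (Fintype.card W + 2) * l ^ 3 ≤ (3 * n) * (K * n) ^ 3 :=
          Nat.mul_le_mul (by omega) (Nat.pow_le_pow_left hl 3)
        have e2 : bad * 2 ^ t ≤ (3 * n) * (K * n) ^ 3 * l.factorial :=
          hbad.trans (Nat.mul_le_mul_right _ e1)
        refine Nat.le_of_mul_le_mul_right (c := 2 ^ t) ?_ (by positivity)
        calc bad * n ^ a * 2 ^ t = bad * 2 ^ t * n ^ a := by ring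
          _ ≤ (3 * n) * (K * n) ^ 3 * l.factorial * n ^ a := Nat.mul_le_mul_right _ e2
          _ = l.factorial * (3 * K ^ 3 * n ^ (a + 4)) := by ring
          _ ≤ _ := Nat.mul_le_mul_left _ ht
      have h2 : (bad : ℝ) ≤ 1 / (n : ℝ) ^ a * l.factorial := by
        rw [one_div, inv_mul_eq_div, le_div_iff₀ (by positivity)]
        exact_mod_cast h1
      linarith
  refine (ENNReal.ofReal_le_ofReal key).trans (le_of_eq ?_)
  rw [ENNReal.ofReal_div_of_pos (by exact_mod_cast hF), ENNReal.ofReal_natCast,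
    ENNReal.ofReal_natCast]

end Probability

/-! ### From the condensation back to the whole graph. -/

section Lift

variable {V : Type u} [DecidableEq V]

theorem isShortcut_sdiff {E X : Finset (V × V)} {D : ℕ}
    (hX : ∀ u v, (u, v) ∈ X → u ≠ v ∧ Reaches E u v)
    (hw : ∀ s t, Reaches E s t → ∃ k ≤ D, HasWalk (E ∪ X) k s t) : IsShortcut E (X \ E) D where
  loopless v hv := (hX v v (Finset.mem_sdiff.1 hv).1).1 rfl
  additional := Finset.disjoint_sdiff
  not_reaches s t hst hst' := by
    refine hst ?_
    rw [Finset.union_sdiff_self_eq_union] at hst'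
    clear hst
    induction hst' with
    | refl => exact .refl
    | tail _ hab ih =>
      rcases Finset.mem_union.1 hab with h | h
      · exact ih.tail h
      · exact ih.trans (hX _ _ h).2
  short_walk := by
    rwa [Finset.union_sdiff_self_eq_union]

variable [Fintype V] {E : Finset (V × V)} {rep : V → V}

theorem IsSccRoot.rep_rep (h : IsSccRoot E rep) (v : V) : rep (rep v) = rep v :=
  h.2 _ _ (h.1 v).2 (h.1 v).1

/-- The selected vertex of the component of `v`. -/
def IsSccRoot.root (h : IsSccRoot E rep) (v : V) : Root rep := ⟨rep v, h.rep_rep v⟩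

theorem mem_condense {a b : Root rep} :
    (a, b) ∈ condense E rep ↔ a ≠ b ∧ ∃ e ∈ E, rep e.1 = a.1 ∧ rep e.2 = b.1 := by
  simp [condense]

theorem IsSccRoot.reaches_edge (h : IsSccRoot E rep) {x y : V} (hxy : (x, y) ∈ E) :
    Reaches E (rep x) (rep y) :=
  ((h.1 x).2.tail hxy).trans (h.1 y).1

theorem IsSccRoot.reaches_of_condense (h : IsSccRoot E rep) {a b : Root rep}
    (hab : Reaches (condense E rep) a b) : Reaches E a.1 b.1 := by
  induction hab with
  | refl => exact .refl
  | tail _ hbc ih =>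
    obtain ⟨-, e, he, h1, h2⟩ := mem_condense.1 hbc
    rw [← h1] at ih
    rw [← h2]
    exact ih.trans (h.reaches_edge he)

theorem IsSccRoot.reaches_condense (h : IsSccRoot E rep) {u v : V} (huv : Reaches E u v) :
    Reaches (condense E rep) (h.root u) (h.root v) := by
  induction huv with
  | refl => exact .refl
  | @tail b c _ hbc ih =>
    by_cases he : h.root b = h.root c
    · rwa [← he]
    · exact ih.tail (mem_condense.2 ⟨he, (b, c), hbc, rfl, rfl⟩)

theorem card_condense_le (h : IsSccRoot E rep) : (condense E rep).card ≤ E.card := by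
  refine le_trans (Finset.card_le_card fun q hq => ?_)
    (Finset.card_image_le (s := E) (f := fun e => (h.root e.1, h.root e.2)))
  obtain ⟨-, e, he, h1, h2⟩ := mem_condense.1 (show (q.1, q.2) ∈ condense E rep from hq)
  exact Finset.mem_image.2 ⟨e, he, Prod.ext (Subtype.ext h1) (Subtype.ext h2)⟩

/-- Edges between selected vertices as edges of the whole graph. -/
def liftEdges (S : Finset (Root rep × Root rep)) : Finset (V × V) :=
  S.image fun q => ((q.1 : V), (q.2 : V))

theorem mem_liftEdges {S : Finset (Root rep × Root rep)} {u v : V} :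
    (u, v) ∈ liftEdges S ↔ ∃ a b : Root rep, (a, b) ∈ S ∧ a.1 = u ∧ b.1 = v := by
  simp only [liftEdges, Finset.mem_image, Prod.exists, Prod.mk.injEq]

theorem mem_sccShortcut {u v : V} :
    (u, v) ∈ sccShortcut rep ↔ u ≠ v ∧ (u = rep v ∨ v = rep u) := by
  simp [sccShortcut]

theorem IsSccRoot.reaches_of_mem_sccShortcut (h : IsSccRoot E rep) {u v : V}
    (huv : (u, v) ∈ sccShortcut rep) : Reaches E u v := by
  obtain ⟨-, rfl | rfl⟩ := mem_sccShortcut.1 huv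
  · exact (h.1 v).2
  · exact (h.1 u).1

theorem card_sccShortcut_le_mul :
    (sccShortcut rep).card ≤ 2 * (Finset.univ.filter fun v => v ≠ rep v).card := by
  set S := Finset.univ.filter fun v => v ≠ rep v
  have hsub : sccShortcut rep ⊆ S.image (fun v => (v, rep v)) ∪ S.image (fun v => (rep v, v)) := by
    rintro ⟨u, v⟩ huv
    simp only [S, Finset.mem_union, Finset.mem_image, Finset.mem_filter, Finset.mem_univ, true_and,
      Prod.mk.injEq]
    obtain ⟨hne, rfl | rfl⟩ := mem_sccShortcut.1 huv
    · exact Or.inr ⟨v, hne.symm, rfl, rfl⟩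
    · exact Or.inl ⟨u, hne, rfl, rfl⟩
  have h1 := (Finset.card_le_card hsub).trans (Finset.card_union_le _ _)
  have h2 := Finset.card_image_le (s := S) (f := fun v => (v, rep v))
  have h3 := Finset.card_image_le (s := S) (f := fun v => (rep v, v))
  omega

theorem card_sccShortcut_le_card : (sccShortcut rep).card ≤ 2 * Fintype.card V :=
  card_sccShortcut_le_mul.trans (Nat.mul_le_mul_left _ (Finset.card_le_univ _))

/-- Every vertex other than its root is the tail of an edge, as it must leave itself to reach the
root. This gives a bound by edges where the trivial one is by vertices. -/
theorem IsSccRoot.card_sccShortcut_le (h : IsSccRoot E rep) :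
    (sccShortcut rep).card ≤ 2 * E.card := by
  refine card_sccShortcut_le_mul.trans (Nat.mul_le_mul_left _ ?_)
  refine le_trans (Finset.card_le_card fun v hv => ?_)
    (Finset.card_image_le (s := E) (f := Prod.fst))
  rw [Finset.mem_filter] at hv
  rcases Relation.ReflTransGen.cases_head (h.1 v).1 with h1 | ⟨x, hx, -⟩
  · exact absurd h1 hv.2
  · exact Finset.mem_image.2 ⟨(v, x), hx, rfl⟩

/-- A walk between selected vertices is turned into a walk of the whole graph. -/
theorem hasWalk_lift {X : Finset (V × V)} (hX : sccShortcut rep ⊆ X)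
    {S : Finset (Root rep × Root rep)} (hS : liftEdges S ⊆ X) {k : ℕ} {a b : Root rep}
    (hab : HasWalk (condense E rep ∪ S) k a b) : ∃ k' ≤ 3 * k, HasWalk (E ∪ X) k' a.1 b.1 := by
  induction k generalizing a with
  | zero => cases hab; exact ⟨0, by omega, rfl⟩
  | succ k ih =>
    obtain ⟨c, hac, hcb⟩ := hab
    obtain ⟨k', hk', hw⟩ := ih hcb
    have hscc : ∀ u v : V, (u = rep v ∨ v = rep u) → ∃ d ≤ 1, HasWalk (E ∪ X) d u v := by
      intro u v huv
      by_cases hne : u = v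
      · exact ⟨0, by omega, hne⟩
      · exact ⟨1, le_rfl, .single (Finset.mem_union_right _ (hX (mem_sccShortcut.2 ⟨hne, huv⟩)))⟩
    obtain ⟨d, hd, hwd⟩ : ∃ d ≤ 3, HasWalk (E ∪ X) d a.1 c.1 := by
      rcases Finset.mem_union.1 hac with h1 | h1
      · obtain ⟨-, ⟨x, y⟩, he, h1, h2⟩ := mem_condense.1 h1
        obtain ⟨d1, hd1, hw1⟩ := hscc a.1 x (Or.inl h1.symm)
        obtain ⟨d2, hd2, hw2⟩ := hscc y c.1 (Or.inr h2.symm)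
        exact ⟨d1 + 1 + d2, by omega,
          (hw1.trans (.single (Finset.mem_union_left _ he))).trans hw2⟩
      · exact ⟨1, by omega, .single (Finset.mem_union_right _
          (hS (mem_liftEdges.2 ⟨a, c, h1, rfl, rfl⟩)))⟩
    exact ⟨d + k', by omega, hwd.trans hw⟩

/-- An edge of the condensation expands to at most three edges: root to tail, the edge itself, head
to root. The additional 2 connects the endpoints with their roots. -/
theorem IsSccRoot.exists_walk (h : IsSccRoot E rep) {X : Finset (V × V)} (hX : sccShortcut rep ⊆ X)
    {S : Finset (Root rep × Root rep)} (hS : liftEdges S ⊆ X) {D : ℕ}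
    (hD : ∀ a b, Reaches (condense E rep) a b → ∃ k ≤ D, HasWalk (condense E rep ∪ S) k a b)
    {u v : V} (huv : Reaches E u v) : ∃ k ≤ 3 * D + 2, HasWalk (E ∪ X) k u v := by
  have hscc : ∀ u v : V, (u = rep v ∨ v = rep u) → ∃ d ≤ 1, HasWalk (E ∪ X) d u v := by
    intro u v huv
    by_cases hne : u = v
    · exact ⟨0, by omega, hne⟩
    · exact ⟨1, le_rfl, .single (Finset.mem_union_right _ (hX (mem_sccShortcut.2 ⟨hne, huv⟩)))⟩
  obtain ⟨k, hk, hw⟩ := hD _ _ (h.reaches_condense huv)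
  obtain ⟨k', hk', hw'⟩ := hasWalk_lift hX hS hw
  obtain ⟨d1, hd1, hw1⟩ := hscc u (rep u) (Or.inr rfl)
  obtain ⟨d2, hd2, hw2⟩ := hscc (rep v) v (Or.inl rfl)
  exact ⟨d1 + k' + d2, by omega, (hw1.trans hw').trans hw2⟩

/-- The edges between different components, with the tail moved to the selected vertex. -/
def halfEdges (E : Finset (V × V)) (rep : V → V) : Finset (V × V) :=
  (E.filter fun e => rep e.1 ≠ rep e.2).image fun e => (rep e.1, e.2)

/-- A certified superset of the output, for given shortcuts `M` of the contracted graph. -/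
def certifiedSet (E : Finset (V × V)) (rep : V → V) (S M : Finset (Root rep × Root rep)) :
    Finset (V × V) :=
  sccShortcut rep ∪ halfEdges E rep ∪ liftEdges (condense E rep) ∪ liftEdges (S ∪ M)

/-- Each kind of edge has its own witness. A condensed edge from `rep x` to `rep y` goes through
`y`, which requires the half edge from `rep x` to `y`; that one goes through `x`. -/
theorem IsSccRoot.certified (h : IsSccRoot E rep) {S M : Finset (Root rep × Root rep)}
    (hSM : ∀ a b, (a, b) ∈ S ∪ M → (a, b) ∈ condense E rep ∨ ∃ x, (a, x) ∈ M ∧ (x, b) ∈ M) :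
    IsCertified E (certifiedSet E rep S M \ E) := by
  set X := certifiedSet E rep S M with hX
  have hs : ∀ {e}, e ∈ sccShortcut rep → e ∈ E ∪ X := fun he =>
    Finset.mem_union_right _ (by simp only [hX, certifiedSet, Finset.mem_union]; tauto)
  have hh : ∀ {e}, e ∈ halfEdges E rep → e ∈ E ∪ X := fun he =>
    Finset.mem_union_right _ (by simp only [hX, certifiedSet, Finset.mem_union]; tauto)
  have hm : ∀ {e}, e ∈ liftEdges (S ∪ M) → e ∈ E ∪ X := fun he =>
    Finset.mem_union_right _ (by simp only [hX, certifiedSet, Finset.mem_union]; tauto)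
  have hE : ∀ {e}, e ∈ E → e ∈ E ∪ X := fun he => Finset.mem_union_left _ he
  intro u v huv
  rw [Finset.mem_sdiff] at huv
  rw [Finset.union_sdiff_self_eq_union]
  obtain ⟨huv, hn⟩ := huv
  have c2 : ∀ {u v}, (u, v) ∈ halfEdges E rep → (u, v) ∉ E →
      ∃ w, (u, w) ∈ E ∪ X ∧ (w, v) ∈ E ∪ X := by
    intro u v huv hn
    simp only [halfEdges, Finset.mem_image, Finset.mem_filter, Prod.exists, Prod.mk.injEq] at huv
    obtain ⟨x, y, ⟨hxy, hne⟩, rfl, rfl⟩ := huv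
    have hx : rep x ≠ x := fun e => hn (by rwa [e])
    exact ⟨x, hs (mem_sccShortcut.2 ⟨hx, Or.inl rfl⟩), hE hxy⟩
  have c3 : ∀ {u v}, (u, v) ∈ liftEdges (condense E rep) → (u, v) ∉ E →
      ∃ w, (u, w) ∈ E ∪ X ∧ (w, v) ∈ E ∪ X := by
    intro u v huv hn
    obtain ⟨a, b, hab, rfl, rfl⟩ := mem_liftEdges.1 huv
    obtain ⟨hne, ⟨x, y⟩, hxy, h1, h2⟩ := mem_condense.1 hab
    have hne' : rep x ≠ rep y := fun e => hne (Subtype.ext (by rw [← h1, ← h2, e]))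
    have hhalf : (rep x, y) ∈ halfEdges E rep :=
      Finset.mem_image.2 ⟨(x, y), Finset.mem_filter.2 ⟨hxy, hne'⟩, rfl⟩
    simp only at h1 h2
    rw [← h1, ← h2] at hn ⊢
    by_cases hy : rep y = y
    · rw [hy] at hn ⊢
      exact c2 hhalf hn
    · exact ⟨y, hh hhalf, hs (mem_sccShortcut.2 ⟨Ne.symm hy, Or.inr rfl⟩)⟩
  rw [hX, certifiedSet, Finset.mem_union, Finset.mem_union, Finset.mem_union] at huv
  rcases huv with ((huv | huv) | huv) | huv
  · obtain ⟨hne, rfl | rfl⟩ := mem_sccShortcut.1 huv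
    -- The last vertex before `v` on a path from the root stays in the component, so the star joins
    -- the root to it.
    · rcases Relation.ReflTransGen.cases_tail (h.1 v).2 with h1 | ⟨w, hw, hwv⟩
      · exact absurd h1.symm hne
      · have hwr : rep w = rep v := h.2 _ _ (.single hwv) ((h.1 v).1.trans hw)
        have hwn : rep v ≠ w := fun e => hn (by rwa [← e] at hwv)
        exact ⟨w, hs (mem_sccShortcut.2 ⟨hwn, Or.inl hwr.symm⟩), hE hwv⟩
    · rcases Relation.ReflTransGen.cases_head (h.1 u).1 with h1 | ⟨w, huw, hw⟩
      · exact absurd h1 hne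
      · have hwr : rep w = rep u := h.2 _ _ (hw.trans (h.1 u).2) (.single huw)
        have hwn : w ≠ rep u := fun e => hn (by rwa [e] at huw)
        exact ⟨w, hE huw, hs (mem_sccShortcut.2 ⟨hwn, Or.inr hwr.symm⟩)⟩
  · exact c2 huv hn
  · exact c3 huv hn
  · obtain ⟨a, b, hab, rfl, rfl⟩ := mem_liftEdges.1 huv
    rcases hSM a b hab with h1 | ⟨x, h1, h2⟩
    · exact c3 (mem_liftEdges.2 ⟨a, b, h1, rfl, rfl⟩) hn
    · exact ⟨x.1, hm (mem_liftEdges.2 ⟨a, x, Finset.mem_union_right _ h1, rfl, rfl⟩),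
        hm (mem_liftEdges.2 ⟨x, b, Finset.mem_union_right _ h2, rfl, rfl⟩)⟩

theorem IsSccRoot.reaches_of_mem_certifiedSet (h : IsSccRoot E rep)
    {S M : Finset (Root rep × Root rep)}
    (hSM : ∀ a b, (a, b) ∈ S ∪ M → a ≠ b ∧ Reaches (condense E rep) a b) {u v : V}
    (huv : (u, v) ∈ certifiedSet E rep S M) : u ≠ v ∧ Reaches E u v := by
  rw [certifiedSet, Finset.mem_union, Finset.mem_union, Finset.mem_union] at huv
  rcases huv with ((huv | huv) | huv) | huv
  · exact ⟨(mem_sccShortcut.1 huv).1, h.reaches_of_mem_sccShortcut huv⟩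
  · simp only [halfEdges, Finset.mem_image, Finset.mem_filter, Prod.exists, Prod.mk.injEq] at huv
    obtain ⟨x, y, ⟨hxy, hne⟩, rfl, rfl⟩ := huv
    refine ⟨fun e => hne ?_, (h.1 x).2.tail hxy⟩
    rw [← e, h.rep_rep]
  · obtain ⟨a, b, hab, rfl, rfl⟩ := mem_liftEdges.1 huv
    exact ⟨fun e => (mem_condense.1 hab).1 (Subtype.ext e), h.reaches_of_condense (.single hab)⟩
  · obtain ⟨a, b, hab, rfl, rfl⟩ := mem_liftEdges.1 huv
    obtain ⟨h1, h2⟩ := hSM a b hab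
    exact ⟨fun e => h1 (Subtype.ext e), h.reaches_of_condense h2⟩

theorem IsSccRoot.card_certifiedSet_le (h : IsSccRoot E rep) (S M : Finset (Root rep × Root rep)) :
    (certifiedSet E rep S M).card ≤ 4 * E.card + S.card + M.card := by
  have h1 := h.card_sccShortcut_le
  have h2 : (halfEdges E rep).card ≤ E.card :=
    Finset.card_image_le.trans (Finset.card_filter_le _ _)
  have h3 : (liftEdges (condense E rep)).card ≤ E.card :=
    Finset.card_image_le.trans (card_condense_le h)
  have h4 : (liftEdges (S ∪ M)).card ≤ S.card + M.card :=
    Finset.card_image_le.trans (Finset.card_union_le _ _)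
  have u1 := Finset.card_union_le (sccShortcut rep ∪ halfEdges E rep ∪ liftEdges (condense E rep))
    (liftEdges (S ∪ M))
  have u2 := Finset.card_union_le (sccShortcut rep ∪ halfEdges E rep) (liftEdges (condense E rep))
  have u3 := Finset.card_union_le (sccShortcut rep) (halfEdges E rep)
  rw [certifiedSet]
  omega

end Lift

/-! ### Bounds for the output of the algorithm. -/

section Output

variable {V : Type u} [Fintype V] [DecidableEq V] {E : Finset (V × V)} {rep : V → V} {l : ℕ}
  {f : GadgetFlow (Root rep)} {out : Node (Root rep) → List (Node (Root rep))}
  {order : List (Root rep)}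

theorem isShortcut_outputShortcut (hrep : IsSccRoot E rep)
    (h : IsRouting (condense E rep) l f out order) (hf : f.IsMinCost (condense E rep) l)
    (hl : 0 < l) {p : Fin l → Fin l} (hp : p.Injective) :
    IsShortcut E (outputShortcut E rep p f out order)
      (3 * (3 * l + Fintype.card (Root rep) / l) + 2) := by
  refine isShortcut_sdiff (fun u v huv => ?_) fun s t hst => ?_
  · rcases Finset.mem_union.1 huv with h1 | h1
    · exact ⟨(mem_sccShortcut.1 h1).1, hrep.reaches_of_mem_sccShortcut h1⟩
    · obtain ⟨a, b, hab, rfl, rfl⟩ := mem_liftEdges.1 h1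
      obtain ⟨h2, h3⟩ := h.reaches_of_mem_coverShortcut hp hab
      refine ⟨fun e => ?_, hrep.reaches_of_condense h2⟩
      rw [Subtype.ext e] at h3
      exact lt_irrefl _ h3
  · exact hrep.exists_walk Finset.subset_union_left
      (S := coverShortcut p f out order) Finset.subset_union_right
      (fun a b hab => h.exists_short_walk hf hl hp hab) hst

theorem card_outputShortcut_le (h : IsRouting (condense E rep) l f out order) {p : Fin l → Fin l}
    (hp : p.Injective) : (outputShortcut E rep p f out order).card ≤
      Fintype.card V * (2 + Nat.log 2 (Fintype.card V)) := by
  have hR : Fintype.card (Root rep) ≤ Fintype.card V := Fintype.card_subtype_le _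
  have h1 := h.card_coverShortcut_le hp
  have h2 : ((coverShortcut p f out order).image fun q => ((q.1 : V), (q.2 : V))).card ≤ _ :=
    Finset.card_image_le.trans h1
  have h3 := card_sccShortcut_le_card (rep := rep)
  have h4 := Nat.mul_le_mul hR (Nat.log_mono_right (b := 2) hR)
  refine (Finset.card_le_card Finset.sdiff_subset).trans ((Finset.card_union_le _ _).trans ?_)
  rw [mul_add]
  omega

/-- The witness is `certifiedSet`. In the bound, 4 counts the stars twice, the half edges and the
condensed edges once each; 12 is 6 for the output chains plus 6 for the marked chains. -/
theorem certComplexity_outputShortcut_le (hrep : IsSccRoot E rep)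
    (h : IsRouting (condense E rep) l f out order) (hf : f.IsMinCost (condense E rep) l)
    (hl : 0 < l) {p : Fin l → Fin l} (hp : p.Injective) {t : ℕ}
    (ht : IsShallow l f out order t p) :
    certComplexity E (outputShortcut E rep p f out order) ≤
      ((E.card * (4 + 12 * t * Nat.log 2 (Fintype.card V)) : ℕ) : ℕ∞) := by
  set S := coverShortcut p f out order with hS
  set M := markedShortcut (condense E rep) p f out order with hM
  have hlt : ∀ a b, (a, b) ∈ S ∪ M → a ≠ b ∧ Reaches (condense E rep) a b := by
    intro a b hab
    rcases Finset.mem_union.1 hab with h1 | h1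
    · obtain ⟨h1, h2⟩ := h.reaches_of_mem_coverShortcut hp h1
      exact ⟨by rintro rfl; exact lt_irrefl _ h2, h1⟩
    · obtain ⟨h1, h2⟩ := h.reaches_of_mem_markedShortcut h1
      exact ⟨by rintro rfl; exact lt_irrefl _ h2, h1⟩
  have hsub : sccShortcut rep ∪ liftEdges S ⊆ certifiedSet E rep S M := by
    intro e he
    simp only [certifiedSet, liftEdges, Finset.image_union, Finset.mem_union] at he ⊢
    tauto
  have hmem : certifiedSet E rep S M \ E ∈ {H' : Finset (V × V) |
      outputShortcut E rep p f out order ⊆ H' ∧ IsCertified E H' ∧ ∃ D, IsShortcut E H' D} := by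
    refine ⟨Finset.sdiff_subset_sdiff hsub subset_rfl,
      hrep.certified fun a b hab => h.certified hp hab,
      3 * (3 * l + Fintype.card (Root rep) / l) + 2, isShortcut_sdiff (fun u v huv => ?_) fun s t hst => ?_⟩
    · exact hrep.reaches_of_mem_certifiedSet hlt huv
    · exact hrep.exists_walk (Finset.subset_union_left.trans hsub)
        (S := S) (Finset.subset_union_right.trans hsub)
        (fun a b hab => h.exists_short_walk hf hl hp hab) hst
  refine (iInf₂_le _ hmem).trans ?_
  rw [Nat.cast_le]
  have hR : Fintype.card (Root rep) ≤ Fintype.card V := Fintype.card_subtype_le _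
  have hlog := Nat.log_mono_right (b := 2) hR
  have h1 : S.card ≤ _ := h.card_coverShortcut_le_of_ancs hp ht
  have h2 : M.card ≤ _ := h.card_markedShortcut_le ht
  have h3 : 6 * (condense E rep).card * t * Nat.log 2 (Fintype.card (Root rep)) ≤
      6 * E.card * t * Nat.log 2 (Fintype.card V) :=
    Nat.mul_le_mul (Nat.mul_le_mul_right _ (Nat.mul_le_mul_left _ (card_condense_le hrep))) hlog
  have h4 : (certifiedSet E rep S M \ E).card ≤ _ :=
    (Finset.card_le_card Finset.sdiff_subset).trans (hrep.card_certifiedSet_le S M)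
  calc _ ≤ _ := h4
    _ ≤ 4 * E.card + 6 * E.card * t * Nat.log 2 (Fintype.card V) +
        6 * E.card * t * Nat.log 2 (Fintype.card V) := by omega
    _ = _ := by ring

end Output

/-! ### Numerical estimates and the choice of constants. -/

theorem natLog_two_le_two_mul_log (n : ℕ) : (Nat.log 2 n : ℝ) ≤ 2 * Real.log n := by
  rcases Nat.eq_zero_or_pos n with rfl | hn
  · simp
  have h1 : ((2 ^ Nat.log 2 n : ℕ) : ℝ) ≤ n := by exact_mod_cast Nat.pow_log_le_self 2 hn.ne'
  have h2 := Real.log_le_log (by positivity) h1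
  push_cast at h2
  rw [Real.log_pow] at h2
  have h3 := Real.log_two_gt_d9
  have h4 : (0 : ℝ) ≤ Nat.log 2 n := by positivity
  nlinarith

/-- Turns the threshold in `isShallow_prob` into an explicit depth that is logarithmic in `n`. -/
theorem pow_le_two_pow (b n e : ℕ) : b * n ^ e ≤ 2 ^ (b + e * (Nat.log 2 n + 1)) := by
  rw [pow_add, mul_comm e, pow_mul]
  exact Nat.mul_le_mul b.lt_two_pow_self.le
    (Nat.pow_le_pow_left (Nat.lt_pow_succ_log_self one_lt_two n).le _)

theorem le_ceil_mul_card {c : ℝ} (hc : 0 < c) {l n : ℕ} (h : (l : ℝ) ≤ c * √n) :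
    l ≤ ⌈c⌉₊ * n := by
  have h1 : √(n : ℝ) ≤ n := by
    rcases Nat.eq_zero_or_pos n with rfl | hn
    · simp
    · rw [Real.sqrt_le_left (by positivity)]
      have : (1 : ℝ) ≤ n := by exact_mod_cast hn
      nlinarith
  have h2 : (l : ℝ) ≤ (⌈c⌉₊ * n : ℕ) := by
    push_cast
    exact h.trans (mul_le_mul (Nat.le_ceil c) h1 (by positivity) (by positivity))
  exact_mod_cast h2

end CertShortcut

open CertShortcut in
theorem mainTheorem10 :
    ∃ k : ℕ, ∀ c₁ c₂ : ℝ, 0 < c₁ → 0 < c₂ → ∃ C : ℝ, ∀ a : ℕ, ∃ C' : ℝ,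
      ∀ (V : Type u) [Fintype V] [DecidableEq V] (E : Finset (V × V)),
        (∀ v, (v, v) ∉ E) →
      ∀ rep : V → V, IsSccRoot E rep →
      ∀ l : ℕ, c₁ * √(Fintype.card (Root rep)) ≤ l → l ≤ c₂ * √(Fintype.card V) →
      ∀ f : GadgetFlow (Root rep), f.IsMinCost (condense E rep) l →
      ∀ out : Node (Root rep) → List (Node (Root rep)), IsOutList (condense E rep) out →
      ∀ order : List (Root rep), IsTopologicalOrder (condense E rep) order →
        (∀ p : Equiv.Perm (Fin l),
          (∃ D : ℕ, (D : ℝ) ≤ C * √(Fintype.card V) ∧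
            IsShortcut E (outputShortcut E rep p f out order) D) ∧
          ((outputShortcut E rep p f out order).card : ℝ) ≤
            C * (Fintype.card V * (1 + Real.log (Fintype.card V)) ^ k)) ∧
        ENNReal.ofReal (1 - 1 / (Fintype.card V : ℝ) ^ a) ≤
          (PMF.uniformOfFintype (Equiv.Perm (Fin l))).toOuterMeasure
            {p | ((extract p f out order).work : ℝ) ≤
                C' * ((Fintype.card V + E.card) * (1 + Real.log (Fintype.card V))) ∧
              certComplexity E (outputShortcut E rep p f out order) ≤
                (⌊C' * (E.card * (1 + Real.log (Fintype.card V)) ^ k)⌋₊ : ℕ∞)} := by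
  -- The exponent 2 is one logarithm for the depth of the treaps and one for the recursion on
  -- chains. The constant comes from `3 * (3 * l + n₀ / l) + 2`, with `n₀` the number of roots and
  -- the final 2 absorbed by `√n ≥ 1`.
  refine ⟨2, fun c₁ c₂ hc₁ hc₂ => ⟨9 * c₂ + 3 / c₁ + 2, fun a => ?_⟩⟩
  set K := ⌈c₂⌉₊ with hK
  set κ : ℝ := 3 * (K : ℝ) ^ 3 + 3 * (a + 4) with hκ
  have hκ0 : 0 ≤ κ := by positivity
  -- The first summand serves the work, the second the certification; `κ * (1 + L)` will bound the
  -- depth `t`.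
  refine ⟨(K + 2) * (3 * κ + 2) + (4 + 24 * κ), ?_⟩
  intro V _ _ E _ rep hrep l hl₁ hl₂ f hf out hout order horder
  have hroute : IsRouting (condense E rep) l f out order :=
    ⟨fun v hv => (mem_condense.1 hv).1 rfl, hf.1, hout, horder⟩
  have hR : Fintype.card (Root rep) ≤ Fintype.card V := Fintype.card_subtype_le _
  -- The lower bound on `l` is positive as soon as there is a root, so division by `l` is only an
  -- issue for the empty graph.
  have hempty : l = 0 → IsEmpty V := by
    intro hl
    rw [hl, Nat.cast_zero] at hl₁
    refine ⟨fun v => ?_⟩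
    have : Nonempty (Root rep) := ⟨hrep.root v⟩
    have h1 : (0 : ℝ) < Fintype.card (Root rep) := by exact_mod_cast Fintype.card_pos
    have h2 := mul_pos hc₁ (Real.sqrt_pos.2 h1)
    linarith
  have hlK := le_ceil_mul_card hc₂ hl₂
  have hcE := card_condense_le hrep
  set n := Fintype.card V with hn
  set m := E.card with hm
  set L := Real.log n with hL
  have hL0 : 0 ≤ L := Real.log_natCast_nonneg n
  have hlog := natLog_two_le_two_mul_log n
  set b := Nat.log 2 n with hb
  refine ⟨fun p => ⟨?_, ?_⟩, ?_⟩
  · rcases Nat.eq_zero_or_pos l with hl | hl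
    · have := hempty hl
      refine ⟨0, by rw [Nat.cast_zero]; positivity, ?_⟩
      exact ⟨fun v => isEmptyElim v, by
        rw [Finset.disjoint_left]; rintro ⟨v, -⟩; exact isEmptyElim v,
        fun s => isEmptyElim s, fun s => isEmptyElim s⟩
    · refine ⟨_, ?_, isShortcut_outputShortcut hrep hroute hf hl p.injective⟩
      have hl' : (0 : ℝ) < l := by exact_mod_cast hl
      have hn1 : 1 ≤ √(n : ℝ) := by
        rw [Real.one_le_sqrt]
        by_contra hcon
        have : n = 0 := by
          by_contra h0
          exact hcon (by exact_mod_cast Nat.one_le_iff_ne_zero.2 h0)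
        rw [this] at hl₂
        simp at hl₂
        omega
      have hdiv : ((Fintype.card (Root rep) / l : ℕ) : ℝ) ≤ √n / c₁ := by
        refine Nat.cast_div_le.trans ?_
        rw [div_le_div_iff₀ hl' hc₁]
        have h1 : √(Fintype.card (Root rep) : ℝ) ≤ √n := Real.sqrt_le_sqrt (by exact_mod_cast hR)
        have h2 := Real.mul_self_sqrt (Nat.cast_nonneg (α := ℝ) (Fintype.card (Root rep)))
        have h3 := Real.sqrt_nonneg (Fintype.card (Root rep) : ℝ)
        calc (Fintype.card (Root rep) : ℝ) * c₁
            = √(Fintype.card (Root rep) : ℝ) * (c₁ * √(Fintype.card (Root rep) : ℝ)) := by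
              linear_combination -c₁ * h2
          _ ≤ √n * l := mul_le_mul h1 hl₁ (by positivity) (by positivity)
      push_cast at hdiv ⊢
      have e : 3 / c₁ * √(n : ℝ) = 3 * (√n / c₁) := by ring
      rw [add_mul, add_mul, e]
      linarith
  · have h1 : ((outputShortcut E rep p f out order).card : ℝ) ≤ n * (2 + b) := by
      exact_mod_cast card_outputShortcut_le hroute p.injective
    have h2 : (n : ℝ) * (2 + b) ≤ n * (2 * (1 + L) ^ 2) :=
      mul_le_mul_of_nonneg_left (by nlinarith) (by positivity)
    have h3 : (2 : ℝ) ≤ 9 * c₂ + 3 / c₁ + 2 := by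
      have : 0 < 3 / c₁ := by positivity
      linarith
    calc _ ≤ _ := h1.trans h2
      _ = 2 * (n * (1 + L) ^ 2) := by ring
      _ ≤ _ := mul_le_mul_of_nonneg_right h3 (by positivity)
  · set t := 3 * K ^ 3 + (a + 4) * (b + 1) with ht
    refine (hroute.isShallow_prob hR hlK (pow_le_two_pow (3 * K ^ 3) n (a + 4))).trans
      ((PMF.uniformOfFintype (Equiv.Perm (Fin l))).toOuterMeasure.mono fun p hp => ?_)
    rw [← hb, ← ht] at hp
    have htκ : (t : ℝ) ≤ κ * (1 + L) := by
      rw [ht, hκ]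
      push_cast
      have h1 : (0 : ℝ) ≤ (K : ℝ) ^ 3 * L := by positivity
      have h2 : (0 : ℝ) ≤ (a + 4) * (2 + L) := by positivity
      have h3 : ((a : ℝ) + 4) * b ≤ (a + 4) * (2 * L) :=
        mul_le_mul_of_nonneg_left hlog (by positivity)
      nlinarith
    refine ⟨?_, ?_⟩
    · have h1 := hroute.extract_work_le hp
      have h2 := hroute.sum_length_out_le
      have h3 : (extract p f out order).work ≤ (K + 2) * (n + m) * (3 * t + 2) := by
        refine h1.trans (Nat.mul_le_mul_right _ ?_)
        nlinarith
      have h4 : ((extract p f out order).work : ℝ) ≤ (K + 2) * (n + m) * (3 * t + 2) := by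
        exact_mod_cast h3
      have h5 : (3 * t + 2 : ℝ) ≤ (3 * κ + 2) * (1 + L) := by nlinarith
      calc _ ≤ _ := h4
        _ ≤ (K + 2) * (n + m) * ((3 * κ + 2) * (1 + L)) :=
          mul_le_mul_of_nonneg_left h5 (by positivity)
        _ = (K + 2) * (3 * κ + 2) * ((n + m) * (1 + L)) := by ring
        _ ≤ _ := mul_le_mul_of_nonneg_right (by linarith) (by positivity)
    · rcases Nat.eq_zero_or_pos l with hl | hl
      · have := hempty hl
        have hH : ∀ D, IsShortcut E (outputShortcut E rep p f out order) D := fun D =>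
          ⟨fun v => isEmptyElim v, by
            rw [Finset.disjoint_left]; rintro ⟨v, -⟩; exact isEmptyElim v,
            fun s => isEmptyElim s, fun s => isEmptyElim s⟩
        refine (iInf₂_le (outputShortcut E rep p f out order)
          ⟨subset_rfl, fun u => isEmptyElim u, 0, hH 0⟩).trans ?_
        rw [Finset.eq_empty_of_isEmpty (outputShortcut E rep p f out order), Finset.card_empty,
          Nat.cast_zero]
        exact zero_le
      · refine (certComplexity_outputShortcut_le hrep hroute hf hl p.injective hp).trans ?_
        rw [Nat.cast_le]
        refine Nat.le_floor ?_
        push_cast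
        have h1 : (4 + 12 * t * b : ℝ) ≤ (4 + 24 * κ) * (1 + L) ^ 2 := by
          have h2 : (t : ℝ) * b ≤ κ * (1 + L) * (2 * L) :=
            mul_le_mul htκ hlog (by positivity) (by positivity)
          have h3 : 0 ≤ κ * (1 + L) := by positivity
          nlinarith
        calc (m : ℝ) * (4 + 12 * t * b) ≤ m * ((4 + 24 * κ) * (1 + L) ^ 2) :=
              mul_le_mul_of_nonneg_left h1 (by positivity)
          _ = (4 + 24 * κ) * (m * (1 + L) ^ 2) := by ring
          _ ≤ _ := mul_le_mul_of_nonneg_right (by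
            have : 0 ≤ ((K : ℝ) + 2) * (3 * κ + 2) := by positivity
            linarith) (by positivity)
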